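/- **Theorem 4.4.** Setting. Let $\mathbb I\subset\mathbb R$ be a compact non-trivial interval and $E,A:\mathbb I\to\mathbb R^{n,n}$, $f:\mathbb I\to\mathbb R^n$ sufficiently smooth; consider the DAE $E\dot x=Ax+f$. For $\mu\ge 0$ let $M_\mu$ be the $(\mu+1)\times(\mu+1)$ block matrix function with blocks $(M_\mu)_{ij}=\binom ijE^{(i-j)}-\binom i{j+1}A^{(i-j-1)}$, $0\le i,j\le\mu$ (zero for $j>i$), let $\hat N_\mu$ be the block column with blocks $A,\dot A,\dots,A^{(\mu)}$, and $g_\mu$ the block column with blocks $f,\dot f,\dots,f^{(\mu)}$. Hypothesis 2.1 (with characteristic values $\mu,a,d$, $a+d=n$) requires for all $t\in\mathbb I$: (1) $\operatorname{rank}M_\mu=(\mu+1)n-a$, so that there is a smooth $Z_2$ of size $(\mu+1)n\times a$ and pointwise maximal rank with $Z_2^TM_\mu=0$; (2) $\operatorname{rank}\hat A_2=a$ for $\hat A_2=Z_2^T\hat N_\mu$, so that there is a smooth $T_2$ of size $n\times d$ and pointwise maximal rank with $\hat A_2T_2=0$; (3) $\operatorname{rank}ET_2=d$, so that there is a smooth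 $Z_1$ of size $n\times d$ and pointwise maximal rank with $\operatorname{rank}Z_1^TET_2=d$. With such $Z_2,T_2,Z_1$ the reduced DAE is $Z_1^TE\dot x=Z_1^TAx+Z_1^Tf$, $0=\hat A_2x+Z_2^Tg_\mu$. For a smooth pointwise nonsingular $Q$ put $x=Q\begin{bmatrix}x_1\\x_2\end{bmatrix}$ with $x_1$ of size $d$ and $x_2$ of size $a$, and write $\hat A_2Q=[\hat A_{21}\ \hat A_{22}]$. If $\hat A_{22}$ is pointwise nonsingular, solving the algebraic equations for $x_2$, differentiating, eliminating $x_2,\dot x_2$ from the differential equations, and solving for $\dot x_1$ (if its coefficient is pointwise nonsingular) gives the *inherent ODE* $\dot x_1=G(t)x_1+g(t)$ belonging to $Q$. Statement. Let $(E,A)$ be sufficiently smooth, satisfy Hypothesis 2.1 with $\mu,a,d$, and be skew-adjoint, i.e. $E^T=E$ and $A^T=-A-\dot E$ on $\mathbb I$. Then there are $p,q\ge0$ with $p+q=d$ such that, with $S=\operatorname{diag}(I_p,-I_q)$, the following hold. (i) There is a smooth $Q=[\,T_2\ \ T_2'\,]$, pointwise nonsingular, whose first block $T_2$ has $d$ columns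 that form a basis of $\ker\hat A_2$ at every point, with $T_2^TET_2=S$ (so that $Z_1=T_2$ is a possible choice). Moreover $Q$ can be taken of the form $Q=U\operatorname{diag}(W,I_a)$ with $U$ smooth and pointwise orthogonal and $W$ smooth of size $d\times d$. (ii) For every smooth $Q=[\,T_2\ \ T_2'\,]$ that is pointwise nonsingular, has the columns of $T_2$ as a basis of $\ker\hat A_2$ at every point, and satisfies $T_2^TET_2=S$, the inherent ODE can be formed and is $$\dot x_1=S^{-1}J(t)x_1+\tilde f_1(t)$$ with $J$ continuous and pointwise skew-symmetric and independent of $f$, and with a transformed inhomogeneity $\tilde f_1$; both are the same for all choices of $Z_2,T_2,Z_1$ in Hypothesis 2.1. For every $t_0\in\mathbb I$ its flow $\Phi$, given by $\dot\Phi=S^{-1}J(t)\Phi$, $\Phi(t_0)=I_d$, exists on $\mathbb I$ and satisfies $\Phi(t)\in O(p,q)=\{G\in GL(d)\mid G^TSG=S\}$ for all $t\in\mathbb I$. Here "sufficiently smooth" means: there is an $r$ depending only on $n$ and $\mu$ such that for every $0\le k\le\infty$ the statement holds for $E,A$ (and $f$) of class $C^{k+r}$ with $Q,U,W$ (and $Z_2$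 for $T_2=Z_1$ the first block of $Q$) of class $C^{k+1}$, with $J,\tilde f_1$ of class $C^k$, and with arbitrary choices of $Z_2,T_2,Z_1$ of class $C^1$. -/

import Mathlib

open Matrix Set

noncomputable section

namespace LinDAE

/-- A matrix function is of class `C^m` on `I` if each of its entries is. -/
def SmoothOn {ι κ : Type*} (m : ℕ∞) (X : ℝ → Matrix ι κ ℝ) (I : Set ℝ) : Prop :=
  ∀ i j, ContDiffOn ℝ (m : WithTop ℕ∞) (fun t => X t i j) I

/-- A vector function is of class `C^m` on `I` if each of its entries is. -/
def VecSmoothOn {ι : Type*} (m : ℕ∞) (f : ℝ → ι → ℝ) (I : Set ℝ) : Prop :=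
  ∀ i, ContDiffOn ℝ (m : WithTop ℕ∞) (fun t => f t i) I

/-- The entrywise derivative of order `k` of a matrix function, one-sided at the ends of `I`. -/
def iterD {ι κ : Type*} (I : Set ℝ) (k : ℕ) (X : ℝ → Matrix ι κ ℝ) (t : ℝ) : Matrix ι κ ℝ :=
  Matrix.of fun i j => iteratedDerivWithin k (fun s => X s i j) I t

/-- The entrywise first derivative of a matrix function. -/
def matD {ι κ : Type*} (I : Set ℝ) (X : ℝ → Matrix ι κ ℝ) (t : ℝ) : Matrix ι κ ℝ :=
  Matrix.of fun i j => derivWithin (fun s => X s i j) I t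

/-- The entrywise first derivative of a vector function. -/
def vecD {ι : Type*} (I : Set ℝ) (f : ℝ → ι → ℝ) (t : ℝ) : ι → ℝ :=
  fun i => derivWithin (fun s => f s i) I t

/-- The pair `(E, A)` is skew-adjoint on `I`: `Eᵀ = E` and `Aᵀ = -A - Ė`. -/
def IsSkewAdjoint {n : ℕ} (E A : ℝ → Matrix (Fin n) (Fin n) ℝ) (I : Set ℝ) : Prop :=
  ∀ t ∈ I, (E t)ᵀ = E t ∧ (A t)ᵀ = -A t - matD I E t

/-! ### The derivative array

Differentiating `E ẋ - A x = f` exactly `i` times, `0 ≤ i ≤ μ`, gives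
`M_μ (ẋ, …, x^(μ+1)) = N_μ (x, 0, …, 0) + g_μ`. -/

/-- The matrix `M_μ`: by the Leibniz rule the coefficient of `x^(j+1)` in the `i`-th derivative of
`E ẋ - A x` is `C(i,j) E^(i-j) - C(i,j+1) A^(i-j-1)`. The binomial coefficients vanish whenever
the subtraction in the order of the derivative is truncated. -/
def arrayM {n : ℕ} (E A : ℝ → Matrix (Fin n) (Fin n) ℝ) (I : Set ℝ) (μ : ℕ) (t : ℝ) :
    Matrix (Fin (μ + 1) × Fin n) (Fin (μ + 1) × Fin n) ℝ :=
  Matrix.of fun r c =>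
    ((r.1 : ℕ).choose (c.1 : ℕ) : ℝ) * iterD I ((r.1 : ℕ) - (c.1 : ℕ)) E t r.2 c.2
      - ((r.1 : ℕ).choose ((c.1 : ℕ) + 1) : ℝ)
          * iterD I ((r.1 : ℕ) - (c.1 : ℕ) - 1) A t r.2 c.2

/-- The first block column `N_μ [I_n 0 … 0]ᵀ` of `N_μ`, with blocks `A, Ȧ, …, A^(μ)`; the other
block columns of `N_μ` are zero. -/
def arrayN {n : ℕ} (A : ℝ → Matrix (Fin n) (Fin n) ℝ) (I : Set ℝ) (μ : ℕ) (t : ℝ) :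
    Matrix (Fin (μ + 1) × Fin n) (Fin n) ℝ :=
  Matrix.of fun r c => iterD I (r.1 : ℕ) A t r.2 c

/-- The vector `g_μ` with blocks `f, ḟ, …, f^(μ)`. -/
def arrayG {n : ℕ} (f : ℝ → Fin n → ℝ) (I : Set ℝ) (μ : ℕ) (t : ℝ) : Fin (μ + 1) × Fin n → ℝ :=
  fun r => iteratedDerivWithin (r.1 : ℕ) (fun s => f s r.2) I t

/-! ### The regularity hypothesis

The index types `α` and `δ` have `a` and `d` elements. -/

/-- The three conditions of the regularity hypothesis at one point `t`, with the matrices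
`Z₂`, `T₂`, `Z₁` that occur in them; here `Â₂ = Z₂ᵀ N_μ [I_n 0 … 0]ᵀ`. -/
structure RegularAt {n : ℕ} {α δ : Type*} [Fintype α] [Fintype δ]
    (E A : ℝ → Matrix (Fin n) (Fin n) ℝ) (I : Set ℝ) (μ : ℕ) (t : ℝ)
    (Z₂ : Matrix (Fin (μ + 1) × Fin n) α ℝ) (T₂ Z₁ : Matrix (Fin n) δ ℝ) : Prop where
  card_add : Fintype.card α + Fintype.card δ = n
  rank_M : (arrayM E A I μ t).rank + Fintype.card α = (μ + 1) * n
  rank_Z₂ : Z₂.rank = Fintype.card α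
  Z₂_mul_M : Z₂ᵀ * arrayM E A I μ t = 0
  rank_A₂ : (Z₂ᵀ * arrayN A I μ t).rank = Fintype.card α
  rank_T₂ : T₂.rank = Fintype.card δ
  A₂_mul_T₂ : Z₂ᵀ * arrayN A I μ t * T₂ = 0
  rank_E_mul_T₂ : (E t * T₂).rank = Fintype.card δ
  rank_Z₁ : Z₁.rank = Fintype.card δ
  rank_E₁_mul_T₂ : (Z₁ᵀ * E t * T₂).rank = Fintype.card δ

/-- The regularity hypothesis for the linear DAE `E ẋ = A x + f` on `I` with characteristic values
`μ, a, d`. Only the rank conditions are required, at every point of `I`; that `Z₂, T₂, Z₁` can be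
chosen as smooth functions of `t` is a consequence of the constant ranks and is not assumed. -/
def Regular {n : ℕ} (E A : ℝ → Matrix (Fin n) (Fin n) ℝ) (I : Set ℝ) (μ a d : ℕ) : Prop :=
  ∀ t ∈ I, ∃ (Z₂ : Matrix (Fin (μ + 1) × Fin n) (Fin a) ℝ) (T₂ Z₁ : Matrix (Fin n) (Fin d) ℝ),
    RegularAt E A I μ t Z₂ T₂ Z₁

/-- `Z₂, T₂, Z₁` are matrix functions of class `C^m` on `I` as in the regularity hypothesis. -/
structure IsChoice {n : ℕ} {α δ : Type*} [Fintype α] [Fintype δ]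
    (E A : ℝ → Matrix (Fin n) (Fin n) ℝ) (I : Set ℝ) (μ : ℕ) (m : ℕ∞)
    (Z₂ : ℝ → Matrix (Fin (μ + 1) × Fin n) α ℝ) (T₂ Z₁ : ℝ → Matrix (Fin n) δ ℝ) : Prop where
  smooth_Z₂ : SmoothOn m Z₂ I
  smooth_T₂ : SmoothOn m T₂ I
  smooth_Z₁ : SmoothOn m Z₁ I
  regularAt : ∀ t ∈ I, RegularAt E A I μ t (Z₂ t) (T₂ t) (Z₁ t)

/-! ### Reduced DAE and inherent ODE

The reduced DAE is `Ê₁ ẋ = Â₁ x + f̂₁`, `0 = Â₂ x + f̂₂` with `Ê₁ = Z₁ᵀ E`, `Â₁ = Z₁ᵀ A`,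
`f̂₁ = Z₁ᵀ f`, `Â₂ = Z₂ᵀ N_μ [I_n 0 … 0]ᵀ`, `f̂₂ = Z₂ᵀ g_μ`. Inserting `x = Q (x₁, x₂)` turns it into
`Ê₁₁ ẋ₁ + Ê₁₂ ẋ₂ = Â₁₁ x₁ + Â₁₂ x₂ + f̂₁`, `0 = Â₂₁ x₁ + Â₂₂ x₂ + f̂₂`. -/

section Inherent

variable {n : ℕ} {α δ : Type*} [Fintype α] [Fintype δ] [DecidableEq α] [DecidableEq δ]
  (E A : ℝ → Matrix (Fin n) (Fin n) ℝ) (f : ℝ → Fin n → ℝ) (I : Set ℝ) (μ : ℕ)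
  (Z₂ : ℝ → Matrix (Fin (μ + 1) × Fin n) α ℝ) (Z₁ : ℝ → Matrix (Fin n) δ ℝ)
  (Q : ℝ → Matrix (Fin n) (δ ⊕ α) ℝ)

/-- `[Ê₁₁ Ê₁₂] = Ê₁ Q`. -/
def redE₁ (t : ℝ) : Matrix δ (δ ⊕ α) ℝ := (Z₁ t)ᵀ * E t * Q t

/-- `[Â₁₁ Â₁₂] = Â₁ Q - Ê₁ Q̇`. -/
def redA₁ (t : ℝ) : Matrix δ (δ ⊕ α) ℝ := (Z₁ t)ᵀ * A t * Q t - (Z₁ t)ᵀ * E t * matD I Q t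

/-- `[Â₂₁ Â₂₂] = Â₂ Q`. -/
def redA₂ (t : ℝ) : Matrix α (δ ⊕ α) ℝ := (Z₂ t)ᵀ * arrayN A I μ t * Q t

/-- The matrix `Â₂₂`, which has to be nonsingular for the splitting to be admissible. -/
def redA₂₂ (t : ℝ) : Matrix α α ℝ := (redA₂ A I μ Z₂ Q t).toCols₂

/-- The algebraic equations solved for `x₂` read `x₂ = R x₁ + r`; this is `R = -Â₂₂⁻¹ Â₂₁`. -/
def solR (t : ℝ) : Matrix α δ ℝ := -((redA₂₂ A I μ Z₂ Q t)⁻¹ * (redA₂ A I μ Z₂ Q t).toCols₁)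

/-- The inhomogeneity `r = -Â₂₂⁻¹ f̂₂` in `x₂ = R x₁ + r`. -/
def solr (t : ℝ) : α → ℝ :=
  -((redA₂₂ A I μ Z₂ Q t)⁻¹ *ᵥ ((Z₂ t)ᵀ *ᵥ arrayG f I μ t))

/-- The coefficient `Ê₁₁ + Ê₁₂ R` of `ẋ₁` after elimination of `x₂` and `ẋ₂`. -/
def elimE (t : ℝ) : Matrix δ δ ℝ :=
  (redE₁ E Z₁ Q t).toCols₁ + (redE₁ E Z₁ Q t).toCols₂ * solR A I μ Z₂ Q t

/-- The matrix `G` of the inherent ODE `ẋ₁ = G x₁ + g`. -/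
def inherentMatrix (t : ℝ) : Matrix δ δ ℝ :=
  (elimE E A I μ Z₂ Z₁ Q t)⁻¹ *
    ((redA₁ E A I Z₁ Q t).toCols₁ + (redA₁ E A I Z₁ Q t).toCols₂ * solR A I μ Z₂ Q t
      - (redE₁ E Z₁ Q t).toCols₂ * matD I (solR A I μ Z₂ Q) t)

/-- The inhomogeneity `g` of the inherent ODE `ẋ₁ = G x₁ + g`. -/
def inherentForcing (t : ℝ) : δ → ℝ :=
  (elimE E A I μ Z₂ Z₁ Q t)⁻¹ *ᵥ
    ((Z₁ t)ᵀ *ᵥ f t + (redA₁ E A I Z₁ Q t).toCols₂ *ᵥ solr A f I μ Z₂ Q t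
      - (redE₁ E Z₁ Q t).toCols₂ *ᵥ vecD I (solr A f I μ Z₂ Q) t)

end Inherent

/-! ### Generalized orthogonal matrices and flows -/

/-- `S = diag(I_p, -I_q)`. -/
def sigMatrix (p q : ℕ) : Matrix (Fin p ⊕ Fin q) (Fin p ⊕ Fin q) ℝ :=
  Matrix.fromBlocks 1 0 0 (-1)

/-- The generalized orthogonal group `O(p, q)`, as a set of matrices. -/
def genOrthogonal (p q : ℕ) : Set (Matrix (Fin p ⊕ Fin q) (Fin p ⊕ Fin q) ℝ) :=
  {G | IsUnit G ∧ Gᵀ * sigMatrix p q * G = sigMatrix p q}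

/-- `Φ` is the flow on `I` of `ẋ = G x + g` with initial time `s`: `Φ̇ = G Φ`, `Φ(s) = 1`. -/
def IsFlow {δ : Type*} [Fintype δ] [DecidableEq δ] (G : ℝ → Matrix δ δ ℝ) (I : Set ℝ) (s : ℝ)
    (Φ : ℝ → Matrix δ δ ℝ) : Prop :=
  Φ s = 1 ∧ ∀ t ∈ I, ∀ i j, HasDerivWithinAt (fun τ => Φ τ i j) ((G t * Φ t) i j) I t

/-- The class of transformations `Q = [T₂ T₂']` of class `C^m` used for skew-adjoint pairs:
`Q` is pointwise nonsingular, `Z₁ = T₂` is a possible choice in the regularity hypothesis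
(in particular the columns of `T₂` span the kernel of `Â₂`), and `T₂ᵀ E T₂ = diag(I_p, -I_q)`. -/
structure IsAdapted {n a p q : ℕ} (E A : ℝ → Matrix (Fin n) (Fin n) ℝ) (I : Set ℝ) (μ : ℕ)
    (m : ℕ∞) (Q : ℝ → Matrix (Fin n) ((Fin p ⊕ Fin q) ⊕ Fin a) ℝ) : Prop where
  smooth : SmoothOn m Q I
  nonsingular : ∀ t ∈ I, ∃ P : Matrix ((Fin p ⊕ Fin q) ⊕ Fin a) (Fin n) ℝ,
    Q t * P = 1 ∧ P * Q t = 1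
  isChoice : ∃ Z₂ : ℝ → Matrix (Fin (μ + 1) × Fin n) (Fin a) ℝ,
    IsChoice E A I μ m Z₂ (fun t => (Q t).toCols₁) (fun t => (Q t).toCols₁)
  congr_E : ∀ t ∈ I, (Q t).toCols₁ᵀ * E t * (Q t).toCols₁ = sigMatrix p q

/-- `Q = U diag(W, I_a)` with a pointwise orthogonal `U` and a square matrix function `W` that acts
on the first block of variables only, both of class `C^m`. -/
def IsOrthogonalUpToFirstBlock {n a p q : ℕ} (I : Set ℝ) (m : ℕ∞)
    (Q : ℝ → Matrix (Fin n) ((Fin p ⊕ Fin q) ⊕ Fin a) ℝ) : Prop :=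
  ∃ (U : ℝ → Matrix (Fin n) ((Fin p ⊕ Fin q) ⊕ Fin a) ℝ)
    (W : ℝ → Matrix (Fin p ⊕ Fin q) (Fin p ⊕ Fin q) ℝ),
    SmoothOn m U I ∧ SmoothOn m W I ∧
    ∀ t ∈ I, U t * (U t)ᵀ = 1 ∧ (U t)ᵀ * U t = 1 ∧ Q t = U t * Matrix.fromBlocks (W t) 0 0 1

end LinDAE

end

open Matrix Set

noncomputable section

namespace LinDAE

/-! Skew-adjointness of the pair means that the operator D = E d/dt - A satisfies D* = -D. Since Z₂ᵀ
M_μ = 0, the combination Z₂ᵀ (Dx, (Dx)˙, …, (Dx)^(μ)) equals -Â₂ x and contains no derivative of x.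
Passing to formal adjoints yields D y = Â₂ᵀ χ, where y is the formal adjoint of the jet applied to
Z₂ χ (`residual_adjJet`). Right-hand sides in the range of Â₂ᵀ are therefore solved by
differentiation alone. The complementary components, tested with a frame T of ker Â₂, are met by
solving a linear ODE. So Dx = ψ is solvable for every sufficiently smooth ψ
(`IsOrthogonalChoice.exists_residual_eq`), and correcting a polynomial with the right jet gives a
homogeneous solution through every consistent value
(`IsOrthogonalChoice.exists_homogeneous_solution`).

The form Tᵀ E T is nondegenerate because xᵀ E y has derivative (Dx)ᵀ y + xᵀ Dy. For v in its kernel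
at t₀, take Dx = 0 with x(t₀) = T v, and Dy = ω x with a weight ω ≥ 0 flat at t₀ and at another
point t₁, where y(t₁) = 0. Then xᵀ E y vanishes at both points while its derivative is ω |x|², which
forces x(t₀) = 0 (`IsOrthogonalChoice.isUnit_transpose_mul_E_mul`). A nonsingular symmetric matrix
function is smoothly congruent to a constant one, which brings Tᵀ E T to S. Smooth orthogonal kernel
frames come from Kato's transport equation for the orthogonal projections.

For an adapted Q put J = Tᵀ A T - Tᵀ E Ṫ; differentiating Tᵀ E T = S shows that J is skew. Writing
homogeneous solutions as x = T ξ gives E T S J = A T - E Ṫ as an identity in all n rows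
(`IsOrthogonalChoice.E_mul_frame`), not only after multiplication by Tᵀ. Any admissible Z₁ therefore
produces the same matrix S⁻¹ J. The inhomogeneity is read off from the Q-coordinates of one solution
of Dx = f, so it cannot depend on the choices either. The flow preserves Φᵀ S Φ because J is skew.
-/

/-! ### Calculus of matrix functions -/

/-- The entrywise derivative of `X` within `I` at `t` is `X'`. -/
def HasMatDeriv {ι κ : Type*} (I : Set ℝ) (X : ℝ → Matrix ι κ ℝ) (X' : Matrix ι κ ℝ) (t : ℝ) :
    Prop :=
  ∀ i j, HasDerivWithinAt (fun s => X s i j) (X' i j) I t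

section Calculus

variable {ι κ θ : Type*} {I : Set ℝ} {m : ℕ∞} {t : ℝ}

theorem HasMatDeriv.mul [Fintype κ] {X : ℝ → Matrix ι κ ℝ} {Y : ℝ → Matrix κ θ ℝ}
    {X' : Matrix ι κ ℝ} {Y' : Matrix κ θ ℝ} (hX : HasMatDeriv I X X' t)
    (hY : HasMatDeriv I Y Y' t) :
    HasMatDeriv I (fun s => X s * Y s) (X' * Y t + X t * Y') t := by
  intro i j
  simp only [Matrix.mul_apply, Matrix.add_apply, ← Finset.sum_add_distrib]
  exact HasDerivWithinAt.fun_sum fun l _ => (hX i l).mul (hY l j)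

theorem HasMatDeriv.transpose {X : ℝ → Matrix ι κ ℝ} {X' : Matrix ι κ ℝ}
    (hX : HasMatDeriv I X X' t) : HasMatDeriv I (fun s => (X s)ᵀ) X'ᵀ t :=
  fun i j => hX j i

theorem HasMatDeriv.add {X Y : ℝ → Matrix ι κ ℝ} {X' Y' : Matrix ι κ ℝ}
    (hX : HasMatDeriv I X X' t) (hY : HasMatDeriv I Y Y' t) :
    HasMatDeriv I (fun s => X s + Y s) (X' + Y') t :=
  fun i j => (hX i j).add (hY i j)

theorem HasMatDeriv.sub {X Y : ℝ → Matrix ι κ ℝ} {X' Y' : Matrix ι κ ℝ}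
    (hX : HasMatDeriv I X X' t) (hY : HasMatDeriv I Y Y' t) :
    HasMatDeriv I (fun s => X s - Y s) (X' - Y') t :=
  fun i j => (hX i j).sub (hY i j)

theorem hasMatDeriv_const (X : Matrix ι κ ℝ) : HasMatDeriv I (fun _ => X) 0 t :=
  fun _ _ => hasDerivWithinAt_const _ _ _

theorem HasMatDeriv.congr {X Y : ℝ → Matrix ι κ ℝ} {X' : Matrix ι κ ℝ}
    (hX : HasMatDeriv I X X' t) (h : ∀ s ∈ I, Y s = X s) (ht : t ∈ I) :
    HasMatDeriv I Y X' t :=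
  fun i j => (hX i j).congr (fun s hs => by rw [h s hs]) (by rw [h t ht])

theorem HasMatDeriv.matD_eq {X : ℝ → Matrix ι κ ℝ} {X' : Matrix ι κ ℝ}
    (hX : HasMatDeriv I X X' t) (hI : UniqueDiffOn ℝ I) (ht : t ∈ I) : matD I X t = X' := by
  ext i j
  exact (hX i j).derivWithin (hI t ht)

theorem HasMatDeriv.unique {X : ℝ → Matrix ι κ ℝ} {X' X'' : Matrix ι κ ℝ}
    (hX : HasMatDeriv I X X' t) (hX' : HasMatDeriv I X X'' t) (hI : UniqueDiffOn ℝ I)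
    (ht : t ∈ I) : X' = X'' := by
  rw [← hX.matD_eq hI ht, hX'.matD_eq hI ht]

theorem matD_congr {X Y : ℝ → Matrix ι κ ℝ} (h : ∀ s ∈ I, X s = Y s) (ht : t ∈ I) :
    matD I X t = matD I Y t := by
  ext i j
  exact derivWithin_congr (fun s hs => by rw [h s hs]) (by rw [h t ht])

theorem SmoothOn.hasMatDeriv {X : ℝ → Matrix ι κ ℝ} (hX : SmoothOn m X I) (hm : 1 ≤ m)
    (ht : t ∈ I) : HasMatDeriv I X (matD I X t) t := by
  intro i j
  refine DifferentiableWithinAt.hasDerivWithinAt (((hX i j).differentiableOn ?_) t ht)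
  have : m ≠ 0 := by rintro rfl; simp at hm
  exact_mod_cast this

theorem SmoothOn.of_le {m' : ℕ∞} {X : ℝ → Matrix ι κ ℝ} (hX : SmoothOn m X I) (h : m' ≤ m) :
    SmoothOn m' X I :=
  fun i j => (hX i j).of_le (by exact_mod_cast h)

theorem SmoothOn.congr {X Y : ℝ → Matrix ι κ ℝ} (hX : SmoothOn m X I)
    (h : ∀ s ∈ I, Y s = X s) : SmoothOn m Y I :=
  fun i j => (hX i j).congr fun s hs => by rw [h s hs]

theorem smoothOn_const (X : Matrix ι κ ℝ) : SmoothOn m (fun _ => X) I :=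
  fun _ _ => contDiffOn_const

theorem SmoothOn.add {X Y : ℝ → Matrix ι κ ℝ} (hX : SmoothOn m X I) (hY : SmoothOn m Y I) :
    SmoothOn m (fun s => X s + Y s) I :=
  fun i j => (hX i j).add (hY i j)

theorem SmoothOn.sub {X Y : ℝ → Matrix ι κ ℝ} (hX : SmoothOn m X I) (hY : SmoothOn m Y I) :
    SmoothOn m (fun s => X s - Y s) I :=
  fun i j => (hX i j).sub (hY i j)

theorem SmoothOn.smul {a : ℝ → ℝ} {X : ℝ → Matrix ι κ ℝ}
    (ha : ContDiffOn ℝ (m : WithTop ℕ∞) a I) (hX : SmoothOn m X I) :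
    SmoothOn m (fun s => a s • X s) I :=
  fun i j => ha.mul (hX i j)

theorem SmoothOn.transpose {X : ℝ → Matrix ι κ ℝ} (hX : SmoothOn m X I) :
    SmoothOn m (fun s => (X s)ᵀ) I :=
  fun i j => hX j i

theorem SmoothOn.mul [Fintype κ] {X : ℝ → Matrix ι κ ℝ} {Y : ℝ → Matrix κ θ ℝ}
    (hX : SmoothOn m X I) (hY : SmoothOn m Y I) : SmoothOn m (fun s => X s * Y s) I := by
  intro i j
  simp only [Matrix.mul_apply]
  exact ContDiffOn.sum fun l _ => (hX i l).mul (hY l j)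

theorem SmoothOn.matD {X : ℝ → Matrix ι κ ℝ} (hX : SmoothOn (m + 1) X I)
    (hI : UniqueDiffOn ℝ I) : SmoothOn m (matD I X) I :=
  fun i j => (hX i j).derivWithin hI (by exact_mod_cast le_rfl)

theorem contDiffOn_iteratedDerivWithin {k : ℕ} {m' : ℕ∞} {f : ℝ → ℝ}
    (hf : ContDiffOn ℝ (m' : WithTop ℕ∞) f I) (hI : UniqueDiffOn ℝ I) (h : m + k ≤ m') :
    ContDiffOn ℝ (m : WithTop ℕ∞) (iteratedDerivWithin k f I) I := by
  replace hf := hf.of_le (m := ((m + k : ℕ∞) : WithTop ℕ∞)) (by exact_mod_cast h)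
  clear h
  induction k generalizing f with
  | zero => simpa using hf
  | succ k ih =>
    rw [iteratedDerivWithin_succ']
    refine ih (hf.derivWithin hI ?_)
    push_cast
    rw [← add_assoc]

theorem SmoothOn.iterD {X : ℝ → Matrix ι κ ℝ} {k : ℕ} {m' : ℕ∞} (hX : SmoothOn m' X I)
    (hI : UniqueDiffOn ℝ I) (h : m + k ≤ m') : SmoothOn m (iterD I k X) I :=
  fun i j => contDiffOn_iteratedDerivWithin (hX i j) hI h

theorem SmoothOn.contDiffOn_det [Fintype ι] [DecidableEq ι] {X : ℝ → Matrix ι ι ℝ}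
    (hX : SmoothOn m X I) : ContDiffOn ℝ (m : WithTop ℕ∞) (fun s => (X s).det) I := by
  simp only [Matrix.det_apply']
  exact ContDiffOn.sum fun σ _ => contDiffOn_const.mul (contDiffOn_prod fun l _ => hX _ _)

theorem SmoothOn.inv [Fintype ι] [DecidableEq ι] {X : ℝ → Matrix ι ι ℝ}
    (hX : SmoothOn m X I) (h : ∀ s ∈ I, IsUnit (X s)) : SmoothOn m (fun s => (X s)⁻¹) I := by
  have hadj : SmoothOn m (fun s => (X s).adjugate) I := by
    intro i j
    simp only [Matrix.adjugate_apply]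
    refine SmoothOn.contDiffOn_det (X := fun s => (X s).updateRow j (Pi.single i 1)) ?_
    intro k l
    by_cases hk : k = j
    · subst hk; simpa using contDiffOn_const
    · simpa [Matrix.updateRow_ne hk] using hX k l
  refine (SmoothOn.smul (hX.contDiffOn_det.inv fun s hs => ?_) hadj).congr fun s hs => ?_
  · exact ((Matrix.isUnit_iff_isUnit_det _).1 (h s hs)).ne_zero
  · rw [Matrix.inv_def, Ring.inverse_eq_inv', Pi.inv_apply]

end Calculus

/-! ### Linear differential equations on a compact interval -/

section LinearODE

variable {ι κ : Type*} [Fintype ι] {tl tr : ℝ}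

/-- Gronwall forward from `t₀`, and forward again after the reflection t ↦ -t for times before `t₀`.
Monotonicity in the elapsed time makes the bound uniform on the interval. -/
theorem norm_le_gronwallBound_Icc {E : Type*} [NormedAddCommGroup E] [NormedSpace ℝ E]
    {α α' : ℝ → E} {a b K B : ℝ} (hK : 0 ≤ K) (hB : 0 ≤ B)
    (h : ∀ t ∈ Icc a b, HasDerivWithinAt α (α' t) (Icc a b) t)
    (hbd : ∀ t ∈ Icc a b, ‖α' t‖ ≤ K * ‖α t‖ + B) {t₀ : ℝ} (ht₀ : t₀ ∈ Icc a b) :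
    ∀ t ∈ Icc a b, ‖α t‖ ≤ gronwallBound ‖α t₀‖ K B (b - a) := by
  intro t ht
  have hmono := gronwallBound_mono (norm_nonneg (α t₀)) hB hK
  rcases le_total t₀ t with h0 | h0
  · refine (norm_le_gronwallBound_of_norm_deriv_right_le (f := α) (f' := α') (a := t₀) (b := b)
      (fun s hs => ((h s ⟨ht₀.1.trans hs.1, hs.2⟩).continuousWithinAt).mono
        (Icc_subset_Icc ht₀.1 le_rfl))
      (fun s hs => ?_) le_rfl (fun s hs => hbd s ⟨ht₀.1.trans hs.1, hs.2.le⟩) t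
      ⟨h0, ht.2⟩).trans (hmono ?_)
    · refine (h s ⟨ht₀.1.trans hs.1, hs.2.le⟩).mono_of_mem_nhdsWithin ?_
      filter_upwards [Icc_mem_nhdsGE hs.2] with u hu
      exact ⟨(ht₀.1.trans hs.1).trans hu.1, hu.2⟩
    · linarith [ht.2, ht₀.1]
  · have key : ∀ s ∈ Icc (-t₀) (-a),
        HasDerivWithinAt (fun u => α (-u)) (-α' (-s)) (Icc (-t₀) (-a)) s := by
      intro s hs
      have h1 : -s ∈ Icc a b := ⟨by linarith [hs.2], by linarith [hs.1, ht₀.2]⟩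
      have := HasDerivWithinAt.scomp s (t' := Icc a b) (h (-s) h1)
        ((hasDerivAt_neg s).hasDerivWithinAt (s := Icc (-t₀) (-a)))
        (fun u hu => ⟨by linarith [hu.2], by linarith [hu.1, ht₀.2]⟩)
      simpa [Function.comp_def] using this
    have h2 := norm_le_gronwallBound_of_norm_deriv_right_le (f := fun u => α (-u))
      (f' := fun s => -α' (-s)) (a := -t₀) (b := -a) (δ := ‖α t₀‖) (K := K) (ε := B)
      (fun s hs => (key s hs).continuousWithinAt)
      (fun s hs => (key s ⟨hs.1, hs.2.le⟩).mono_of_mem_nhdsWithin (by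
        filter_upwards [Icc_mem_nhdsGE hs.2] with u hu
        exact ⟨hs.1.trans hu.1, hu.2⟩))
      (by simp) (fun s hs => by
        rw [norm_neg]
        exact hbd _ ⟨by linarith [hs.2], by linarith [hs.1, ht₀.2]⟩) (-t)
      ⟨by linarith, by linarith [ht.1]⟩
    simp only [neg_neg] at h2
    exact h2.trans (hmono (by linarith [ht.1, ht₀.2]))

/-- Coordinatewise truncation to `[-ρ, ρ]`. -/
def clamp (ρ : ℝ) (x : ι → ℝ) : ι → ℝ := fun i => max (-ρ) (min ρ (x i))

theorem clamp_eq_self {ρ : ℝ} {x : ι → ℝ} (h : ‖x‖ ≤ ρ) : clamp ρ x = x := by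
  funext i
  have := abs_le.1 ((norm_le_pi_norm x i).trans h)
  simp [clamp, this.1, this.2]

theorem norm_clamp_sub_clamp_le (ρ : ℝ) (x y : ι → ℝ) : ‖clamp ρ x - clamp ρ y‖ ≤ ‖x - y‖ := by
  refine (pi_norm_le_iff_of_nonneg (norm_nonneg _)).2 fun i => ?_
  refine le_trans ?_ (norm_le_pi_norm (x - y) i)
  simp only [clamp, Pi.sub_apply, Real.norm_eq_abs]
  refine (abs_max_sub_max_le_max _ _ _ _).trans ?_
  simp only [sub_self, abs_zero, abs_nonneg, sup_of_le_right]
  refine (abs_min_sub_min_le_max _ _ _ _).trans ?_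
  simp

theorem norm_clamp_le_self {ρ : ℝ} (hρ : 0 ≤ ρ) (x : ι → ℝ) : ‖clamp ρ x‖ ≤ ‖x‖ := by
  have := norm_clamp_sub_clamp_le ρ x 0
  rwa [clamp_eq_self (x := 0) (by simpa using hρ), sub_zero, sub_zero] at this

theorem norm_clamp_le {ρ : ℝ} (hρ : 0 ≤ ρ) (x : ι → ℝ) : ‖clamp ρ x‖ ≤ ρ := by
  refine (pi_norm_le_iff_of_nonneg hρ).2 fun i => ?_
  rw [Real.norm_eq_abs, abs_le]
  exact ⟨le_max_left _ _, max_le (by linarith) (min_le_left _ _)⟩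

/-- Picard–Lindelöf reaches the whole interval only if the right-hand side is bounded relative to
the ball used. The state is therefore truncated inside `G`, and an a priori bound shows that the
truncation never acts on the solution found. -/
theorem exists_linearODE_solution (htl : tl < tr) {G : ℝ → Matrix ι ι ℝ} {b : ℝ → ι → ℝ}
    (hG : ∀ i j, ContinuousOn (fun t => G t i j) (Icc tl tr))
    (hb : ∀ i, ContinuousOn (fun t => b t i) (Icc tl tr)) {t₀ : ℝ} (ht₀ : t₀ ∈ Icc tl tr)
    (x₀ : ι → ℝ) :
    ∃ x : ℝ → ι → ℝ, x t₀ = x₀ ∧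
      ∀ t ∈ Icc tl tr, HasDerivWithinAt x (G t *ᵥ x t + b t) (Icc tl tr) t := by
  have hbc : ContinuousOn b (Icc tl tr) := continuousOn_pi.2 hb
  have hGc : ∀ i, ContinuousOn (fun t => G t i) (Icc tl tr) := fun i => continuousOn_pi.2 (hG i)
  obtain ⟨B, hB⟩ := isCompact_Icc.exists_bound_of_continuousOn hbc
  have hsum : ContinuousOn (fun t => ∑ i, ∑ j, |G t i j|) (Icc tl tr) :=
    continuousOn_finsetSum _ fun i _ => continuousOn_finsetSum _ fun j _ => (hG i j).abs
  obtain ⟨K, hK⟩ := isCompact_Icc.exists_bound_of_continuousOn hsum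
  have hB0 : 0 ≤ B := (norm_nonneg _).trans (hB t₀ ht₀)
  have hK0 : 0 ≤ K := (norm_nonneg _).trans (hK t₀ ht₀)
  have hGle : ∀ t ∈ Icc tl tr, ∀ x : ι → ℝ, ‖G t *ᵥ x‖ ≤ K * ‖x‖ := by
    intro t ht x
    refine (pi_norm_le_iff_of_nonneg (by positivity)).2 fun i => ?_
    have h1 : ‖(G t *ᵥ x) i‖ ≤ (∑ j, |G t i j|) * ‖x‖ := by
      rw [Matrix.mulVec, dotProduct, Finset.sum_mul]
      refine (norm_sum_le _ _).trans (Finset.sum_le_sum fun j _ => ?_)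
      rw [norm_mul, Real.norm_eq_abs (G t i j)]
      exact mul_le_mul_of_nonneg_left (norm_le_pi_norm x j) (abs_nonneg _)
    refine h1.trans (mul_le_mul_of_nonneg_right ?_ (norm_nonneg _))
    refine le_trans ?_ ((le_abs_self _).trans (hK t ht))
    exact Finset.single_le_sum (f := fun i => ∑ j, |G t i j|)
      (fun i _ => Finset.sum_nonneg fun j _ => abs_nonneg _) (Finset.mem_univ i)
  -- The truncated equation obeys the same linear growth bound, so its solution stays within the
  -- Gronwall radius of the original equation.
  set ρ : ℝ := gronwallBound ‖x₀‖ K B (tr - tl) with hρdef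
  have hρ0 : 0 ≤ ρ := by
    have := gronwallBound_mono (norm_nonneg x₀) hB0 hK0 (sub_nonneg.2 htl.le)
    rw [gronwallBound_x0] at this
    exact (norm_nonneg _).trans this
  have hPL : IsPicardLindelof (fun t x => G t *ᵥ clamp ρ x + b t) (⟨t₀, ht₀⟩ : Icc tl tr) x₀
      (⟨(K * ρ + B) * (tr - tl), by have := sub_nonneg.2 htl.le; positivity⟩ : NNReal) 0
      (⟨K * ρ + B, by positivity⟩ : NNReal) (⟨K, hK0⟩ : NNReal) := by
    refine ⟨fun t ht => ?_, fun x _ => ?_, fun t ht x _ => ?_, ?_⟩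
    · refine LipschitzWith.lipschitzOnWith (LipschitzWith.of_dist_le_mul fun x y => ?_)
      rw [dist_eq_norm, dist_eq_norm, add_sub_add_right_eq_sub, ← Matrix.mulVec_sub]
      exact (hGle t ht _).trans
        (mul_le_mul_of_nonneg_left (norm_clamp_sub_clamp_le ρ x y) hK0)
    · refine ContinuousOn.add (continuousOn_pi.2 fun i => ?_) hbc
      exact continuousOn_finsetSum _ fun j _ => (hG i j).mul continuousOn_const
    · refine (norm_add_le _ _).trans (add_le_add ((hGle t ht _).trans ?_) (hB t ht))
      exact mul_le_mul_of_nonneg_left (norm_clamp_le hρ0 x) hK0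
    · have hL : 0 ≤ K * ρ + B := by positivity
      rw [NNReal.coe_zero, sub_zero]
      refine mul_le_mul_of_nonneg_left (max_le ?_ ?_) hL
      · linarith [ht₀.1]
      · linarith [ht₀.2]
  obtain ⟨x, hx0, hx⟩ := hPL.exists_eq_forall_mem_Icc_hasDerivWithinAt₀
  refine ⟨x, hx0, fun t ht => ?_⟩
  have hbound := norm_le_gronwallBound_Icc hK0 hB0 hx (fun s hs =>
    (norm_add_le _ _).trans (add_le_add ((hGle s hs _).trans
      (mul_le_mul_of_nonneg_left (norm_clamp_le_self hρ0 (x s)) hK0)) (hB s hs))) ht₀ t ht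
  have h0 : x t₀ = x₀ := hx0
  rw [h0] at hbound
  have := hx t ht
  rwa [clamp_eq_self hbound] at this

/-- Bootstrapping: if `X` is of class C^k with k ≤ m, then so is `G X + B`, hence `X` is of class
C^(k+1). Finite orders suffice, also for m = ∞. -/
theorem SmoothOn.of_linearODE [Fintype κ] {I : Set ℝ} (hI : UniqueDiffOn ℝ I) {m : ℕ∞}
    {G : ℝ → Matrix ι ι ℝ} {B X : ℝ → Matrix ι κ ℝ} (hG : SmoothOn m G I) (hB : SmoothOn m B I)
    (hX : ∀ t ∈ I, HasMatDeriv I X (G t * X t + B t) t) : SmoothOn (m + 1) X I := by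
  have step : ∀ k : ℕ, (k : ℕ∞) ≤ m → SmoothOn k X I → SmoothOn (k + 1) X I := by
    intro k hk h i j
    rw [show (((k + 1 : ℕ∞) : ℕ∞) : WithTop ℕ∞) = (k : WithTop ℕ∞) + 1 by norm_cast,
      contDiffOn_succ_iff_derivWithin hI]
    refine ⟨fun t ht => (hX t ht i j).differentiableWithinAt, by simp, ?_⟩
    have := (((hG.of_le hk).mul h).add (hB.of_le hk)) i j
    exact this.congr fun t ht => (hX t ht i j).derivWithin (hI t ht)
  have all : ∀ k : ℕ, (k : ℕ∞) ≤ m + 1 → SmoothOn k X I := by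
    intro k
    induction k with
    | zero =>
      intro _ i j
      have h : ContinuousOn (fun t => X t i j) I := fun t ht => (hX t ht i j).continuousWithinAt
      exact_mod_cast contDiffOn_zero.2 h
    | succ k ih =>
      intro hk
      have hk' : (k : ℕ∞) ≤ m := by
        push_cast at hk
        exact (ENat.add_le_add_iff_right (by simp)).1 hk
      simpa using step k hk' (ih (hk'.trans le_self_add))
  intro i j
  rw [contDiffOn_iff_forall_nat_le]
  intro k hk
  exact all k (by exact_mod_cast hk) i j

theorem exists_matODE_solution [Fintype κ] (htl : tl < tr) {m : ℕ∞} {G : ℝ → Matrix ι ι ℝ}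
    {B : ℝ → Matrix ι κ ℝ} (hG : SmoothOn m G (Icc tl tr)) (hB : SmoothOn m B (Icc tl tr))
    {t₀ : ℝ} (ht₀ : t₀ ∈ Icc tl tr) (X₀ : Matrix ι κ ℝ) :
    ∃ X : ℝ → Matrix ι κ ℝ, X t₀ = X₀ ∧ SmoothOn (m + 1) X (Icc tl tr) ∧
      ∀ t ∈ Icc tl tr, HasMatDeriv (Icc tl tr) X (G t * X t + B t) t := by
  choose x hx0 hx using fun j : κ => exists_linearODE_solution htl (G := G)
    (b := fun t i => B t i j) (fun i l => (hG i l).continuousOn) (fun i => (hB i j).continuousOn)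
    ht₀ (fun i => X₀ i j)
  have hD : ∀ t ∈ Icc tl tr, HasMatDeriv (Icc tl tr) (fun t => Matrix.of fun i j => x j t i)
      (G t * (Matrix.of fun i j => x j t i) + B t) t := by
    intro t ht i j
    exact (hasDerivWithinAt_pi.1 (hx j t ht)) i
  refine ⟨fun t => Matrix.of fun i j => x j t i, ?_,
    SmoothOn.of_linearODE (uniqueDiffOn_Icc htl) hG hB hD, hD⟩
  ext i j
  exact congrFun (hx0 j) i

/-- Applied below to the conserved quantities UᵀU, UᵀPU, WᵀYW and ΦᵀSΦ of various linear ODEs. -/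
theorem HasMatDeriv.eq_of_zero {κ' : Type*} {X : ℝ → Matrix κ κ' ℝ}
    (hX : ∀ t ∈ Icc tl tr, HasMatDeriv (Icc tl tr) X 0 t) {s t : ℝ} (hs : s ∈ Icc tl tr)
    (ht : t ∈ Icc tl tr) : X s = X t := by
  ext i j
  have key : ∀ u ∈ Icc tl tr, X u i j = X tl i j := by
    refine constant_of_has_deriv_right_zero (fun u hu => (hX u hu i j).continuousWithinAt)
      fun u hu => ?_
    refine (hX u ⟨hu.1, hu.2.le⟩ i j).mono_of_mem_nhdsWithin ?_
    filter_upwards [Icc_mem_nhdsGE hu.2] with v hv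
    exact ⟨hu.1.trans hv.1, hv.2⟩
  rw [key s hs, key t ht]

end LinearODE


/-! ### Leibniz rules -/

section Leibniz

variable {I : Set ℝ} {t : ℝ}

theorem iteratedDerivWithin_sub_apply (ht : t ∈ I) (hI : UniqueDiffOn ℝ I) {i : ℕ}
    {f g : ℝ → ℝ} (hf : ContDiffWithinAt ℝ i f I t) (hg : ContDiffWithinAt ℝ i g I t) :
    iteratedDerivWithin i (fun s => f s - g s) I t
      = iteratedDerivWithin i f I t - iteratedDerivWithin i g I t :=
  iteratedDerivWithin_sub ht hI hf hg

theorem iteratedDerivWithin_mul_eq_sum (hI : UniqueDiffOn ℝ I) (ht : t ∈ I) {i : ℕ}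
    {f g : ℝ → ℝ} (hf : ContDiffOn ℝ i f I) (hg : ContDiffOn ℝ i g I) :
    iteratedDerivWithin i (fun s => f s * g s) I t = ∑ j ∈ Finset.range (i + 1),
      (i.choose j : ℝ) * iteratedDerivWithin (i - j) f I t * iteratedDerivWithin j g I t := by
  have h := iteratedDerivWithin_mul ht hI (hg t ht) (hf t ht)
  rw [show (fun s => f s * g s) = g * f by ext s; simp [mul_comm], h]
  exact Finset.sum_congr rfl fun j _ => by ring

/-- The Leibniz rule for the formal adjoint of `f ↦ f^(i)`. -/
theorem mul_iteratedDerivWithin_eq_sum (hI : UniqueDiffOn ℝ I) {i : ℕ}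
    {f w : ℝ → ℝ} (hf : ContDiffOn ℝ i f I) (hw : ContDiffOn ℝ i w I) :
    ∀ t ∈ I, f t * ((-1) ^ i * iteratedDerivWithin i w I t) = ∑ j ∈ Finset.range (i + 1),
      (i.choose j : ℝ) * ((-1) ^ j *
        iteratedDerivWithin j (fun s => iteratedDerivWithin (i - j) f I s * w s) I t) := by
  induction i generalizing w with
  | zero => intro t ht; simp
  | succ i ih =>
    intro t ht
    have hw' : ContDiffOn ℝ i (derivWithin w I) I :=
      hw.derivWithin hI (by push_cast; exact le_rfl)
    have h := ih (hf.of_le (by exact_mod_cast i.le_succ)) hw' t ht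
    have key : ∀ j ∈ Finset.range (i + 1),
        iteratedDerivWithin j (fun s => iteratedDerivWithin (i - j) f I s * derivWithin w I s) I t
          = iteratedDerivWithin (j + 1) (fun s => iteratedDerivWithin (i - j) f I s * w s) I t
            - iteratedDerivWithin j
                (fun s => iteratedDerivWithin (i + 1 - j) f I s * w s) I t := by
      intro j hj
      have hj : j ≤ i := Nat.lt_succ_iff.1 (Finset.mem_range.1 hj)
      have e1 : i + 1 - j = (i - j) + 1 := by omega
      have hfj : ContDiffOn ℝ ((j + 1 : ℕ) : WithTop ℕ∞) (iteratedDerivWithin (i - j) f I) I :=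
        contDiffOn_iteratedDerivWithin (m := (j + 1 : ℕ)) (m' := (i + 1 : ℕ)) hf hI
          (by norm_cast; omega)
      have hfj' : ContDiffOn ℝ j (iteratedDerivWithin (i + 1 - j) f I) I :=
        contDiffOn_iteratedDerivWithin (m := (j : ℕ)) (m' := (i + 1 : ℕ)) hf hI
          (by norm_cast; omega)
      have hwj : ContDiffOn ℝ ((j + 1 : ℕ) : WithTop ℕ∞) w I :=
        hw.of_le (by norm_cast; omega)
      rw [iteratedDerivWithin_succ']
      have hd : ContDiffOn ℝ j
          (derivWithin (fun s => iteratedDerivWithin (i - j) f I s * w s) I) I :=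
        (hfj.mul hwj).derivWithin hI (by push_cast; exact le_rfl)
      have hwj0 : ContDiffOn ℝ j w I := hwj.of_le (by norm_cast; omega)
      rw [← iteratedDerivWithin_sub_apply ht hI (hd t ht) ((hfj'.mul hwj0) t ht)]
      refine iteratedDerivWithin_congr (fun s hs => ?_) ht
      rw [derivWithin_fun_mul ((hfj.differentiableOn (by simp)) s hs)
        ((hwj.differentiableOn (by simp)) s hs), e1, iteratedDerivWithin_succ]
      ring
    rw [iteratedDerivWithin_succ', pow_succ]
    have h1 : f t * ((-1) ^ i * -1 * iteratedDerivWithin i (derivWithin w I) I t)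
        = -(f t * ((-1) ^ i * iteratedDerivWithin i (derivWithin w I) I t)) := by ring
    rw [h1, h, Finset.sum_congr rfl fun j hj => by rw [key j hj]]
    set a : ℕ → ℝ := fun j => (-1) ^ j *
      iteratedDerivWithin j (fun s => iteratedDerivWithin (i + 1 - j) f I s * w s) I t with ha
    have h2 : -∑ j ∈ Finset.range (i + 1), (i.choose j : ℝ) * ((-1) ^ j *
        (iteratedDerivWithin (j + 1) (fun s => iteratedDerivWithin (i - j) f I s * w s) I t
          - iteratedDerivWithin j (fun s => iteratedDerivWithin (i + 1 - j) f I s * w s) I t))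
        = ∑ j ∈ Finset.range (i + 1), ((i.choose j : ℝ) * a (j + 1) + (i.choose j : ℝ) * a j) := by
      rw [← Finset.sum_neg_distrib]
      refine Finset.sum_congr rfl fun j _ => ?_
      simp only [ha, Nat.add_sub_add_right]
      ring
    rw [h2, Finset.sum_add_distrib, Finset.sum_range_succ' _ (i + 1)]
    have h3 : ∑ j ∈ Finset.range (i + 1), (i.choose j : ℝ) * a j
        = ∑ j ∈ Finset.range (i + 1), (i.choose (j + 1) : ℝ) * a (j + 1) + a 0 := by
      have h4 := Finset.sum_range_succ' (fun j => (i.choose j : ℝ) * a j) (i + 1)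
      rw [Finset.sum_range_succ _ (i + 1)] at h4
      simpa using h4
    rw [h3, ← add_assoc, ← Finset.sum_add_distrib]
    simp only [Nat.choose_succ_succ', Nat.choose_zero_right, Nat.cast_one, one_mul, Nat.cast_add,
      add_mul]
    rfl

/-- The scalar form of `d^i/dt^i (e ẋ - a x)` in terms of the derivative array. -/
theorem iteratedDerivWithin_residual (hI : UniqueDiffOn ℝ I) (ht : t ∈ I) {i μ : ℕ} (hi : i ≤ μ)
    {e a x : ℝ → ℝ} (he : ContDiffOn ℝ i e I) (ha : ContDiffOn ℝ i a I)
    (hx : ContDiffOn ℝ (i + 1 : ℕ) x I) :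
    iteratedDerivWithin i (fun s => e s * derivWithin x I s - a s * x s) I t
      = ∑ j ∈ Finset.range (μ + 1), ((i.choose j : ℝ) * iteratedDerivWithin (i - j) e I t
          - (i.choose (j + 1) : ℝ) * iteratedDerivWithin (i - j - 1) a I t)
            * iteratedDerivWithin j (derivWithin x I) I t
        - iteratedDerivWithin i a I t * x t := by
  have hx' : ContDiffOn ℝ i (derivWithin x I) I := hx.derivWithin hI (by push_cast; exact le_rfl)
  have hx0 : ContDiffOn ℝ i x I := hx.of_le (by norm_cast; omega)
  rw [iteratedDerivWithin_sub_apply ht hI ((he.mul hx') t ht) ((ha.mul hx0) t ht),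
    iteratedDerivWithin_mul_eq_sum hI ht he hx', iteratedDerivWithin_mul_eq_sum hI ht ha hx0]
  have h1 : ∑ j ∈ Finset.range (i + 1), (i.choose j : ℝ) * iteratedDerivWithin (i - j) e I t
        * iteratedDerivWithin j (derivWithin x I) I t
      = ∑ j ∈ Finset.range (μ + 1), (i.choose j : ℝ) * iteratedDerivWithin (i - j) e I t
        * iteratedDerivWithin j (derivWithin x I) I t := by
    refine Finset.sum_subset (fun j hj => ?_) fun j _ hj => ?_
    · simp only [Finset.mem_range] at *; omega
    · rw [Nat.choose_eq_zero_of_lt (by simp only [Finset.mem_range] at hj; omega)]; simp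
  have h2 : ∑ j ∈ Finset.range i, (i.choose (j + 1) : ℝ) * iteratedDerivWithin (i - (j + 1)) a I t
        * iteratedDerivWithin (j + 1) x I t
      = ∑ j ∈ Finset.range (μ + 1), (i.choose (j + 1) : ℝ) * iteratedDerivWithin (i - j - 1) a I t
        * iteratedDerivWithin j (derivWithin x I) I t := by
    rw [Finset.sum_congr rfl fun j _ => by rw [iteratedDerivWithin_succ', ← Nat.sub_sub]]
    refine Finset.sum_subset (fun j hj => ?_) fun j _ hj => ?_
    · simp only [Finset.mem_range] at *; omega
    · rw [Nat.choose_eq_zero_of_lt (by simp only [Finset.mem_range] at hj; omega)]; simp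
  rw [h1, Finset.sum_range_succ' _ i, h2]
  simp only [sub_mul, Finset.sum_sub_distrib, Nat.choose_zero_right, Nat.cast_one, one_mul,
    Nat.sub_zero, iteratedDerivWithin_zero]
  ring

/-- Both sides are the formal adjoint of x ↦ jet(f x): on the left as multiplication after the
adjoint jet, on the right after expanding the jet of the product by Leibniz. -/
theorem sum_mul_adjoint_eq_sum {π : Type*} [Fintype π] (hI : UniqueDiffOn ℝ I) (ht : t ∈ I)
    {μ : ℕ} {f : π → ℝ → ℝ} {w : ℕ → π → ℝ → ℝ} (hf : ∀ p, ContDiffOn ℝ μ (f p) I)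
    (hw : ∀ i p, ContDiffOn ℝ μ (w i p) I) :
    ∑ p, f p t * ∑ i ∈ Finset.range (μ + 1), (-1) ^ i * iteratedDerivWithin i (w i p) I t
      = ∑ j ∈ Finset.range (μ + 1), (-1) ^ j * iteratedDerivWithin j
          (fun s => ∑ i ∈ Finset.range (μ + 1), ∑ p,
            (i.choose j : ℝ) * iteratedDerivWithin (i - j) (f p) I s * w i p s) I t := by
  have hc : ∀ j ∈ Finset.range (μ + 1), ∀ i ∈ Finset.range (μ + 1), ∀ p,
      ContDiffOn ℝ j (fun s => iteratedDerivWithin (i - j) (f p) I s * w i p s) I := by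
    intro j hj i hi p
    simp only [Finset.mem_range] at hi hj
    refine ContDiffOn.mul ?_ ((hw i p).of_le (by norm_cast; omega))
    exact contDiffOn_iteratedDerivWithin (m := (j : ℕ)) (m' := (μ : ℕ)) (hf p) hI
      (by norm_cast; omega)
  have hR : ∀ j ∈ Finset.range (μ + 1), (-1 : ℝ) ^ j * iteratedDerivWithin j
          (fun s => ∑ i ∈ Finset.range (μ + 1), ∑ p,
            (i.choose j : ℝ) * iteratedDerivWithin (i - j) (f p) I s * w i p s) I t
      = ∑ i ∈ Finset.range (μ + 1), ∑ p, (i.choose j : ℝ) * ((-1) ^ j *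
        iteratedDerivWithin j (fun s => iteratedDerivWithin (i - j) (f p) I s * w i p s) I t) := by
    intro j hj
    simp only [mul_assoc]
    rw [iteratedDerivWithin_fun_sum ht hI fun i hi => ?_, Finset.mul_sum]
    · refine Finset.sum_congr rfl fun i hi => ?_
      rw [iteratedDerivWithin_fun_sum ht hI fun p _ => ?_, Finset.mul_sum]
      · refine Finset.sum_congr rfl fun p _ => ?_
        rw [iteratedDerivWithin_const_mul_field]
        ring
      · exact (contDiffOn_const.mul (hc j hj i hi p)) t ht
    · exact (ContDiffOn.sum fun p _ => contDiffOn_const.mul (hc j hj i hi p)) t ht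
  rw [Finset.sum_congr rfl hR, Finset.sum_comm]
  simp only [Finset.mul_sum]
  rw [Finset.sum_comm]
  refine Finset.sum_congr rfl fun i hi => ?_
  rw [Finset.sum_comm]
  refine Finset.sum_congr rfl fun p _ => ?_
  simp only [Finset.mem_range] at hi
  rw [mul_iteratedDerivWithin_eq_sum hI ((hf p).of_le (by norm_cast; omega))
    ((hw i p).of_le (by norm_cast; omega)) t ht]
  refine Finset.sum_subset (fun j hj => ?_) fun j _ hj => ?_
  · simp only [Finset.mem_range] at *; omega
  · rw [Nat.choose_eq_zero_of_lt (by simp only [Finset.mem_range] at hj; omega)]; simp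

end Leibniz


/-! ### The derivative array as a differential operator -/

section Array

variable {n μ : ℕ} {κ : Type*} {I : Set ℝ} {t : ℝ}

/-- The jet `(X, Ẋ, …, X^(μ))` of a matrix function. -/
def jet (I : Set ℝ) (μ : ℕ) (X : ℝ → Matrix (Fin n) κ ℝ) (t : ℝ) :
    Matrix (Fin (μ + 1) × Fin n) κ ℝ :=
  Matrix.of fun r c => iteratedDerivWithin (r.1 : ℕ) (fun s => X s r.2 c) I t

/-- The residual `E Ẋ - A X` of a matrix function. -/
def residual (E A : ℝ → Matrix (Fin n) (Fin n) ℝ) (I : Set ℝ) (X : ℝ → Matrix (Fin n) κ ℝ)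
    (t : ℝ) : Matrix (Fin n) κ ℝ :=
  E t * matD I X t - A t * X t

/-- The formal adjoint `W ↦ ∑ (-1)^i (d/dt)^i W_i` of the jet. -/
def adjJet (I : Set ℝ) (W : ℝ → Matrix (Fin (μ + 1) × Fin n) κ ℝ) (t : ℝ) :
    Matrix (Fin n) κ ℝ :=
  Matrix.of fun p c => ∑ i : Fin (μ + 1),
    (-1) ^ (i : ℕ) * iteratedDerivWithin (i : ℕ) (fun s => W s (i, p) c) I t

theorem jet_congr {X Y : ℝ → Matrix (Fin n) κ ℝ} (h : ∀ s ∈ I, X s = Y s) (ht : t ∈ I) :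
    jet I μ X t = jet I μ Y t := by
  ext r c
  exact iteratedDerivWithin_congr (fun s hs => by rw [h s hs]) ht

theorem jet_residual (hI : UniqueDiffOn ℝ I) (ht : t ∈ I)
    {E A : ℝ → Matrix (Fin n) (Fin n) ℝ} {X : ℝ → Matrix (Fin n) κ ℝ}
    (hE : SmoothOn μ E I) (hA : SmoothOn μ A I) (hX : SmoothOn (μ + 1) X I) :
    jet I μ (residual E A I X) t
      = arrayM E A I μ t * jet I μ (matD I X) t - arrayN A I μ t * X t := by
  ext ⟨i, p⟩ c
  have hi : (i : ℕ) ≤ μ := Nat.lt_succ_iff.1 i.2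
  have hE' : ∀ q, ContDiffOn ℝ (i : ℕ) (fun s => E s p q) I :=
    fun q => (hE p q).of_le (by exact_mod_cast hi)
  have hA' : ∀ q, ContDiffOn ℝ (i : ℕ) (fun s => A s p q) I :=
    fun q => (hA p q).of_le (by exact_mod_cast hi)
  have hX' : ∀ q, ContDiffOn ℝ ((i + 1 : ℕ) : WithTop ℕ∞) (fun s => X s q c) I :=
    fun q => (hX q c).of_le (by exact_mod_cast Nat.succ_le_succ hi)
  have hX0 : ∀ q, ContDiffOn ℝ (i : ℕ) (fun s => X s q c) I :=
    fun q => (hX' q).of_le (by norm_cast; omega)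
  have hdX : ∀ q, ContDiffOn ℝ (i : ℕ) (derivWithin (fun s => X s q c) I) I :=
    fun q => (hX' q).derivWithin hI (by push_cast; exact le_rfl)
  have e1 : (fun s => residual E A I X s p c) = fun s => ∑ q,
      (E s p q * derivWithin (fun s => X s q c) I s - A s p q * X s q c) := by
    funext s
    simp [residual, Matrix.mul_apply, matD, Finset.sum_sub_distrib]
  have e2 : jet I μ (residual E A I X) t (i, p) c
      = ∑ q, iteratedDerivWithin i (fun s =>
        E s p q * derivWithin (fun s => X s q c) I s - A s p q * X s q c) I t := by
    show iteratedDerivWithin (i : ℕ) (fun s => residual E A I X s p c) I t = _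
    rw [e1]
    refine iteratedDerivWithin_fun_sum (n := (i : ℕ)) (I := Finset.univ) ht hI fun q _ => ?_
    exact (((hE' q).mul (hdX q)).sub ((hA' q).mul (hX0 q))) t ht
  rw [e2, Finset.sum_congr rfl fun q _ =>
    iteratedDerivWithin_residual hI ht hi (hE' q) (hA' q) (hX' q), Finset.sum_sub_distrib,
    Matrix.sub_apply, Matrix.mul_apply, Matrix.mul_apply, Fintype.sum_prod_type, Finset.sum_comm,
    Finset.sum_range]
  rfl

theorem contDiffOn_adjJet (hI : UniqueDiffOn ℝ I) {m : ℕ∞}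
    {W : ℝ → Matrix (Fin (μ + 1) × Fin n) κ ℝ} (hW : SmoothOn (m + μ) W I) :
    SmoothOn m (adjJet I W) I := by
  intro p c
  show ContDiffOn ℝ m (fun t => ∑ i : Fin (μ + 1),
    (-1) ^ (i : ℕ) * iteratedDerivWithin (i : ℕ) (fun s => W s (i, p) c) I t) I
  refine ContDiffOn.sum fun i _ => ContDiffOn.mul contDiffOn_const ?_
  refine contDiffOn_iteratedDerivWithin (hW (i, p) c) hI ?_
  have : ((i : ℕ) : ℕ∞) ≤ μ := by exact_mod_cast Nat.lt_succ_iff.1 i.2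
  gcongr

/-- For a skew-adjoint pair the operator `E d/dt - A` is skew-adjoint, so that `Wᵀ M = 0` yields
solutions of `E ẏ - A y = Nᵀ W`. -/
theorem residual_adjJet (hI : UniqueDiffOn ℝ I) {E A : ℝ → Matrix (Fin n) (Fin n) ℝ}
    {W : ℝ → Matrix (Fin (μ + 1) × Fin n) κ ℝ}
    (hE : SmoothOn (μ + 1) E I) (hA : SmoothOn (μ + 1) A I) (hW : SmoothOn (μ + 1) W I)
    (hskew : IsSkewAdjoint E A I) (hM : ∀ s ∈ I, (arrayM E A I μ s)ᵀ * W s = 0) (ht : t ∈ I) :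
    residual E A I (adjJet I W) t = (arrayN A I μ t)ᵀ * W t := by
  have hy : SmoothOn 1 (adjJet I W) I := contDiffOn_adjJet hI (hW.of_le (by rw [add_comm]))
  have hEt : ∀ s ∈ I, (E s)ᵀ = E s := fun s hs => (hskew s hs).1
  have hdE := hE.hasMatDeriv (by simp) ht
  have hdy := hy.hasMatDeriv le_rfl ht
  have hdEs : (matD I E t)ᵀ = matD I E t :=
    (hdE.transpose.congr (fun s hs => (hEt s hs).symm) ht).unique hdE hI ht
  have hAt : A t = -(A t)ᵀ - matD I E t := by rw [(hskew t ht).2]; abel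
  have hd : HasMatDeriv I (fun s => (E s)ᵀ * adjJet I W s)
      (residual E A I (adjJet I W) t - (A t)ᵀ * adjJet I W t) t := by
    convert hdE.transpose.mul hdy using 1
    rw [residual, hdEs, hEt t ht]
    nth_rw 1 [hAt]
    rw [Matrix.sub_mul, Matrix.neg_mul]
    abel
  ext q c
  -- The blocks of `W` are extended by zero to all natural indices, so that sums over ranges can be
  -- shifted freely.
  obtain ⟨w, hwW, hw⟩ : ∃ w : ℕ → Fin n → ℝ → ℝ,
      (∀ (i : Fin (μ + 1)) p s, w i p s = W s (i, p) c) ∧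
      ∀ i p, ContDiffOn ℝ ((μ + 1 : ℕ) : WithTop ℕ∞) (w i p) I := by
    refine ⟨fun i p s => if h : i < μ + 1 then W s (⟨i, h⟩, p) c else 0, fun i p s => ?_,
      fun i p => ?_⟩
    · simp [Nat.lt_succ_iff.1 i.2]
    · by_cases h : i < μ + 1
      · simp only [h, dif_pos]
        exact hW (⟨i, h⟩, p) c
      · simp only [h, dif_neg, not_false_iff]
        exact contDiffOn_const
  -- With y = `adjJet I W`, Leibniz gives Aᵀ y = ∑ (-1)^j (β j)^(j), and β 0 is the required entry
  -- of Nᵀ W.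
  set β : ℕ → ℝ → ℝ := fun j s => ∑ i ∈ Finset.range (μ + 1), ∑ p : Fin n,
    (i.choose j : ℝ) * iteratedDerivWithin (i - j) (fun s => A s p q) I s *
      w i p s with hβ
  have hβs : ∀ j ≤ μ + 1, ContDiffOn ℝ (j : ℕ) (β j) I := by
    intro j hj
    refine ContDiffOn.sum fun i hi => ContDiffOn.sum fun p _ => ?_
    simp only [Finset.mem_range] at hi
    refine (contDiffOn_const.mul ?_).mul ((hw i p).of_le (by exact_mod_cast hj))
    exact contDiffOn_iteratedDerivWithin (m := (j : ℕ)) (m' := (μ + 1 : ℕ)) (hA p q) hI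
      (by norm_cast; omega)
  have hβtop : β (μ + 1) = 0 := by
    funext s
    refine Finset.sum_eq_zero fun i hi => Finset.sum_eq_zero fun p _ => ?_
    rw [Nat.choose_eq_zero_of_lt (Finset.mem_range.1 hi)]
    simp
  have hadj : ∀ (F : ℝ → Matrix (Fin n) (Fin n) ℝ), SmoothOn (μ + 1) F I → ∀ s ∈ I,
      ((F s)ᵀ * adjJet I W s) q c = ∑ j ∈ Finset.range (μ + 1), (-1) ^ j * iteratedDerivWithin j
        (fun s => ∑ i ∈ Finset.range (μ + 1), ∑ p : Fin n,
          (i.choose j : ℝ) * iteratedDerivWithin (i - j) (fun s => F s p q) I s *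
            w i p s) I s := by
    intro F hF s hs
    rw [← sum_mul_adjoint_eq_sum (f := fun p s => F s p q) hI hs
      (fun p => (hF p q).of_le (by norm_cast; exact le_self_add))
      (fun i p => (hw i p).of_le (by norm_cast; omega)), Matrix.mul_apply]
    refine Finset.sum_congr rfl fun p _ => ?_
    rw [Finset.sum_range]
    have hwW' : ∀ (i : Fin (μ + 1)) p, w i p = fun s => W s (i, p) c :=
      fun i p => funext (hwW i p)
    simp [adjJet, hwW']
  -- Block row j of Mᵀ W = 0 says exactly that the analogue of β j built from `E` is β (j + 1).
  have hε : ∀ s ∈ I, ∀ j ∈ Finset.range (μ + 1), ∑ i ∈ Finset.range (μ + 1), ∑ p : Fin n,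
      (i.choose j : ℝ) * iteratedDerivWithin (i - j) (fun s => E s p q) I s *
        w i p s = β (j + 1) s := by
    intro s hs j hj
    have h := congrFun (congrFun (hM s hs) (⟨j, Finset.mem_range.1 hj⟩, q)) c
    rw [Matrix.mul_apply, Fintype.sum_prod_type, Matrix.zero_apply] at h
    rw [← sub_eq_zero, ← h]
    simp only [hβ, Finset.sum_range]
    rw [← Finset.sum_sub_distrib]
    refine Finset.sum_congr rfl fun i _ => ?_
    rw [← Finset.sum_sub_distrib]
    refine Finset.sum_congr rfl fun p _ => ?_
    simp only [hwW, Matrix.transpose_apply, arrayM, Matrix.of_apply, iterD,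
      Nat.sub_add_eq]
    ring
  have hEy : ∀ s ∈ I, ((E s)ᵀ * adjJet I W s) q c
      = ∑ j ∈ Finset.range (μ + 1), (-1) ^ j * iteratedDerivWithin j (β (j + 1)) I s := by
    intro s hs
    rw [hadj E hE s hs]
    refine Finset.sum_congr rfl fun j hj => ?_
    rw [iteratedDerivWithin_congr (fun u hu => hε u hu j hj) hs]
  have hdsum : HasDerivWithinAt (fun s => ((E s)ᵀ * adjJet I W s) q c)
      (∑ j ∈ Finset.range (μ + 1), (-1) ^ j * iteratedDerivWithin (j + 1) (β (j + 1)) I t) I t := by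
    refine HasDerivWithinAt.congr (HasDerivWithinAt.fun_sum fun j hj => ?_) hEy (hEy t ht)
    refine HasDerivWithinAt.const_mul _ ?_
    rw [iteratedDerivWithin_succ]
    refine DifferentiableWithinAt.hasDerivWithinAt ?_
    have hj : j + 1 ≤ μ + 1 := Nat.succ_le_of_lt (Finset.mem_range.1 hj)
    exact (hβs (j + 1) hj).differentiableOn_iteratedDerivWithin (by norm_cast; omega) hI t ht
  have heq := (hI t ht).eq_deriv _ (hd q c) hdsum
  have hAy := hadj A hA t ht
  rw [Matrix.sub_apply, hAy, sub_eq_iff_eq_add] at heq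
  rw [heq]
  -- The sum for (Eᵀ y)˙ is the one for -Aᵀ y shifted by one: the top term vanishes by `hβtop` and β
  -- 0 is left over.
  have h1 : ∑ j ∈ Finset.range (μ + 1), (-1 : ℝ) ^ j * iteratedDerivWithin (j + 1) (β (j + 1)) I t
      = -∑ j ∈ Finset.range (μ + 1), (-1) ^ j * iteratedDerivWithin j (β j) I t + β 0 t := by
    have h2 := Finset.sum_range_succ' (fun j => (-1 : ℝ) ^ j * iteratedDerivWithin j (β j) I t)
      (μ + 1)
    rw [Finset.sum_range_succ] at h2
    have h3 : iteratedDerivWithin (μ + 1) (β (μ + 1)) I t = 0 := by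
      rw [hβtop]; exact iteratedDerivWithin_const_zero
    rw [h3] at h2
    simp only [pow_succ, mul_neg, mul_one, neg_mul, Finset.sum_neg_distrib, mul_zero, add_zero,
      pow_zero, one_mul, iteratedDerivWithin_zero] at h2
    linarith
  rw [h1]
  have h4 : ((arrayN A I μ t)ᵀ * W t) q c = β 0 t := by
    rw [Matrix.mul_apply, Fintype.sum_prod_type, hβ]
    simp only [Finset.sum_range]
    refine Finset.sum_congr rfl fun i _ => Finset.sum_congr rfl fun p _ => ?_
    simp [arrayN, iterD, hwW]
  rw [h4]
  ring

end Array


/-! ### Linear algebra -/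

section LinearAlgebra

variable {ι κ ν θ δ α ρ : Type*}

theorem toCols₁_mul [Fintype κ] (X : Matrix ι κ ℝ) (Y : Matrix κ (δ ⊕ α) ℝ) :
    (X * Y).toCols₁ = X * Y.toCols₁ := rfl

theorem transpose_toCols₁_mul_toCols₁ [Fintype ν] [DecidableEq δ] [DecidableEq α]
    {U : Matrix ν (δ ⊕ α) ℝ} (h : Uᵀ * U = 1) : (U.toCols₁)ᵀ * U.toCols₁ = 1 := by
  ext i j
  have := congrFun (congrFun h (Sum.inl i)) (Sum.inl j)
  rw [Matrix.one_apply, Matrix.mul_apply] at this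
  rw [Matrix.one_apply, Matrix.mul_apply]
  simpa using this

theorem rank_eq_card_of_mul_eq_one [Fintype ι] [Fintype κ] [DecidableEq κ] {Y : Matrix κ ι ℝ}
    {X : Matrix ι κ ℝ} (h : Y * X = 1) : X.rank = Fintype.card κ := by
  refine le_antisymm X.rank_le_card_width ?_
  rw [← Matrix.rank_one (R := ℝ) (n := κ), ← h]
  exact Matrix.rank_mul_le_right Y X

theorem isUnit_of_rank_eq_card [Fintype κ] [DecidableEq κ] {X : Matrix κ κ ℝ}
    (h : X.rank = Fintype.card κ) : IsUnit X := by
  rw [← Matrix.mulVec_surjective_iff_isUnit]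
  have : LinearMap.range X.mulVecLin = ⊤ := by
    refine Submodule.eq_top_of_finrank_eq ?_
    rw [Module.finrank_fintype_fun_eq_card]
    exact h
  exact LinearMap.range_eq_top.1 this

theorem isUnit_transpose_mul_self [Fintype ι] [Fintype κ] [DecidableEq κ] {X : Matrix ι κ ℝ}
    (h : X.rank = Fintype.card κ) : IsUnit (Xᵀ * X) :=
  isUnit_of_rank_eq_card (by rw [Matrix.rank_transpose_mul_self, h])

/-- If `B C = 0` and the ranks are complementary, the kernel of `B` is the range of `C`. -/
theorem exists_eq_mul_of_mul_eq_zero [Fintype ι] [Fintype κ] [Fintype ν] [DecidableEq θ]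
    [DecidableEq κ] [Fintype θ] {B : Matrix ι κ ℝ} {C : Matrix κ ν ℝ} (hBC : B * C = 0)
    (hr : B.rank + C.rank = Fintype.card κ) {Y : Matrix κ θ ℝ} (hY : B * Y = 0) :
    ∃ K : Matrix ν θ ℝ, Y = C * K := by
  have hle : LinearMap.range C.mulVecLin ≤ LinearMap.ker B.mulVecLin := by
    rintro _ ⟨v, rfl⟩
    simp [hBC]
  have heq : LinearMap.range C.mulVecLin = LinearMap.ker B.mulVecLin := by
    refine Submodule.eq_of_le_of_finrank_eq hle ?_
    have h := LinearMap.finrank_range_add_finrank_ker B.mulVecLin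
    rw [Module.finrank_fintype_fun_eq_card] at h
    have h1 : B.rank = Module.finrank ℝ (LinearMap.range B.mulVecLin) := rfl
    have h2 : C.rank = Module.finrank ℝ (LinearMap.range C.mulVecLin) := rfl
    omega
  have hcol : ∀ j, ∃ v : ν → ℝ, C *ᵥ v = fun i => Y i j := by
    intro j
    have : (fun i => Y i j) ∈ LinearMap.ker B.mulVecLin := by
      rw [LinearMap.mem_ker, Matrix.mulVecLin_apply]
      ext i
      exact congrFun (congrFun hY i) j
    rw [← heq] at this
    exact this
  choose v hv using hcol
  refine ⟨Matrix.of fun i j => v j i, ?_⟩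
  ext i j
  exact (congrFun (hv j) i).symm

theorem exists_orthogonal_diagonalization [Fintype κ] [DecidableEq κ] {H : Matrix κ κ ℝ}
    (hH : Hᵀ = H) : ∃ (V : Matrix κ κ ℝ) (l : κ → ℝ), Vᵀ * V = 1 ∧ V * Vᵀ = 1 ∧
      Vᵀ * H * V = diagonal l := by
  have hH' : H.IsHermitian := hH
  have h1 : (hH'.eigenvectorUnitary : Matrix κ κ ℝ)ᵀ * hH'.eigenvectorUnitary = 1 :=
    Unitary.coe_star_mul_self hH'.eigenvectorUnitary
  refine ⟨hH'.eigenvectorUnitary, hH'.eigenvalues, h1,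
    Unitary.coe_mul_star_self hH'.eigenvectorUnitary, ?_⟩
  have h := hH'.conjStarAlgAut_star_eigenvectorUnitary
  rw [Unitary.conjStarAlgAut_star_apply] at h
  exact h

/-- An orthogonal matrix whose first columns span the kernel of `X`. -/
theorem exists_orthogonal_kernel_frame [Fintype ρ] [Fintype ν] [DecidableEq ν] [Fintype δ]
    [Fintype α] [DecidableEq δ] [DecidableEq α] (X : Matrix ρ ν ℝ)
    (hcard : Fintype.card δ + Fintype.card α = Fintype.card ν)
    (hr : X.rank + Fintype.card δ = Fintype.card ν) :
    ∃ U : Matrix ν (δ ⊕ α) ℝ, Uᵀ * U = 1 ∧ U * Uᵀ = 1 ∧ X * U.toCols₁ = 0 := by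
  -- The eigenvectors of XᵀX for the eigenvalue zero span ker X; reordering the columns puts them
  -- first.
  obtain ⟨V, l, hV1, hV2, hV⟩ := exists_orthogonal_diagonalization (H := Xᵀ * X) (by simp)
  have hXV : (X * V)ᵀ * (X * V) = diagonal l := by
    rw [← hV]; simp only [Matrix.transpose_mul, Matrix.mul_assoc]
  have hdet : IsUnit V.det := (Matrix.isUnit_iff_isUnit_det _).1 (IsUnit.of_mul_eq_one _ hV2)
  have hrank : Fintype.card {i // l i ≠ 0} = X.rank := by
    rw [← Matrix.rank_diagonal, ← hXV, Matrix.rank_transpose_mul_self,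
      Matrix.rank_mul_eq_left_of_isUnit_det V X hdet]
  have hc := Fintype.card_subtype_compl (fun i => l i ≠ 0)
  simp only [not_not] at hc
  have hle : Fintype.card {i // l i ≠ 0} ≤ Fintype.card ν := Fintype.card_subtype_le _
  let e₁ : δ ≃ {i // l i = 0} := Fintype.equivOfCardEq (by omega)
  let e₂ : α ≃ {i // ¬ l i = 0} := Fintype.equivOfCardEq (by
    have : Fintype.card {i // ¬ l i = 0} = Fintype.card {i // l i ≠ 0} := rfl
    omega)
  let e : δ ⊕ α ≃ ν := (Equiv.sumCongr e₁ e₂).trans (Equiv.sumCompl fun i => l i = 0)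
  refine ⟨V.submatrix id e, ?_, ?_, ?_⟩
  · have h := Matrix.submatrix_mul_equiv Vᵀ V e (Equiv.refl ν) e
    rw [hV1, Matrix.submatrix_one_equiv] at h
    exact h
  · rw [Matrix.transpose_submatrix, Matrix.submatrix_mul_equiv, hV2, Matrix.submatrix_id_id]
  · ext i j
    have hl : l (e (Sum.inl j)) = 0 := (e₁ j).2
    have h := congrFun (congrFun hXV (e (Sum.inl j))) (e (Sum.inl j))
    rw [Matrix.diagonal_apply_eq, hl, Matrix.mul_apply] at h
    simp only [Matrix.transpose_apply] at h
    have h0 := (Finset.sum_eq_zero_iff_of_nonneg fun k _ =>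
      mul_self_nonneg ((X * V) k (e (Sum.inl j)))).1 h i (Finset.mem_univ i)
    exact mul_self_eq_zero.1 h0

/-- **Sylvester's law of inertia**, existence of the normal form. -/
theorem exists_congr_sigMatrix [Fintype κ] [DecidableEq κ] {X : Matrix κ κ ℝ} (hX : Xᵀ = X)
    (hu : IsUnit X) : ∃ (p q : ℕ) (e : Fin p ⊕ Fin q ≃ κ)
      (W : Matrix (Fin p ⊕ Fin q) (Fin p ⊕ Fin q) ℝ),
      Wᵀ * X.submatrix e e * W = sigMatrix p q := by
  obtain ⟨V, l, hV1, hV2, hV⟩ := exists_orthogonal_diagonalization hX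
  have hl : ∀ i, l i ≠ 0 := by
    have hdet : (diagonal l).det ≠ 0 := by
      rw [← hV, Matrix.det_mul, Matrix.det_mul]
      have h1 : (Vᵀ).det * V.det = 1 := by rw [← Matrix.det_mul, hV1, Matrix.det_one]
      have h2 := ((Matrix.isUnit_iff_isUnit_det _).1 hu).ne_zero
      rw [mul_right_comm, h1, one_mul]
      exact h2
    rw [Matrix.det_diagonal] at hdet
    exact fun i => Finset.prod_ne_zero_iff.1 hdet i (Finset.mem_univ i)
  classical
  -- As no eigenvalue is zero, the second summand collects the negative ones; p and q are the two
  -- multiplicities.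
  let e : Fin (Fintype.card {i // 0 < l i}) ⊕ Fin (Fintype.card {i // ¬ 0 < l i}) ≃ κ :=
    (Equiv.sumCongr (Fintype.equivFin _).symm (Fintype.equivFin _).symm).trans
      (Equiv.sumCompl fun i => 0 < l i)
  refine ⟨_, _, e, (V * diagonal fun i => (Real.sqrt |l i|)⁻¹).submatrix e e, ?_⟩
  rw [Matrix.transpose_submatrix, Matrix.submatrix_mul_equiv, Matrix.submatrix_mul_equiv,
    Matrix.transpose_mul, Matrix.diagonal_transpose]
  have h1 : diagonal (fun i => (Real.sqrt |l i|)⁻¹) * Vᵀ * X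
      * (V * diagonal fun i => (Real.sqrt |l i|)⁻¹) = diagonal fun i => l i / |l i| := by
    have h2 : diagonal (fun i => (Real.sqrt |l i|)⁻¹) * Vᵀ * X
        * (V * diagonal fun i => (Real.sqrt |l i|)⁻¹)
        = diagonal (fun i => (Real.sqrt |l i|)⁻¹) * (Vᵀ * X * V)
          * diagonal fun i => (Real.sqrt |l i|)⁻¹ := by
      simp only [Matrix.mul_assoc]
    rw [h2, hV, Matrix.diagonal_mul_diagonal, Matrix.diagonal_mul_diagonal]
    congr 1
    funext i
    have h3 : Real.sqrt |l i| * Real.sqrt |l i| = |l i| := Real.mul_self_sqrt (abs_nonneg _)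
    rw [mul_right_comm, ← mul_inv, h3, div_eq_inv_mul]
  rw [h1, Matrix.submatrix_diagonal_equiv]
  have hpos : ∀ j, 0 < l (e (Sum.inl j)) := fun j => ((Fintype.equivFin _).symm j).2
  have hneg : ∀ j, l (e (Sum.inr j)) < 0 := fun j =>
    lt_of_le_of_ne (not_lt.1 ((Fintype.equivFin {i // ¬ 0 < l i}).symm j).2) (hl _)
  have h4 : (fun i => l i / |l i|) ∘ e = Sum.elim (fun _ => (1 : ℝ)) fun _ => -1 := by
    funext i
    rcases i with j | j
    · simp only [Function.comp_apply, Sum.elim_inl]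
      rw [abs_of_pos (hpos j), div_self (hpos j).ne']
    · simp only [Function.comp_apply, Sum.elim_inr]
      rw [abs_of_neg (hneg j), div_neg, div_self (hneg j).ne]
  rw [h4, ← Matrix.fromBlocks_diagonal, sigMatrix, Matrix.diagonal_one]
  congr 1
  rw [← Matrix.diagonal_one, Matrix.diagonal_neg]

theorem sigMatrix_mul_self (p q : ℕ) : sigMatrix p q * sigMatrix p q = 1 := by
  simp [sigMatrix, Matrix.fromBlocks_multiply]

theorem sigMatrix_inv (p q : ℕ) : (sigMatrix p q)⁻¹ = sigMatrix p q :=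
  Matrix.inv_eq_left_inv (sigMatrix_mul_self p q)

theorem sigMatrix_transpose (p q : ℕ) : (sigMatrix p q)ᵀ = sigMatrix p q := by
  simp [sigMatrix, Matrix.fromBlocks_transpose]

end LinearAlgebra

/-! ### Smooth frames of kernels -/

section Frames

variable {ν δ α ρ : Type*} [Fintype ρ] [Fintype ν] [DecidableEq ν] [Fintype δ] [Fintype α]
  [DecidableEq δ] [DecidableEq α]

theorem SmoothOn.mono {ι κ : Type*} {m : ℕ∞} {X : ℝ → Matrix ι κ ℝ} {I I' : Set ℝ}
    (hX : SmoothOn m X I) (h : I' ⊆ I) : SmoothOn m X I' :=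
  fun i j => (hX i j).mono h

/-- The orthogonal projections onto the kernels of a matrix function of constant rank depend
smoothly on the parameter. -/
theorem SmoothOn.kernelProjection {m : ℕ∞} {I : Set ℝ} {X : ℝ → Matrix ρ ν ℝ}
    {K : ℝ → Matrix ν δ ℝ} (hX : SmoothOn m X I) (hXK : ∀ t ∈ I, X t * K t = 0)
    (hK : ∀ t ∈ I, (K t)ᵀ * K t = 1)
    (hr : ∀ t ∈ I, (X t).rank + Fintype.card δ = Fintype.card ν) :
    SmoothOn m (fun t => K t * (K t)ᵀ) I := by
  intro i j t₁ ht₁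
  -- Freezing `K` at `t₁` keeps `H` smooth although `K` itself may be discontinuous. The quadratic
  -- form of `H t₁` is |X v|² + |K₁ᵀ v|², so `H` is nonsingular near `t₁`.
  set H : ℝ → Matrix ν ν ℝ := fun t => (X t)ᵀ * X t + K t₁ * (K t₁)ᵀ with hH
  have hHs : SmoothOn m H I := (hX.transpose.mul hX).add (smoothOn_const _)
  have hH₁ : (H t₁).det ≠ 0 := by
    intro h0
    obtain ⟨v, hv0, hv⟩ := Matrix.exists_mulVec_eq_zero_iff.2 h0
    have h1 : (X t₁ *ᵥ v) ⬝ᵥ (X t₁ *ᵥ v) + ((K t₁)ᵀ *ᵥ v) ⬝ᵥ ((K t₁)ᵀ *ᵥ v) = 0 := by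
      have h2 : v ⬝ᵥ (H t₁ *ᵥ v) = 0 := by rw [hv, dotProduct_zero]
      rw [hH] at h2
      simp only [Matrix.add_mulVec, dotProduct_add, ← Matrix.mulVec_mulVec] at h2
      rw [Matrix.dotProduct_mulVec, Matrix.vecMul_transpose,
        Matrix.dotProduct_mulVec v (K t₁), ← Matrix.mulVec_transpose] at h2
      exact h2
    have h3 : 0 ≤ (X t₁ *ᵥ v) ⬝ᵥ (X t₁ *ᵥ v) := Finset.sum_nonneg fun i _ => mul_self_nonneg _
    have h4 : 0 ≤ ((K t₁)ᵀ *ᵥ v) ⬝ᵥ ((K t₁)ᵀ *ᵥ v) :=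
      Finset.sum_nonneg fun i _ => mul_self_nonneg _
    have h5 : X t₁ *ᵥ v = 0 := dotProduct_self_eq_zero.1 (by linarith)
    have h6 : (K t₁)ᵀ *ᵥ v = 0 := dotProduct_self_eq_zero.1 (by linarith)
    have h7 : X t₁ * replicateCol Unit v = 0 := by
      ext a b; exact congrFun h5 a
    obtain ⟨w, hw⟩ := exists_eq_mul_of_mul_eq_zero (hXK t₁ ht₁)
      (by rw [rank_eq_card_of_mul_eq_one (hK t₁ ht₁)]; exact hr t₁ ht₁) h7
    have h8 : (K t₁)ᵀ * replicateCol Unit v = 0 := by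
      ext a b; exact congrFun h6 a
    rw [hw, ← Matrix.mul_assoc, hK t₁ ht₁, Matrix.one_mul] at h8
    rw [h8, Matrix.mul_zero] at hw
    exact hv0 (funext fun a => congrFun (congrFun hw a) ())
  obtain ⟨O, hO, hOI⟩ := continuousOn_iff'.1 hHs.contDiffOn_det.continuousOn {0}ᶜ
    isOpen_compl_singleton
  have ht₁O : t₁ ∈ O := by
    have : t₁ ∈ (fun s => (H s).det) ⁻¹' {0}ᶜ ∩ I := ⟨hH₁, ht₁⟩
    rw [hOI] at this
    exact this.1
  have hunit : ∀ t ∈ I ∩ O, IsUnit (H t).det := by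
    intro t ht
    have : t ∈ O ∩ I := ⟨ht.2, ht.1⟩
    rw [← hOI] at this
    exact isUnit_iff_ne_zero.2 this.1
  -- From H K = K₁ (K₁ᵀ K), this is a smooth local basis of ker X, and the projection is Z (ZᵀZ)⁻¹
  -- Zᵀ whichever `K` was chosen.
  set Z : ℝ → Matrix ν δ ℝ := fun t => (H t)⁻¹ * K t₁ with hZ
  have hZs : SmoothOn m Z (I ∩ O) :=
    ((hHs.mono inter_subset_left).inv fun t ht =>
      (Matrix.isUnit_iff_isUnit_det _).2 (hunit t ht)).mul (smoothOn_const _)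
  have hKZ : ∀ t ∈ I ∩ O, K t = Z t * ((K t₁)ᵀ * K t) := by
    intro t ht
    have h1 : H t * K t = K t₁ * ((K t₁)ᵀ * K t) := by
      rw [hH]
      simp only [Matrix.add_mul, Matrix.mul_assoc, hXK t ht.1, Matrix.mul_zero, zero_add]
    rw [hZ, Matrix.mul_assoc, ← h1, Matrix.nonsing_inv_mul_cancel_left _ _ (hunit t ht)]
  have hM : ∀ t ∈ I ∩ O, IsUnit ((K t₁)ᵀ * K t).det := by
    intro t ht
    refine (Matrix.isUnit_iff_isUnit_det _).1 (IsUnit.of_mul_eq_one_right ((K t)ᵀ * Z t) ?_)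
    rw [Matrix.mul_assoc, ← hKZ t ht, hK t ht.1]
  have hZK : ∀ t ∈ I ∩ O, Z t = K t * ((K t₁)ᵀ * K t)⁻¹ := by
    intro t ht
    have h1 := congrArg (fun Y => Y * ((K t₁)ᵀ * K t)⁻¹) (hKZ t ht)
    simp only [Matrix.mul_nonsing_inv_cancel_right _ _ (hM t ht)] at h1
    exact h1.symm
  have hZZ : ∀ t ∈ I ∩ O, ((K t₁)ᵀ * K t)ᵀ * ((Z t)ᵀ * Z t) * ((K t₁)ᵀ * K t) = 1 := by
    intro t ht
    have h1 : ((K t₁)ᵀ * K t)ᵀ * ((Z t)ᵀ * Z t) * ((K t₁)ᵀ * K t)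
        = (Z t * ((K t₁)ᵀ * K t))ᵀ * (Z t * ((K t₁)ᵀ * K t)) := by
      simp only [Matrix.transpose_mul, Matrix.mul_assoc]
    rw [h1, ← hKZ t ht, hK t ht.1]
  have hP : SmoothOn m (fun t => K t * (K t)ᵀ) (I ∩ O) := by
    have hu : ∀ t ∈ I ∩ O, IsUnit ((Z t)ᵀ * Z t) := by
      intro t ht
      have h1 := hZZ t ht
      rw [Matrix.mul_assoc] at h1
      have h2 := mul_eq_one_comm.1 h1
      rw [Matrix.mul_assoc] at h2
      exact IsUnit.of_mul_eq_one _ h2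
    refine ((hZs.mul ((hZs.transpose.mul hZs).inv hu)).mul hZs.transpose).congr fun t ht => ?_
    have h1 := hZZ t ht
    rw [Matrix.mul_assoc] at h1
    have h2 := mul_eq_one_comm.1 h1
    rw [Matrix.mul_assoc] at h2
    rw [Matrix.inv_eq_right_inv h2]
    conv_lhs => rw [hKZ t ht]
    simp only [Matrix.transpose_mul, Matrix.mul_assoc]
  exact (contDiffWithinAt_inter (hO.mem_nhds ht₁O)).1 (hP i j t₁ ⟨ht₁, ht₁O⟩)

/-- A matrix function of constant rank on a compact interval has a smooth orthogonal frame whose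
first columns span its kernel. -/
theorem exists_smooth_kernel_frame {tl tr : ℝ} (htl : tl < tr) {m : ℕ∞} {X : ℝ → Matrix ρ ν ℝ}
    (hX : SmoothOn (m + 1) X (Icc tl tr))
    (hcard : Fintype.card δ + Fintype.card α = Fintype.card ν)
    (hr : ∀ t ∈ Icc tl tr, (X t).rank + Fintype.card δ = Fintype.card ν) :
    ∃ U : ℝ → Matrix ν (δ ⊕ α) ℝ, SmoothOn (m + 1) U (Icc tl tr) ∧
      ∀ t ∈ Icc tl tr, (U t)ᵀ * U t = 1 ∧ U t * (U t)ᵀ = 1 ∧ X t * (U t).toCols₁ = 0 := by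
  have hI := uniqueDiffOn_Icc htl
  have htl' : tl ∈ Icc tl tr := left_mem_Icc.2 htl.le
  have hex : ∀ t, ∃ V : Matrix ν (δ ⊕ α) ℝ, t ∈ Icc tl tr →
      Vᵀ * V = 1 ∧ V * Vᵀ = 1 ∧ X t * V.toCols₁ = 0 := by
    intro t
    by_cases ht : t ∈ Icc tl tr
    · obtain ⟨V, hV⟩ := exists_orthogonal_kernel_frame (α := α) (X t) hcard (hr t ht)
      exact ⟨V, fun _ => hV⟩
    · exact ⟨0, fun h => absurd h ht⟩
  -- These pointwise frames carry no continuity; only the projections they define are smooth.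
  choose V hV using hex
  set K : ℝ → Matrix ν δ ℝ := fun t => (V t).toCols₁ with hKdef
  have hXK : ∀ t ∈ Icc tl tr, X t * K t = 0 := fun t ht => (hV t ht).2.2
  have hKK : ∀ t ∈ Icc tl tr, (K t)ᵀ * K t = 1 := fun t ht =>
    transpose_toCols₁_mul_toCols₁ (hV t ht).1
  set P : ℝ → Matrix ν ν ℝ := fun t => K t * (K t)ᵀ with hPdef
  have hP : SmoothOn (m + 1) P (Icc tl tr) := hX.kernelProjection hXK hKK hr
  have hPt : ∀ t, (P t)ᵀ = P t := fun t => by simp [hPdef]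
  have hPP : ∀ t ∈ Icc tl tr, P t * P t = P t := by
    intro t ht
    simp only [hPdef]
    rw [Matrix.mul_assoc, ← Matrix.mul_assoc (K t)ᵀ, hKK t ht, Matrix.one_mul]
  have hXP : ∀ t ∈ Icc tl tr, X t * P t = 0 := by
    intro t ht
    rw [hPdef, ← Matrix.mul_assoc, hXK t ht, Matrix.zero_mul]
  have hD : ∀ t ∈ Icc tl tr, HasMatDeriv (Icc tl tr) P (matD (Icc tl tr) P t) t :=
    fun t ht => hP.hasMatDeriv le_add_self ht
  set D : ℝ → Matrix ν ν ℝ := matD (Icc tl tr) P with hDdef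
  have hDt : ∀ t ∈ Icc tl tr, (D t)ᵀ = D t := fun t ht =>
    ((hD t ht).transpose.congr (fun s _ => (hPt s).symm) ht).unique (hD t ht) hI ht
  have hDP : ∀ t ∈ Icc tl tr, D t * P t + P t * D t = D t := fun t ht =>
    (((hD t ht).mul (hD t ht)).congr (fun s hs => (hPP s hs).symm) ht).unique (hD t ht) hI ht
  have hPDP : ∀ t ∈ Icc tl tr, P t * D t * P t = 0 := by
    intro t ht
    have h := congrArg (fun Y => P t * Y) (hDP t ht)
    simp only [Matrix.mul_add, ← Matrix.mul_assoc, hPP t ht] at h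
    exact add_eq_right.1 h
  -- Kato's transport generator. It is skew, so `U` stays orthogonal, and P Ṗ P = 0 makes UᵀPU
  -- constant, so `U` carries the kernel at `tl` to the kernel at t.
  set G : ℝ → Matrix ν ν ℝ := fun t => D t * P t - P t * D t with hG
  have hGs : SmoothOn m G (Icc tl tr) := by
    have h1 := hP.matD hI
    have h2 : SmoothOn m P (Icc tl tr) := hP.of_le le_self_add
    exact (h1.mul h2).sub (h2.mul h1)
  obtain ⟨U, hU0, hUs, hU⟩ := exists_matODE_solution htl hGs
    (smoothOn_const (0 : Matrix ν (δ ⊕ α) ℝ)) htl' (V tl)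
  simp only [add_zero] at hU
  have hGt : ∀ t ∈ Icc tl tr, (G t)ᵀ = -G t := by
    intro t ht
    simp only [hG, Matrix.transpose_sub, Matrix.transpose_mul, hPt, hDt t ht, neg_sub]
  have hUU : ∀ t ∈ Icc tl tr, (U t)ᵀ * U t = 1 := by
    intro t ht
    rw [← (hV tl htl').1, ← hU0]
    refine HasMatDeriv.eq_of_zero (X := fun s => (U s)ᵀ * U s) (fun s hs => ?_) ht htl'
    convert (hU s hs).transpose.mul (hU s hs) using 1
    rw [Matrix.transpose_mul, hGt s hs, Matrix.mul_neg, Matrix.neg_mul, Matrix.mul_assoc]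
    simp
  have hcardeq : Fintype.card (δ ⊕ α) = Fintype.card ν := by rw [Fintype.card_sum, hcard]
  have hUU' : ∀ t ∈ Icc tl tr, U t * (U t)ᵀ = 1 := fun t ht =>
    (Matrix.mul_eq_one_comm_of_card_eq _ _ _ hcardeq).1 (hUU t ht)
  have hUPU : ∀ t ∈ Icc tl tr, (U t)ᵀ * P t * U t = (V tl)ᵀ * P tl * V tl := by
    intro t ht
    rw [← hU0]
    refine HasMatDeriv.eq_of_zero (X := fun s => (U s)ᵀ * P s * U s) (fun s hs => ?_) ht htl'
    convert ((hU s hs).transpose.mul (hD s hs)).mul (hU s hs) using 1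
    have h1 : G s * P s = D s * P s := by
      rw [hG]
      simp only [Matrix.sub_mul, hPDP s hs, sub_zero]
      rw [Matrix.mul_assoc, hPP s hs]
    have h2 : P s * G s = -(P s * D s) := by
      rw [hG]
      simp only [Matrix.mul_sub, ← Matrix.mul_assoc, hPDP s hs, hPP s hs, zero_sub]
    have h3 : ((G s * U s)ᵀ * P s + (U s)ᵀ * matD (Icc tl tr) P s) * U s
        + (U s)ᵀ * P s * (G s * U s)
        = (U s)ᵀ * (-(G s * P s) + D s + P s * G s) * U s := by
      rw [Matrix.transpose_mul, hGt s hs, ← hDdef]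
      simp only [Matrix.mul_add, Matrix.add_mul, Matrix.mul_neg, Matrix.neg_mul, Matrix.mul_assoc]
    rw [h3, h1, h2]
    have h4 : -(D s * P s) + D s + -(P s * D s) = 0 := by
      nth_rw 2 [← hDP s hs]
      abel
    rw [h4, Matrix.mul_zero, Matrix.zero_mul]
  refine ⟨U, hUs, fun t ht => ⟨hUU t ht, hUU' t ht, ?_⟩⟩
  have hN : ((V tl)ᵀ * P tl * V tl).toCols₁ = (1 : Matrix (δ ⊕ α) (δ ⊕ α) ℝ).toCols₁ := by
    rw [toCols₁_mul, ← (hV tl htl').1, toCols₁_mul]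
    show (V tl)ᵀ * P tl * K tl = (V tl)ᵀ * K tl
    rw [hPdef, Matrix.mul_assoc, Matrix.mul_assoc, hKK tl htl', Matrix.mul_one]
  have h1 : P t * U t = U t * ((V tl)ᵀ * P tl * V tl) := by
    rw [← hUPU t ht, ← Matrix.mul_assoc, ← Matrix.mul_assoc, hUU' t ht, Matrix.one_mul]
  have h2 : X t * (U t * ((V tl)ᵀ * P tl * V tl)).toCols₁ = 0 := by
    rw [← h1, toCols₁_mul, ← Matrix.mul_assoc, hXP t ht, Matrix.zero_mul]
  rw [toCols₁_mul, hN, ← toCols₁_mul, Matrix.mul_one] at h2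
  exact h2

end Frames


/-! ### Functions that vanish to a given order at a point -/

section Flat

variable {ι κ θ : Type*} {I : Set ℝ} {t : ℝ}

/-- `X` vanishes to order `m` at `t`: its derivatives of order at most `m` are zero. -/
def Flat (I : Set ℝ) (t : ℝ) (m : ℕ) (X : ℝ → Matrix ι κ ℝ) : Prop :=
  ∀ i ≤ m, iterD I i X t = 0

theorem Flat.mono {m m' : ℕ} {X : ℝ → Matrix ι κ ℝ} (h : Flat I t m X) (hm : m' ≤ m) :
    Flat I t m' X :=
  fun i hi => h i (hi.trans hm)

theorem Flat.congr {m : ℕ} {X Y : ℝ → Matrix ι κ ℝ} (h : Flat I t m X)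
    (hXY : ∀ s ∈ I, Y s = X s) (ht : t ∈ I) : Flat I t m Y := by
  intro k hk
  rw [← h k hk]
  ext i j
  exact iteratedDerivWithin_congr (fun s hs => by rw [hXY s hs]) ht

theorem Flat.deriv {m : ℕ} {X : ℝ → Matrix ι κ ℝ} (h : Flat I t (m + 1) X) :
    Flat I t m (matD I X) := by
  intro k hk
  rw [← h (k + 1) (Nat.succ_le_succ hk)]
  ext i j
  show iteratedDerivWithin k (derivWithin (fun s => X s i j) I) I t = _
  rw [← iteratedDerivWithin_succ']
  rfl

theorem Flat.of_deriv {m : ℕ} {X : ℝ → Matrix ι κ ℝ} (h0 : X t = 0) (h : Flat I t m (matD I X)) :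
    Flat I t (m + 1) X := by
  intro k hk
  ext i j
  rcases k with _ | k
  · simp [iterD, h0]
  · have := congrFun (congrFun (h k (Nat.le_of_succ_le_succ hk)) i) j
    rw [← this]
    show iteratedDerivWithin (k + 1) (fun s => X s i j) I t = _
    rw [iteratedDerivWithin_succ']
    rfl

theorem Flat.add (hI : UniqueDiffOn ℝ I) (ht : t ∈ I) {m : ℕ} {X Y : ℝ → Matrix ι κ ℝ}
    (hX : Flat I t m X) (hY : Flat I t m Y) (hXs : SmoothOn m X I) (hYs : SmoothOn m Y I) :
    Flat I t m (fun s => X s + Y s) := by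
  intro k hk
  have hk' : (k : WithTop ℕ∞) ≤ ((m : ℕ∞) : WithTop ℕ∞) := by exact_mod_cast hk
  ext i j
  have h1 := congrFun (congrFun (hX k hk) i) j
  have h2 := congrFun (congrFun (hY k hk) i) j
  have := iteratedDerivWithin_add ht hI (((hXs i j).of_le hk') t ht) (((hYs i j).of_le hk') t ht)
  simp only [iterD, Matrix.of_apply, Matrix.zero_apply] at h1 h2 ⊢
  rw [h1, h2, add_zero] at this
  exact this

theorem Flat.mul_left [Fintype κ] (hI : UniqueDiffOn ℝ I) (ht : t ∈ I) {m : ℕ}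
    {G : ℝ → Matrix ι κ ℝ} {X : ℝ → Matrix κ θ ℝ} (hX : Flat I t m X) (hG : SmoothOn m G I)
    (hXs : SmoothOn m X I) : Flat I t m (fun s => G s * X s) := by
  intro k hk
  have hk' : (k : WithTop ℕ∞) ≤ ((m : ℕ∞) : WithTop ℕ∞) := by exact_mod_cast hk
  ext i j
  have hGc : ∀ l, ContDiffOn ℝ k (fun s => G s i l) I := fun l => (hG i l).of_le hk'
  have hXc : ∀ l, ContDiffOn ℝ k (fun s => X s l j) I := fun l => (hXs l j).of_le hk'
  show iteratedDerivWithin k (fun s => (G s * X s) i j) I t = 0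
  simp only [Matrix.mul_apply]
  rw [iteratedDerivWithin_fun_sum ht hI fun l _ => ((hGc l).mul (hXc l)) t ht]
  refine Finset.sum_eq_zero fun l _ => ?_
  rw [iteratedDerivWithin_mul_eq_sum hI ht (hGc l) (hXc l)]
  refine Finset.sum_eq_zero fun r hr => ?_
  have h1 := congrFun (congrFun (hX r (by have := Finset.mem_range.1 hr; omega)) l) j
  simp only [iterD, Matrix.of_apply, Matrix.zero_apply] at h1
  rw [h1, mul_zero]

/-- Each pass through the equation turns flatness of order k of `X` into flatness of order k of `Ẋ`,
hence of order k + 1 of `X`, as long as `B` is flat to order k. -/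
theorem Flat.of_linearODE [Fintype ι] (hI : UniqueDiffOn ℝ I) (ht : t ∈ I) {m : ℕ}
    {G : ℝ → Matrix ι ι ℝ} {B X : ℝ → Matrix ι κ ℝ} (hG : SmoothOn m G I) (hB : SmoothOn m B I)
    (hX : SmoothOn m X I) (hD : ∀ s ∈ I, HasMatDeriv I X (G s * X s + B s) s) (h0 : X t = 0)
    (hBf : Flat I t m B) : Flat I t (m + 1) X := by
  have key : ∀ k ≤ m + 1, Flat I t k X := by
    intro k
    induction k with
    | zero =>
      intro _ i hi
      obtain rfl : i = 0 := Nat.le_zero.1 hi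
      ext a b
      simp [iterD, h0]
    | succ k ih =>
      intro hk
      have hkm : k ≤ m := Nat.le_of_succ_le_succ hk
      have hkm' : (k : ℕ∞) ≤ m := by exact_mod_cast hkm
      have h1 := (ih (hkm.trans m.le_succ)).mul_left hI ht (hG.of_le hkm') (hX.of_le hkm')
      have h2 := h1.add hI ht (hBf.mono hkm) ((hG.of_le hkm').mul (hX.of_le hkm'))
        (hB.of_le hkm')
      exact Flat.of_deriv h0 (h2.congr (fun s hs => (hD s hs).matD_eq hI hs) ht)
  exact key _ le_rfl

theorem Flat.jet_eq_zero {n m : ℕ} {X : ℝ → Matrix (Fin n) κ ℝ} (h : Flat I t m X) :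
    jet I m X t = 0 := by
  ext r c
  exact congrFun (congrFun (h r.1 (Nat.lt_succ_iff.1 r.1.2)) r.2) c

theorem flat_of_jet_eq_zero {n m : ℕ} {X : ℝ → Matrix (Fin n) κ ℝ} (h : jet I m X t = 0) :
    Flat I t m X := by
  intro k hk
  ext i j
  exact congrFun (congrFun h (⟨k, Nat.lt_succ_iff.2 hk⟩, i)) j

theorem Flat.adjJet_eq_zero {n μ : ℕ} {W : ℝ → Matrix (Fin (μ + 1) × Fin n) κ ℝ}
    (h : Flat I t μ W) : adjJet I W t = 0 := by
  ext p c
  show ∑ i : Fin (μ + 1),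
    (-1) ^ (i : ℕ) * iteratedDerivWithin (i : ℕ) (fun s => W s (i, p) c) I t = 0
  refine Finset.sum_eq_zero fun i _ => ?_
  have := congrFun (congrFun (h i (Nat.lt_succ_iff.1 i.2)) (i, p)) c
  simp only [iterD, Matrix.of_apply, Matrix.zero_apply] at this
  rw [this, mul_zero]

theorem iteratedDerivWithin_sub_pow (hI : UniqueDiffOn ℝ I) (ht : t ∈ I) (k i : ℕ) :
    iteratedDerivWithin i (fun s => (s - t) ^ k) I t = if i = k then (k.factorial : ℝ) else 0 := by
  rw [iteratedDerivWithin_eq_iteratedDeriv hI (by fun_prop) ht,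
    iteratedDeriv_comp_sub_const i (fun s : ℝ => s ^ k)]
  simp only [sub_self]
  rw [iteratedDeriv_fun_pow_zero]
  push_cast
  rfl

theorem flat_pow_smul (hI : UniqueDiffOn ℝ I) (ht : t ∈ I) {m k : ℕ} (hk : m < k)
    {X : ℝ → Matrix ι κ ℝ} (hX : SmoothOn m X I) : Flat I t m (fun s => (s - t) ^ k • X s) := by
  intro i hi
  ext a b
  show iteratedDerivWithin i (fun s => (s - t) ^ k * X s a b) I t = 0
  rw [iteratedDerivWithin_mul_eq_sum hI ht (by fun_prop)
    ((hX a b).of_le (by exact_mod_cast hi))]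
  refine Finset.sum_eq_zero fun r _ => ?_
  rw [iteratedDerivWithin_sub_pow hI ht, if_neg (by omega)]
  ring

/-- There is a polynomial with prescribed derivatives at a point. -/
theorem exists_smooth_with_jet (hI : UniqueDiffOn ℝ I) (ht : t ∈ I) {n μ : ℕ}
    (x₀ : Matrix (Fin n) κ ℝ) (Y : Matrix (Fin (μ + 1) × Fin n) κ ℝ) :
    ∃ X : ℝ → Matrix (Fin n) κ ℝ, (∀ m, SmoothOn m X I) ∧ X t = x₀ ∧
      jet I μ (matD I X) t = Y := by
  have hs : ∀ (i : Fin n) (c : κ) (r : Fin (μ + 1)) (m : WithTop ℕ∞), ContDiffOn ℝ m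
      (fun s => Y (r, i) c / ((r : ℕ) + 1).factorial * (s - t) ^ ((r : ℕ) + 1)) I := by
    intro i c r m; fun_prop
  -- The prescribed jet is that of the derivative, so block r is the derivative of order r + 1 of
  -- the Taylor polynomial.
  refine ⟨fun s => Matrix.of fun i c => x₀ i c + ∑ r : Fin (μ + 1),
    Y (r, i) c / ((r : ℕ) + 1).factorial * (s - t) ^ ((r : ℕ) + 1), fun m i c => ?_, ?_, ?_⟩
  · exact contDiffOn_const.add (ContDiffOn.sum fun r _ => hs i c r _)
  · ext i c
    simp
  · ext ⟨k, i⟩ c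
    show iteratedDerivWithin (k : ℕ) (derivWithin (fun s => x₀ i c + ∑ r : Fin (μ + 1),
      Y (r, i) c / ((r : ℕ) + 1).factorial * (s - t) ^ ((r : ℕ) + 1)) I) I t = Y (k, i) c
    rw [← iteratedDerivWithin_succ']
    have h1 := iteratedDerivWithin_add (n := k + 1) (f := fun _ => x₀ i c)
      (g := fun s => ∑ r : Fin (μ + 1), Y (r, i) c / ((r : ℕ) + 1).factorial * (s - t) ^ ((r : ℕ) + 1))
      ht hI contDiffWithinAt_const ((ContDiffOn.sum fun r _ => hs i c r _) t ht)
    refine h1.trans ?_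
    rw [iteratedDerivWithin_fun_sum ht hI fun r _ => hs i c r _ t ht, iteratedDerivWithin_const,
      if_neg (Nat.succ_ne_zero _), zero_add, Finset.sum_eq_single k]
    · rw [iteratedDerivWithin_const_mul_field, iteratedDerivWithin_sub_pow hI ht, if_pos rfl]
      field_simp
    · intro r _ hr
      rw [iteratedDerivWithin_const_mul_field, iteratedDerivWithin_sub_pow hI ht, if_neg, mul_zero]
      intro h
      exact hr (Fin.ext (by omega))
    · simp

end Flat


set_option linter.unusedSectionVars false

/-! ### Pointwise consequences of the regularity hypothesis -/

section RegularAt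

variable {n μ : ℕ} {α δ κ : Type*} [Fintype α] [Fintype δ] [DecidableEq α] [DecidableEq δ]
  [Fintype κ] [DecidableEq κ]
  {E A : ℝ → Matrix (Fin n) (Fin n) ℝ} {I : Set ℝ} {t : ℝ}
  {Z₂ Z₂' : Matrix (Fin (μ + 1) × Fin n) α ℝ} {T₂ Z₁ T₂' Z₁' : Matrix (Fin n) δ ℝ}

theorem RegularAt.exists_eq_Z₂_mul (h : RegularAt E A I μ t Z₂ T₂ Z₁)
    {Y : Matrix (Fin (μ + 1) × Fin n) κ ℝ} (hY : Yᵀ * arrayM E A I μ t = 0) :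
    ∃ K : Matrix α κ ℝ, Y = Z₂ * K := by
  have h1 := congrArg Matrix.transpose h.Z₂_mul_M
  have h2 := congrArg Matrix.transpose hY
  rw [Matrix.transpose_mul, Matrix.transpose_transpose, Matrix.transpose_zero] at h1 h2
  refine exists_eq_mul_of_mul_eq_zero h1 ?_ h2
  rw [Matrix.rank_transpose, h.rank_Z₂, h.rank_M]
  simp

theorem RegularAt.exists_eq_T₂_mul (h : RegularAt E A I μ t Z₂ T₂ Z₁)
    {Y : Matrix (Fin n) κ ℝ} (hY : Z₂ᵀ * arrayN A I μ t * Y = 0) :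
    ∃ K : Matrix δ κ ℝ, Y = T₂ * K := by
  refine exists_eq_mul_of_mul_eq_zero h.A₂_mul_T₂ ?_ hY
  rw [h.rank_A₂, h.rank_T₂, h.card_add, Fintype.card_fin]

/-- The range of M_μ is the kernel of Z₂ᵀ, so a consistent value extends to a formal solution: `K`
holds its derivatives of orders 1 to μ + 1. -/
theorem RegularAt.exists_jet (h : RegularAt E A I μ t Z₂ T₂ Z₁)
    {Y : Matrix (Fin n) κ ℝ} (hY : Z₂ᵀ * arrayN A I μ t * Y = 0) :
    ∃ K : Matrix (Fin (μ + 1) × Fin n) κ ℝ, arrayN A I μ t * Y = arrayM E A I μ t * K := by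
  refine exists_eq_mul_of_mul_eq_zero h.Z₂_mul_M ?_ (by rw [← Matrix.mul_assoc, hY])
  rw [Matrix.rank_transpose, h.rank_Z₂, add_comm, h.rank_M]
  simp

/-- Every left annihilator of M_μ factors through Z₂, so the space of consistent values does not
depend on the choice of Z₂. -/
theorem RegularAt.A₂_mul_T₂_of (h : RegularAt E A I μ t Z₂ T₂ Z₁)
    {Y : Matrix (Fin (μ + 1) × Fin n) κ ℝ} (hY : Yᵀ * arrayM E A I μ t = 0) :
    Yᵀ * arrayN A I μ t * T₂ = 0 := by
  obtain ⟨K, rfl⟩ := h.exists_eq_Z₂_mul hY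
  rw [Matrix.transpose_mul, Matrix.mul_assoc, Matrix.mul_assoc, ← Matrix.mul_assoc Z₂ᵀ,
    h.A₂_mul_T₂, Matrix.mul_zero]

/-- `Z₁ᵀ E` is nonsingular on the range of any possible `T₂`. -/
theorem RegularAt.isUnit_E₁_mul (h : RegularAt E A I μ t Z₂ T₂ Z₁)
    (h' : RegularAt E A I μ t Z₂' T₂' Z₁') : IsUnit (Z₁'ᵀ * E t * T₂) := by
  obtain ⟨K, hK⟩ := h.exists_eq_T₂_mul (h'.A₂_mul_T₂_of h.Z₂_mul_M)
  have h1 := isUnit_of_rank_eq_card h'.rank_E₁_mul_T₂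
  rw [hK, ← Matrix.mul_assoc, Matrix.isUnit_iff_isUnit_det, Matrix.det_mul] at h1
  exact (Matrix.isUnit_iff_isUnit_det _).2 (isUnit_of_mul_isUnit_left h1)

end RegularAt

/-! ### Solvability of regular skew-adjoint systems -/

section Solvability

variable {n μ : ℕ} {α δ κ : Type*} [Fintype α] [Fintype δ] [DecidableEq α] [DecidableEq δ]
  [Fintype κ] [DecidableEq κ] {E A : ℝ → Matrix (Fin n) (Fin n) ℝ} {I : Set ℝ} {t : ℝ}

/-- A smooth choice of `Z₂` together with an orthogonal frame `U = [T₂ T₂']`, where `Z₁ = E T₂`. -/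
structure IsOrthogonalChoice (E A : ℝ → Matrix (Fin n) (Fin n) ℝ) (I : Set ℝ) (μ : ℕ) (m : ℕ∞)
    (Z₂ : ℝ → Matrix (Fin (μ + 1) × Fin n) α ℝ) (U : ℝ → Matrix (Fin n) (δ ⊕ α) ℝ) : Prop where
  smooth_Z₂ : SmoothOn m Z₂ I
  smooth_U : SmoothOn m U I
  transpose_mul : ∀ t ∈ I, (U t)ᵀ * U t = 1
  mul_transpose : ∀ t ∈ I, U t * (U t)ᵀ = 1
  regularAt : ∀ t ∈ I, RegularAt E A I μ t (Z₂ t) (U t).toCols₁ (E t * (U t).toCols₁)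

theorem IsOrthogonalChoice.of_le {m m' : ℕ∞} {Z₂ : ℝ → Matrix (Fin (μ + 1) × Fin n) α ℝ}
    {U : ℝ → Matrix (Fin n) (δ ⊕ α) ℝ} (h : IsOrthogonalChoice E A I μ m Z₂ U) (hm : m' ≤ m) :
    IsOrthogonalChoice E A I μ m' Z₂ U :=
  ⟨h.smooth_Z₂.of_le hm, h.smooth_U.of_le hm, h.transpose_mul, h.mul_transpose, h.regularAt⟩

theorem SmoothOn.arrayM {m : ℕ∞} (hI : UniqueDiffOn ℝ I) (hE : SmoothOn (m + μ) E I)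
    (hA : SmoothOn (m + μ) A I) : SmoothOn m (arrayM E A I μ) I := by
  intro r c
  have h : ∀ k : ℕ, k ≤ μ → m + k ≤ m + (μ : ℕ∞) := fun k hk => by gcongr
  have hr := Nat.lt_succ_iff.1 r.1.2
  exact (contDiffOn_const.mul (hE.iterD hI (h _ (by omega)) _ _)).sub
    (contDiffOn_const.mul (hA.iterD hI (h _ (by omega)) _ _))

theorem SmoothOn.arrayN {m : ℕ∞} (hI : UniqueDiffOn ℝ I) (hA : SmoothOn (m + μ) A I) :
    SmoothOn m (arrayN A I μ) I := by
  intro r c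
  have hr : ((r.1 : ℕ) : ℕ∞) ≤ μ := by exact_mod_cast Nat.lt_succ_iff.1 r.1.2
  exact hA.iterD hI (by gcongr) _ _

/-- Smooth kernel frames are taken twice, for M_μᵀ and then for Â₂. The pointwise witnesses of
regularity factor through the new frames, which transfers the rank conditions. Taking Z₁ = E T₂ is
always admissible, since XᵀX and X have the same rank. -/
theorem Regular.exists_isOrthogonalChoice {tl tr : ℝ} (htl : tl < tr) {m : ℕ∞} {a d : ℕ}
    (hE : SmoothOn (m + 1 + μ) E (Icc tl tr)) (hA : SmoothOn (m + 1 + μ) A (Icc tl tr))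
    (hreg : Regular E A (Icc tl tr) μ a d) :
    ∃ (Z₂ : ℝ → Matrix (Fin (μ + 1) × Fin n) (Fin a) ℝ)
      (U : ℝ → Matrix (Fin n) (Fin d ⊕ Fin a) ℝ),
      IsOrthogonalChoice E A (Icc tl tr) μ (m + 1) Z₂ U := by
  have hI := uniqueDiffOn_Icc htl
  have hM : ∀ t ∈ Icc tl tr, (arrayM E A (Icc tl tr) μ t).rank + a = (μ + 1) * n := by
    intro t ht
    obtain ⟨Z, T, Z', h⟩ := hreg t ht
    simpa using h.rank_M
  have hsum : a + d = n := by
    obtain ⟨Z, T, Z', h⟩ := hreg tl (left_mem_Icc.2 htl.le)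
    simpa using h.card_add
  obtain ⟨V, hVs, hV⟩ := exists_smooth_kernel_frame (δ := Fin a) (α := Fin ((μ + 1) * n - a)) htl
    (SmoothOn.arrayM hI hE hA).transpose
    (by have := hM tl (left_mem_Icc.2 htl.le); simp; omega)
    (fun t ht => by have := hM t ht; simpa [Matrix.rank_transpose] using this)
  set Z₂ : ℝ → Matrix (Fin (μ + 1) × Fin n) (Fin a) ℝ := fun t => (V t).toCols₁ with hZ₂
  have hZs : SmoothOn (m + 1) Z₂ (Icc tl tr) := fun i j => hVs i (Sum.inl j)
  have hZM : ∀ t ∈ Icc tl tr, (Z₂ t)ᵀ * arrayM E A (Icc tl tr) μ t = 0 := by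
    intro t ht
    rw [← Matrix.transpose_transpose (arrayM E A (Icc tl tr) μ t), ← Matrix.transpose_mul,
      (hV t ht).2.2, Matrix.transpose_zero]
  have hZr : ∀ t ∈ Icc tl tr, (Z₂ t).rank = a := fun t ht => by
    simpa using rank_eq_card_of_mul_eq_one (transpose_toCols₁_mul_toCols₁ (hV t ht).1)
  have hAr : ∀ t ∈ Icc tl tr, ((Z₂ t)ᵀ * arrayN A (Icc tl tr) μ t).rank = a := by
    intro t ht
    obtain ⟨Z, T, Z', h⟩ := hreg t ht
    have hK := exists_eq_mul_of_mul_eq_zero (B := (arrayM E A (Icc tl tr) μ t)ᵀ) (C := Z₂ t)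
      (Y := Z) (hV t ht).2.2
      (by rw [Matrix.rank_transpose, hZr t ht, hM t ht]; simp)
      (by rw [← Matrix.transpose_transpose Z, ← Matrix.transpose_mul, h.Z₂_mul_M,
        Matrix.transpose_zero])
    obtain ⟨K, hK⟩ := hK
    have h0 := Matrix.rank_le_card_height ((Z₂ t)ᵀ * arrayN A (Icc tl tr) μ t)
    rw [Fintype.card_fin] at h0
    refine le_antisymm h0 ?_
    have h1 := h.rank_A₂
    rw [hK, Matrix.transpose_mul, Matrix.mul_assoc, Fintype.card_fin] at h1
    exact h1.symm.le.trans (Matrix.rank_mul_le_right _ _)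
  obtain ⟨U, hUs, hU⟩ := exists_smooth_kernel_frame (δ := Fin d) (α := Fin a) htl
    (hZs.transpose.mul (SmoothOn.arrayN hI hA)) (by simp; omega)
    (fun t ht => by rw [hAr t ht]; simpa using hsum)
  refine ⟨Z₂, U, hZs, hUs, fun t ht => (hU t ht).1, fun t ht => (hU t ht).2.1, fun t ht => ?_⟩
  obtain ⟨Z, T, Z', h⟩ := hreg t ht
  have hUr : (U t).toCols₁.rank = d := by
    simpa using rank_eq_card_of_mul_eq_one (transpose_toCols₁_mul_toCols₁ (hU t ht).1)
  have hK := exists_eq_mul_of_mul_eq_zero (Y := T) (hU t ht).2.2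
    (by rw [hAr t ht, hUr, Fintype.card_fin, hsum]) (h.A₂_mul_T₂_of (hZM t ht))
  obtain ⟨K, hK⟩ := hK
  have hEU : (E t * (U t).toCols₁).rank = d := by
    refine le_antisymm (by simpa using Matrix.rank_le_card_width (E t * (U t).toCols₁)) ?_
    have h1 := h.rank_E_mul_T₂
    rw [hK, ← Matrix.mul_assoc, Fintype.card_fin] at h1
    exact h1.symm.le.trans (Matrix.rank_mul_le_left _ _)
  refine ⟨by simpa using hsum, by simpa using hM t ht, by simpa using hZr t ht, hZM t ht,
    by simpa using hAr t ht, by simpa using hUr, (hU t ht).2.2, by simpa using hEU,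
    by simpa using hEU, ?_⟩
  rw [Matrix.mul_assoc, Matrix.rank_transpose_mul_self]
  simpa using hEU

theorem SmoothOn.residual {m : ℕ∞} {X : ℝ → Matrix (Fin n) κ ℝ} (hI : UniqueDiffOn ℝ I)
    (hE : SmoothOn m E I) (hA : SmoothOn m A I) (hX : SmoothOn (m + 1) X I) :
    SmoothOn m (residual E A I X) I :=
  (hE.mul (hX.matD hI)).sub (hA.mul (hX.of_le le_self_add))

theorem residual_add {X Y : ℝ → Matrix (Fin n) κ ℝ} {X' Y' : Matrix (Fin n) κ ℝ}
    (hI : UniqueDiffOn ℝ I) (ht : t ∈ I) (hX : HasMatDeriv I X X' t) (hY : HasMatDeriv I Y Y' t) :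
    residual E A I (fun s => X s + Y s) t = residual E A I X t + residual E A I Y t := by
  rw [residual, residual, residual, (hX.add hY).matD_eq hI ht, hX.matD_eq hI ht, hY.matD_eq hI ht]
  simp only [Matrix.mul_add]
  abel

theorem residual_sub {X Y : ℝ → Matrix (Fin n) κ ℝ} {X' Y' : Matrix (Fin n) κ ℝ}
    (hI : UniqueDiffOn ℝ I) (ht : t ∈ I) (hX : HasMatDeriv I X X' t) (hY : HasMatDeriv I Y Y' t) :
    residual E A I (fun s => X s - Y s) t = residual E A I X t - residual E A I Y t := by
  rw [residual, residual, residual, (hX.sub hY).matD_eq hI ht, hX.matD_eq hI ht, hY.matD_eq hI ht]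
  simp only [Matrix.mul_sub]
  abel

theorem self_eq_add_of_mul_transpose {U : Matrix (Fin n) (δ ⊕ α) ℝ} (h : U * Uᵀ = 1)
    (X : Matrix (Fin n) κ ℝ) :
    X = U.toCols₁ * ((U.toCols₁)ᵀ * X) + U.toCols₂ * ((U.toCols₂)ᵀ * X) := by
  rw [← Matrix.mul_assoc, ← Matrix.mul_assoc, ← Matrix.add_mul]
  have h1 : U.toCols₁ * (U.toCols₁)ᵀ + U.toCols₂ * (U.toCols₂)ᵀ = 1 := by
    rw [← h]
    ext i j
    simp [Matrix.mul_apply, Fintype.sum_sum_type]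
  rw [h1, Matrix.one_mul]

/-- A regular skew-adjoint system `E ẋ = A x + ψ` is solvable for all smooth `ψ`: the formal adjoint
of the reduction to a semi-explicit system yields a solution. -/
theorem IsOrthogonalChoice.exists_residual_eq {tl tr : ℝ} (htl : tl < tr) {j : ℕ∞} (hj : 1 ≤ j)
    {Z₂ : ℝ → Matrix (Fin (μ + 1) × Fin n) α ℝ} {U : ℝ → Matrix (Fin n) (δ ⊕ α) ℝ}
    (h : IsOrthogonalChoice E A (Icc tl tr) μ (j + μ + 1) Z₂ U)
    (hskew : IsSkewAdjoint E A (Icc tl tr))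
    (hE : SmoothOn (j + μ + 1 + μ) E (Icc tl tr)) (hA : SmoothOn (j + μ + 1 + μ) A (Icc tl tr))
    {ψ : ℝ → Matrix (Fin n) κ ℝ} (hψ : SmoothOn (j + μ + 1) ψ (Icc tl tr)) {t₀ : ℝ}
    (ht₀ : t₀ ∈ Icc tl tr) :
    ∃ u : ℝ → Matrix (Fin n) κ ℝ, SmoothOn j u (Icc tl tr) ∧
      (∀ t ∈ Icc tl tr, residual E A (Icc tl tr) u t = ψ t) ∧
      (Flat (Icc tl tr) t₀ μ ψ → u t₀ = 0) := by
  have hI := uniqueDiffOn_Icc htl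
  set I := Icc tl tr with hIdef
  have hE1 : SmoothOn (j + μ + 1) E I := hE.of_le le_self_add
  have hA1 : SmoothOn (j + μ + 1) A I := hA.of_le le_self_add
  have hle : j + μ ≤ j + (μ : ℕ∞) + 1 := le_self_add
  set T : ℝ → Matrix (Fin n) δ ℝ := fun t => (U t).toCols₁ with hT
  set T' : ℝ → Matrix (Fin n) α ℝ := fun t => (U t).toCols₂ with hT'
  have hTs : SmoothOn (j + μ + 1) T I := fun i k => h.smooth_U i (Sum.inl k)
  have hTs' : SmoothOn (j + μ + 1) T' I := fun i k => h.smooth_U i (Sum.inr k)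
  -- The ansatz is Z₁ φ rather than T φ: the nonsingularity of Tᵀ E T is not available here and will
  -- be deduced from this solvability, whereas Tᵀ E Z₁ = (E T)ᵀ (E T) is nonsingular by the rank
  -- condition.
  set Z₁ : ℝ → Matrix (Fin n) δ ℝ := fun t => E t * T t with hZ₁
  have hZ₁s : SmoothOn (j + μ + 1) Z₁ I := hE1.mul hTs
  have hNs : SmoothOn (j + μ + 1) (LinDAE.arrayN A I μ) I := SmoothOn.arrayN hI hA
  -- the differential part
  set L : ℝ → Matrix (Fin n) δ ℝ := residual E A I Z₁ with hL
  have hLs : SmoothOn (j + μ) L I := SmoothOn.residual hI (hE1.of_le hle) (hA1.of_le hle) hZ₁s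
  set C : ℝ → Matrix δ δ ℝ := fun t => (T t)ᵀ * E t * Z₁ t with hC
  have hCu : ∀ t ∈ I, IsUnit (C t) := by
    intro t ht
    have h1 := isUnit_transpose_mul_self (h.regularAt t ht).rank_E_mul_T₂
    rw [Matrix.transpose_mul, (hskew t ht).1] at h1
    exact h1
  have hCs : SmoothOn (j + μ) (fun t => (C t)⁻¹) I :=
    (((hTs.transpose.mul hE1).mul hZ₁s).inv hCu).of_le hle
  set G : ℝ → Matrix δ δ ℝ := fun t => (C t)⁻¹ * ((0 : Matrix δ δ ℝ) - (T t)ᵀ * L t) with hG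
  set b : ℝ → Matrix δ κ ℝ := fun t => (C t)⁻¹ * ((T t)ᵀ * ψ t) with hb
  have hTts : SmoothOn (j + μ) (fun t => (T t)ᵀ) I := hTs.transpose.of_le hle
  have hGs : SmoothOn (j + μ) G I := hCs.mul ((smoothOn_const _).sub (hTts.mul hLs))
  have hbs : SmoothOn (j + μ) b I := hCs.mul (hTts.mul (hψ.of_le hle))
  -- This ODE is the requirement Tᵀ (ψ - D(Z₁ φ)) = 0; the zero initial value serves the flatness
  -- claim.
  obtain ⟨φ, hφ0, hφs, hφ⟩ := exists_matODE_solution htl hGs hbs ht₀ (0 : Matrix δ κ ℝ)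
  -- the residual of the differential part
  have hZφs : SmoothOn (j + μ + 1) (fun t => Z₁ t * φ t) I := hZ₁s.mul hφs
  set ρ : ℝ → Matrix (Fin n) κ ℝ :=
    fun t => ψ t - residual E A I (fun t => Z₁ t * φ t) t with hρ
  have hρs : SmoothOn (j + μ) ρ I :=
    (hψ.of_le hle).sub (SmoothOn.residual hI (hE1.of_le hle) (hA1.of_le hle) hZφs)
  have hres : ∀ t ∈ I, residual E A I (fun t => Z₁ t * φ t) t
      = L t * φ t + E t * Z₁ t * (G t * φ t + b t) := by
    intro t ht
    have h1 := (hZ₁s.hasMatDeriv le_add_self ht).mul (hφ t ht)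
    rw [residual, h1.matD_eq hI ht, hL, residual]
    simp only [Matrix.mul_add, Matrix.sub_mul, Matrix.mul_assoc]
    abel
  have hTρ : ∀ t ∈ I, (T t)ᵀ * ρ t = 0 := by
    intro t ht
    have h1 : (T t)ᵀ * (E t * Z₁ t * (G t * φ t + b t))
        = C t * (C t)⁻¹ * ((T t)ᵀ * ψ t - (T t)ᵀ * L t * φ t) := by
      rw [hG, hb]
      simp only [zero_sub, Matrix.mul_sub, Matrix.mul_add, Matrix.mul_neg, Matrix.neg_mul,
        hC, Matrix.mul_assoc]
      abel
    rw [hρ]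
    simp only
    rw [hres t ht, Matrix.mul_sub, Matrix.mul_add, h1,
      Matrix.mul_nonsing_inv _ ((Matrix.isUnit_iff_isUnit_det _).1 (hCu t ht)), Matrix.one_mul]
    simp only [Matrix.mul_assoc]
    abel
  -- the algebraic part
  set A₂ : ℝ → Matrix α (Fin n) ℝ := fun t => (Z₂ t)ᵀ * LinDAE.arrayN A I μ t with hA₂
  -- Since Â₂ T = 0, one has Â₂ = Y T'ᵀ with `Y` nonsingular. The remaining residual ρ is orthogonal
  -- to `T`, hence lies in the range of Â₂ᵀ.
  set Y : ℝ → Matrix α α ℝ := fun t => A₂ t * T' t with hY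
  have hAY : ∀ t ∈ I, A₂ t = Y t * (T' t)ᵀ := by
    intro t ht
    have h1 := self_eq_add_of_mul_transpose (h.mul_transpose t ht) (1 : Matrix (Fin n) (Fin n) ℝ)
    rw [Matrix.mul_one, Matrix.mul_one] at h1
    calc A₂ t = A₂ t * 1 := (Matrix.mul_one _).symm
      _ = A₂ t * (U t).toCols₁ * ((U t).toCols₁)ᵀ + A₂ t * (U t).toCols₂ * ((U t).toCols₂)ᵀ := by
        rw [Matrix.mul_assoc (A₂ t), Matrix.mul_assoc (A₂ t), ← Matrix.mul_add, ← h1]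
      _ = _ := by rw [(h.regularAt t ht).A₂_mul_T₂, Matrix.zero_mul, zero_add]
  have hYu : ∀ t ∈ I, IsUnit (Y t)ᵀ := by
    intro t ht
    rw [Matrix.isUnit_transpose]
    refine isUnit_of_rank_eq_card (le_antisymm (Y t).rank_le_card_width ?_)
    rw [← (h.regularAt t ht).rank_A₂]
    show (A₂ t).rank ≤ _
    rw [hAY t ht]
    exact Matrix.rank_mul_le_left _ _
  set χ : ℝ → Matrix α κ ℝ := fun t => ((Y t)ᵀ)⁻¹ * (T' t)ᵀ * ρ t with hχ
  have hYs : SmoothOn (j + μ) (fun t => ((Y t)ᵀ)⁻¹ * (T' t)ᵀ) I :=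
    SmoothOn.of_le (((((h.smooth_Z₂.transpose.mul hNs).mul hTs').transpose).inv hYu).mul
      hTs'.transpose) hle
  have hχs : SmoothOn (j + μ) χ I := hYs.mul hρs
  have hAχ : ∀ t ∈ I, (A₂ t)ᵀ * χ t = ρ t := by
    intro t ht
    have h1 := self_eq_add_of_mul_transpose (h.mul_transpose t ht) (ρ t)
    have h2 : ((U t).toCols₁)ᵀ * ρ t = 0 := hTρ t ht
    rw [h2, Matrix.mul_zero, zero_add] at h1
    rw [hAY t ht, Matrix.transpose_mul, Matrix.transpose_transpose, hχ]
    simp only [Matrix.mul_assoc]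
    rw [Matrix.mul_nonsing_inv_cancel_left _ _ ((Matrix.isUnit_iff_isUnit_det _).1 (hYu t ht))]
    exact h1.symm
  set W : ℝ → Matrix (Fin (μ + 1) × Fin n) κ ℝ := fun t => Z₂ t * χ t with hW
  have hWs : SmoothOn (j + μ) W I := (h.smooth_Z₂.of_le hle).mul hχs
  have hμ1 : (μ : ℕ∞) + 1 ≤ j + μ := by rw [add_comm]; gcongr
  have hadj : ∀ t ∈ I, residual E A I (adjJet I W) t = ρ t := by
    intro t ht
    rw [residual_adjJet hI (hE1.of_le (hμ1.trans hle)) (hA1.of_le (hμ1.trans hle))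
      (hWs.of_le hμ1) hskew (fun s hs => ?_) ht, hW, ← Matrix.mul_assoc, ← hAχ t ht, hA₂,
      Matrix.transpose_mul, Matrix.transpose_transpose]
    have h1 := congrArg Matrix.transpose (h.regularAt s hs).Z₂_mul_M
    rw [Matrix.transpose_mul, Matrix.transpose_transpose, Matrix.transpose_zero] at h1
    rw [hW, ← Matrix.mul_assoc, h1, Matrix.zero_mul]
  have hadjs : SmoothOn j (adjJet I W) I := contDiffOn_adjJet hI hWs
  have hZφ1 : SmoothOn j (fun t => Z₁ t * φ t) I :=
    hZφs.of_le (le_self_add.trans hle)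
  refine ⟨fun t => Z₁ t * φ t + adjJet I W t, hZφ1.add hadjs, fun t ht => ?_, fun hflat => ?_⟩
  · rw [residual_add hI ht (hZφ1.hasMatDeriv hj ht) (hadjs.hasMatDeriv hj ht), hadj t ht]
    exact add_sub_cancel _ _
  -- Flatness passes along the construction: ψ of order μ gives φ of order μ + 1, then ρ and `W` of
  -- order μ, just enough for the adjoint jet to vanish.
  · have hm : (μ : ℕ∞) ≤ j + μ := le_add_self
    have hφf : Flat I t₀ (μ + 1) φ :=
      Flat.of_linearODE hI ht₀ (hGs.of_le hm) (hbs.of_le hm) (hφs.of_le (hm.trans hle)) hφ hφ0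
        ((hflat.mul_left hI ht₀ (hTts.of_le hm) (hψ.of_le (hm.trans hle))).mul_left hI ht₀
          (hCs.of_le hm) ((hTts.of_le hm).mul (hψ.of_le (hm.trans hle))))
    have hm1 : ((μ + 1 : ℕ) : ℕ∞) ≤ j + μ + 1 := by
      push_cast
      exact add_le_add_left hm 1
    have hZφf : Flat I t₀ (μ + 1) (fun t => Z₁ t * φ t) :=
      hφf.mul_left hI ht₀ (hZ₁s.of_le hm1) (hφs.of_le hm1)
    have hEf : Flat I t₀ μ (fun t => (0 - E t) * matD I (fun t => Z₁ t * φ t) t) :=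
      hZφf.deriv.mul_left hI ht₀ ((smoothOn_const _).sub (hE1.of_le (hm.trans hle)))
        ((hZφs.matD hI).of_le hm)
    have hAf : Flat I t₀ μ (fun t => A t * (Z₁ t * φ t)) :=
      (hZφf.mono μ.le_succ).mul_left hI ht₀ (hA1.of_le (hm.trans hle))
        (hZφs.of_le (hm.trans hle))
    have hEs : SmoothOn μ (fun t => (0 - E t) * matD I (fun t => Z₁ t * φ t) t) I :=
      ((smoothOn_const _).sub (hE1.of_le (hm.trans hle))).mul ((hZφs.matD hI).of_le hm)
    have hAs : SmoothOn μ (fun t => A t * (Z₁ t * φ t)) I :=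
      (hA1.of_le (hm.trans hle)).mul (hZφs.of_le (hm.trans hle))
    have hρf : Flat I t₀ μ ρ := by
      refine ((hEf.add hI ht₀ hAf hEs hAs).add hI ht₀ hflat (hEs.add hAs)
        (hψ.of_le (hm.trans hle))).congr (fun s hs => ?_) ht₀
      simp only [hρ, residual, zero_sub, Matrix.neg_mul]
      abel
    have hWf : Flat I t₀ μ W :=
      (hρf.mul_left hI ht₀ (hYs.of_le hm) (hρs.of_le hm)).mul_left hI ht₀
        (h.smooth_Z₂.of_le (hm.trans hle)) (hχs.of_le hm)
    show Z₁ t₀ * φ t₀ + adjJet I W t₀ = 0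
    rw [hφ0, Matrix.mul_zero, zero_add]
    exact hWf.adjJet_eq_zero

/-- Every consistent initial value of the homogeneous system is attained by a smooth solution. -/
theorem IsOrthogonalChoice.exists_homogeneous_solution {tl tr : ℝ} (htl : tl < tr) {j : ℕ∞}
    (hj : 1 ≤ j) {Z₂ : ℝ → Matrix (Fin (μ + 1) × Fin n) α ℝ} {U : ℝ → Matrix (Fin n) (δ ⊕ α) ℝ}
    (h : IsOrthogonalChoice E A (Icc tl tr) μ (j + μ + 1) Z₂ U)
    (hskew : IsSkewAdjoint E A (Icc tl tr))
    (hE : SmoothOn (j + μ + 1 + μ) E (Icc tl tr)) (hA : SmoothOn (j + μ + 1 + μ) A (Icc tl tr))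
    {t₀ : ℝ} (ht₀ : t₀ ∈ Icc tl tr) {x₀ : Matrix (Fin n) κ ℝ}
    (hx₀ : (Z₂ t₀)ᵀ * arrayN A (Icc tl tr) μ t₀ * x₀ = 0) :
    ∃ x : ℝ → Matrix (Fin n) κ ℝ, SmoothOn j x (Icc tl tr) ∧
      (∀ t ∈ Icc tl tr, residual E A (Icc tl tr) x t = 0) ∧ x t₀ = x₀ := by
  have hI := uniqueDiffOn_Icc htl
  -- A polynomial `p` with this formal jet has a residual flat to order μ at `t₀`; the correction
  -- `u` removes the residual without moving the initial value.
  obtain ⟨K, hK⟩ := (h.regularAt t₀ ht₀).exists_jet hx₀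
  obtain ⟨p, hps, hp0, hpj⟩ := exists_smooth_with_jet hI ht₀ x₀ K
  have hE1 : SmoothOn (j + μ + 1) E (Icc tl tr) := hE.of_le le_self_add
  have hA1 : SmoothOn (j + μ + 1) A (Icc tl tr) := hA.of_le le_self_add
  have hm : (μ : ℕ∞) ≤ j + μ + 1 := le_add_self.trans le_self_add
  have hflat : Flat (Icc tl tr) t₀ μ (residual E A (Icc tl tr) p) := by
    refine flat_of_jet_eq_zero ?_
    rw [jet_residual hI ht₀ (hE1.of_le hm) (hA1.of_le hm) (hps _), hpj, hp0, hK, sub_self]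
  obtain ⟨u, hus, hu, hu0⟩ := h.exists_residual_eq htl hj hskew hE hA
    (SmoothOn.residual hI hE1 hA1 (hps _)) ht₀
  refine ⟨fun t => p t - u t, (hps j).sub hus, fun t ht => ?_, ?_⟩
  · rw [residual_sub hI ht ((hps j).hasMatDeriv hj ht) (hus.hasMatDeriv hj ht), hu t ht, sub_self]
  · show p t₀ - u t₀ = x₀
    rw [hp0, hu0 hflat, sub_zero]

/-- The bilinear concomitant of a skew-adjoint pair. -/
theorem hasMatDeriv_concomitant {κ' : Type*} (hskew : IsSkewAdjoint E A I) (ht : t ∈ I)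
    {X : ℝ → Matrix (Fin n) κ ℝ} {Y : ℝ → Matrix (Fin n) κ' ℝ} (hE : SmoothOn 1 E I)
    (hX : SmoothOn 1 X I) (hY : SmoothOn 1 Y I) :
    HasMatDeriv I (fun s => (X s)ᵀ * E s * Y s)
      ((residual E A I X t)ᵀ * Y t + (X t)ᵀ * residual E A I Y t) t := by
  convert ((hX.hasMatDeriv le_rfl ht).transpose.mul (hE.hasMatDeriv le_rfl ht)).mul
    (hY.hasMatDeriv le_rfl ht) using 1
  simp only [residual, Matrix.transpose_sub, Matrix.transpose_mul, (hskew t ht).1, (hskew t ht).2,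
    Matrix.mul_sub, Matrix.sub_mul, Matrix.add_mul, Matrix.mul_neg, Matrix.neg_mul,
    Matrix.mul_assoc]
  abel

/-- The hidden algebraic constraints: `Z` annihilates every term with derivatives of `X`. In
particular, `X` is consistent wherever its residual is flat to order μ. -/
theorem transpose_mul_jet_residual (hI : UniqueDiffOn ℝ I) (ht : t ∈ I) (hE : SmoothOn μ E I)
    (hA : SmoothOn μ A I) {X : ℝ → Matrix (Fin n) κ ℝ} (hX : SmoothOn (μ + 1) X I)
    {Z : Matrix (Fin (μ + 1) × Fin n) α ℝ} (hZ : Zᵀ * arrayM E A I μ t = 0) :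
    Zᵀ * jet I μ (residual E A I X) t = -(Zᵀ * arrayN A I μ t * X t) := by
  rw [jet_residual hI ht hE hA hX, Matrix.mul_sub, ← Matrix.mul_assoc, hZ, Matrix.zero_mul,
    zero_sub, Matrix.mul_assoc]

end Solvability


/-! ### Nondegeneracy of `E` on consistent initial values -/

section Nondegeneracy

variable {n μ : ℕ} {α δ : Type*} [Fintype α] [Fintype δ] [DecidableEq α] [DecidableEq δ]
  {E A : ℝ → Matrix (Fin n) (Fin n) ℝ}

/-- A function with nonnegative derivative `ρ g`, with `ρ > 0` off the end points, that vanishes at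
both ends of an interval has `g = 0` at both ends. -/
theorem eq_zero_of_hasDerivWithinAt_mul {a b : ℝ} (hab : a < b) {F ρ g : ℝ → ℝ}
    (hF : ∀ t ∈ Icc a b, HasDerivWithinAt F (ρ t * g t) (Icc a b) t) (ha : F a = 0) (hb : F b = 0)
    (hρ : ∀ t ∈ Ioo a b, 0 < ρ t) (hg0 : ∀ t ∈ Icc a b, 0 ≤ g t) (hg : ContinuousOn g (Icc a b)) :
    ∀ t ∈ Icc a b, g t = 0 := by
  have hmono : MonotoneOn F (Icc a b) := by
    refine monotoneOn_of_hasDerivWithinAt_nonneg (convex_Icc a b)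
      (fun t ht => (hF t ht).continuousWithinAt)
      (fun t ht => (hF t (interior_subset ht)).mono interior_subset) fun t ht => ?_
    rw [interior_Icc] at ht
    exact mul_nonneg (hρ t ht).le (hg0 t (Ioo_subset_Icc_self ht))
  have hzero : ∀ t ∈ Icc a b, F t = 0 := fun t ht => le_antisymm
    (hb ▸ hmono ht (right_mem_Icc.2 hab.le) ht.2) (ha ▸ hmono (left_mem_Icc.2 hab.le) ht ht.1)
  have hopen : EqOn g (fun _ => 0) (Ioo a b) := by
    intro t ht
    have h1 := (hF t (Ioo_subset_Icc_self ht)).congr_of_mem (f₁ := fun _ => (0 : ℝ))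
      (fun s hs => (hzero s hs).symm) (Ioo_subset_Icc_self ht)
    have h2 := (uniqueDiffOn_Icc hab t (Ioo_subset_Icc_self ht)).eq_deriv _ h1
      (hasDerivWithinAt_const t _ _)
    exact (mul_eq_zero.1 h2).resolve_left (hρ t ht).ne'
  have := hopen.of_subset_closure hg continuousOn_const Ioo_subset_Icc_self
    (by rw [closure_Ioo hab.ne])
  exact this

/-- A kernel vector `v` of Tᵀ E T starts a homogeneous solution `x` whose value at `t₀` is
E-orthogonal to all consistent values. Pairing it with a solution `y` driven by a nonnegative weight
times `x` forces x(t₀) = 0. The differentiability is spent on two successive solves, for `x` and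
then for `y`. -/
theorem IsOrthogonalChoice.isUnit_transpose_mul_E_mul {tl tr : ℝ} (htl : tl < tr)
    {Z₂ : ℝ → Matrix (Fin (μ + 1) × Fin n) α ℝ} {U : ℝ → Matrix (Fin n) (δ ⊕ α) ℝ}
    (h : IsOrthogonalChoice E A (Icc tl tr) μ ((μ + 1 : ℕ) + μ + 1 + μ + 1) Z₂ U)
    (hskew : IsSkewAdjoint E A (Icc tl tr))
    (hE : SmoothOn ((μ + 1 : ℕ) + μ + 1 + μ + 1 + μ) E (Icc tl tr))
    (hA : SmoothOn ((μ + 1 : ℕ) + μ + 1 + μ + 1 + μ) A (Icc tl tr))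
    {t₀ : ℝ} (ht₀ : t₀ ∈ Icc tl tr) :
    IsUnit (((U t₀).toCols₁)ᵀ * E t₀ * (U t₀).toCols₁) := by
  have hI := uniqueDiffOn_Icc htl
  set T := (U t₀).toCols₁ with hT
  rw [Matrix.isUnit_iff_isUnit_det, isUnit_iff_ne_zero]
  intro hdet
  obtain ⟨v, hv0, hv⟩ := Matrix.exists_mulVec_eq_zero_iff.2 hdet
  set V : Matrix δ Unit ℝ := Matrix.replicateCol Unit v with hV
  have hTV : Tᵀ * E t₀ * T * V = 0 := by
    rw [hV, ← Matrix.replicateCol_mulVec, hv]; rfl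
  have hV0 : V ≠ 0 := fun h0 => hv0 (funext fun i => congrFun (congrFun h0 i) ())
  have hj0 : (1 : ℕ∞) ≤ ((μ + 1 : ℕ) : ℕ∞) := by push_cast; exact le_add_self
  -- a homogeneous solution starting in the kernel
  obtain ⟨x, hxs, hx, hx0⟩ := h.exists_homogeneous_solution htl
    (j := (μ + 1 : ℕ) + μ + 1) (κ := Unit) le_add_self hskew hE hA ht₀ (x₀ := T * V)
    (by rw [← Matrix.mul_assoc, (h.regularAt t₀ ht₀).A₂_mul_T₂, Matrix.zero_mul])
  have hle : ((μ + 1 : ℕ) : ℕ∞) + μ + 1 ≤ (μ + 1 : ℕ) + μ + 1 + μ + 1 :=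
    le_self_add.trans le_self_add
  have hle' : ((μ + 1 : ℕ) : ℕ∞) + μ + 1 + μ ≤ (μ + 1 : ℕ) + μ + 1 + μ + 1 + μ := by
    gcongr
  have key : ∀ t₁ ∈ Icc tl tr, ∃ y : ℝ → Matrix (Fin n) Unit ℝ,
      SmoothOn (μ + 1 : ℕ) y (Icc tl tr) ∧ y t₁ = 0 ∧
      (∀ t ∈ Icc tl tr, residual E A (Icc tl tr) y t
        = ((t - t₀) ^ (2 * (μ + 1)) * (t - t₁) ^ (2 * (μ + 1))) • x t) ∧
      (Z₂ t₀)ᵀ * arrayN A (Icc tl tr) μ t₀ * y t₀ = 0 := by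
    intro t₁ ht₁
    have hp : ∀ s : ℝ, ContDiffOn ℝ (((μ + 1 : ℕ) + μ + 1 : ℕ∞) : WithTop ℕ∞)
        (fun t => (t - s) ^ (2 * (μ + 1))) (Icc tl tr) := fun s => by fun_prop
    -- The exponent is even, so the weight is nonnegative, and exceeds μ, so ψ is flat to order μ at
    -- both points. Flatness at `t₁` allows y(t₁) = 0; flatness at `t₀` makes y(t₀) consistent.
    set ψ : ℝ → Matrix (Fin n) Unit ℝ :=
      fun t => ((t - t₀) ^ (2 * (μ + 1)) * (t - t₁) ^ (2 * (μ + 1))) • x t with hψ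
    have hψs : SmoothOn ((μ + 1 : ℕ) + μ + 1) ψ (Icc tl tr) :=
      SmoothOn.smul ((hp t₀).mul (hp t₁)) hxs
    have hμ : (μ : ℕ∞) ≤ (μ + 1 : ℕ) + μ + 1 := le_add_self.trans le_self_add
    have hf₁ : Flat (Icc tl tr) t₁ μ ψ :=
      (flat_pow_smul hI ht₁ (k := 2 * (μ + 1)) (by omega)
        ((SmoothOn.smul (hp t₀) hxs).of_le hμ)).congr
        (fun s hs => by rw [smul_smul, mul_comm]) ht₁
    have hf₀ : Flat (Icc tl tr) t₀ μ ψ :=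
      (flat_pow_smul hI ht₀ (k := 2 * (μ + 1)) (by omega)
        ((SmoothOn.smul (hp t₁) hxs).of_le hμ)).congr
        (fun s hs => by rw [smul_smul]) ht₀
    obtain ⟨y, hys, hy, hy1⟩ := (h.of_le hle).exists_residual_eq htl hj0 hskew
      (hE.of_le hle') (hA.of_le hle') hψs ht₁
    refine ⟨y, hys, hy1 hf₁, hy, ?_⟩
    have h1 := transpose_mul_jet_residual hI ht₀ (hE.of_le le_add_self) (hA.of_le le_add_self)
      (hys.of_le (by push_cast; exact le_rfl)) (h.regularAt t₀ ht₀).Z₂_mul_M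
    rw [jet_congr hy ht₀, hf₀.jet_eq_zero, Matrix.mul_zero] at h1
    exact neg_eq_zero.1 h1.symm
  have hE1 : SmoothOn 1 E (Icc tl tr) := hE.of_le (le_add_self.trans le_self_add)
  have hx1 : SmoothOn 1 x (Icc tl tr) := hxs.of_le le_add_self
  set g : ℝ → ℝ := fun t => ((x t)ᵀ * x t) () () with hg
  have hgs : ContinuousOn g (Icc tl tr) := (hx1.transpose.mul hx1 () ()).continuousOn
  have hg0 : ∀ t, 0 ≤ g t := fun t => by
    simp only [hg, Matrix.mul_apply, Matrix.transpose_apply]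
    exact Finset.sum_nonneg fun i _ => mul_self_nonneg _
  have main : g t₀ = 0 := by
    have hF : ∀ t₁ ∈ Icc tl tr, ∃ F : ℝ → ℝ, F t₀ = 0 ∧ F t₁ = 0 ∧ ∀ t ∈ Icc tl tr,
        HasDerivWithinAt F ((t - t₀) ^ (2 * (μ + 1)) * (t - t₁) ^ (2 * (μ + 1)) * g t)
          (Icc tl tr) t := by
      intro t₁ ht₁
      obtain ⟨y, hys, hy1, hy, hy0⟩ := key t₁ ht₁
      refine ⟨fun t => ((x t)ᵀ * E t * y t) () (), ?_, ?_, fun t ht => ?_⟩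
      -- As y(t₀) = T K, the pairing at `t₀` is Vᵀ Tᵀ E T K, which is zero by symmetry of `E` and
      -- the choice of `V`.
      · obtain ⟨K, hK⟩ := (h.regularAt t₀ ht₀).exists_eq_T₂_mul hy0
        have h1 := congrArg Matrix.transpose hTV
        rw [Matrix.transpose_mul, Matrix.transpose_mul, Matrix.transpose_mul,
          Matrix.transpose_transpose, (hskew t₀ ht₀).1, Matrix.transpose_zero] at h1
        show ((x t₀)ᵀ * E t₀ * y t₀) () () = 0
        rw [← Matrix.mul_assoc] at h1
        rw [hK, hx0, Matrix.transpose_mul, ← Matrix.mul_assoc, Matrix.mul_assoc Vᵀ Tᵀ,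
          Matrix.mul_assoc Vᵀ, ← hT, Matrix.mul_assoc Tᵀ, ← Matrix.mul_assoc, h1,
          Matrix.zero_mul]
        rfl
      · simp [hy1]
      · have h1 := hasMatDeriv_concomitant hskew ht hE1 hx1 (hys.of_le hj0) () ()
        rw [hx t ht, hy t ht, Matrix.transpose_zero, Matrix.zero_mul, zero_add,
          Matrix.mul_smul] at h1
        exact h1
    have hpos : ∀ s t : ℝ, t ≠ s → 0 < (t - s) ^ (2 * (μ + 1)) := fun s t hst => by
      rw [pow_mul]
      exact pow_pos (sq_pos_of_ne_zero (sub_ne_zero.2 hst)) _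
    -- `t₁` is an end point different from `t₀`, so the argument runs on a nontrivial subinterval.
    rcases ht₀.1.lt_or_eq with hlt | heq
    · obtain ⟨F, hF0, hF1, hF⟩ := hF tl (left_mem_Icc.2 htl.le)
      have hsub : Icc tl t₀ ⊆ Icc tl tr := Icc_subset_Icc_right ht₀.2
      exact eq_zero_of_hasDerivWithinAt_mul hlt (fun t ht => (hF t (hsub ht)).mono hsub) hF1 hF0
        (fun t ht => mul_pos (hpos _ _ ht.2.ne) (hpos _ _ ht.1.ne')) (fun t _ => hg0 t)
        (hgs.mono hsub) t₀ (right_mem_Icc.2 hlt.le)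
    · have hlt : t₀ < tr := heq ▸ htl
      obtain ⟨F, hF0, hF1, hF⟩ := hF tr (right_mem_Icc.2 htl.le)
      have hsub : Icc t₀ tr ⊆ Icc tl tr := Icc_subset_Icc_left ht₀.1
      exact eq_zero_of_hasDerivWithinAt_mul hlt (fun t ht => (hF t (hsub ht)).mono hsub) hF0 hF1
        (fun t ht => mul_pos (hpos _ _ ht.1.ne') (hpos _ _ ht.2.ne)) (fun t _ => hg0 t)
        (hgs.mono hsub) t₀ (left_mem_Icc.2 hlt.le)
  apply hV0
  have hx00 : x t₀ = 0 := by
    ext i j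
    simp only [hg, Matrix.mul_apply, Matrix.transpose_apply] at main
    exact mul_self_eq_zero.1
      ((Finset.sum_eq_zero_iff_of_nonneg fun i _ => mul_self_nonneg _).1 main i (Finset.mem_univ i))
  rw [hx0] at hx00
  rw [← Matrix.one_mul V, ← transpose_toCols₁_mul_toCols₁ (h.transpose_mul t₀ ht₀),
    Matrix.mul_assoc, ← hT, hx00, Matrix.mul_zero]

end Nondegeneracy

/-! ### Adapted transformations -/

section Adapted

variable {n μ a d p q : ℕ} {E A : ℝ → Matrix (Fin n) (Fin n) ℝ} {I : Set ℝ} {t : ℝ}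

/-- A left inverse of Tᵀ E T yields left inverses of `T` and `E T`, so all rank conditions on T₂ and
Z₁ follow at once. -/
theorem RegularAt.of_isUnit_congr {α δ δ' : Type*} [Fintype α] [Fintype δ] [Fintype δ']
    [DecidableEq δ'] {Z₂ : Matrix (Fin (μ + 1) × Fin n) α ℝ} {T₂ Z₁ : Matrix (Fin n) δ ℝ}
    (h : RegularAt E A I μ t Z₂ T₂ Z₁) (hcard : Fintype.card δ' = Fintype.card δ)
    {T : Matrix (Fin n) δ' ℝ} (hT : Z₂ᵀ * arrayN A I μ t * T = 0)
    {Y : Matrix δ' δ' ℝ} (hY : Y * (Tᵀ * E t * T) = 1) : RegularAt E A I μ t Z₂ T T := by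
  have h1 : T.rank = Fintype.card δ' :=
    rank_eq_card_of_mul_eq_one (Y := Y * (Tᵀ * E t)) (by rw [Matrix.mul_assoc, hY])
  exact ⟨by rw [hcard, h.card_add], h.rank_M, h.rank_Z₂, h.Z₂_mul_M, h.rank_A₂, h1, hT,
    rank_eq_card_of_mul_eq_one (Y := Y * Tᵀ) (by rw [← hY]; simp only [Matrix.mul_assoc]), h1,
    rank_eq_card_of_mul_eq_one hY⟩

/-- Sylvester's law is needed only at `tl`. The equation Ẇ = -½ Y⁻¹ Ẏ W keeps Wᵀ Y W constant,
because Y and Ẏ are symmetric; this transports the normal form smoothly. -/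
theorem exists_smooth_congr_sigMatrix {tl tr : ℝ} (htl : tl < tr) {m : ℕ∞}
    {X : ℝ → Matrix (Fin d) (Fin d) ℝ} (hX : SmoothOn (m + 1) X (Icc tl tr))
    (hXt : ∀ t ∈ Icc tl tr, (X t)ᵀ = X t) (hXu : ∀ t ∈ Icc tl tr, IsUnit (X t)) :
    ∃ (p q : ℕ) (e : Fin p ⊕ Fin q ≃ Fin d)
      (W : ℝ → Matrix (Fin p ⊕ Fin q) (Fin p ⊕ Fin q) ℝ), SmoothOn (m + 1) W (Icc tl tr) ∧
      ∀ t ∈ Icc tl tr, (W t)ᵀ * (X t).submatrix e e * W t = sigMatrix p q := by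
  have hI := uniqueDiffOn_Icc htl
  have htl' : tl ∈ Icc tl tr := left_mem_Icc.2 htl.le
  obtain ⟨p, q, e, W₀, hW₀⟩ := exists_congr_sigMatrix (hXt tl htl') (hXu tl htl')
  set Y : ℝ → Matrix (Fin p ⊕ Fin q) (Fin p ⊕ Fin q) ℝ := fun t => (X t).submatrix e e with hY
  have hYs : SmoothOn (m + 1) Y (Icc tl tr) := fun i j => hX (e i) (e j)
  have hYu : ∀ t ∈ Icc tl tr, IsUnit (Y t) := fun t ht =>
    (Matrix.isUnit_submatrix_equiv e e).2 (hXu t ht)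
  have hYt : ∀ t ∈ Icc tl tr, (Y t)ᵀ = Y t := fun t ht => by
    rw [hY, Matrix.transpose_submatrix, hXt t ht]
  have hdY : ∀ t ∈ Icc tl tr, (matD (Icc tl tr) Y t)ᵀ = matD (Icc tl tr) Y t := fun t ht =>
    (((hYs.hasMatDeriv le_add_self ht).transpose.congr (fun s hs => (hYt s hs).symm) ht).matD_eq
      hI ht).symm
  set G : ℝ → Matrix (Fin p ⊕ Fin q) (Fin p ⊕ Fin q) ℝ :=
    fun t => (-(1 / 2) : ℝ) • ((Y t)⁻¹ * matD (Icc tl tr) Y t) with hG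
  have hGs : SmoothOn m G (Icc tl tr) :=
    SmoothOn.smul contDiffOn_const (((hYs.inv hYu).of_le le_self_add).mul (hYs.matD hI))
  obtain ⟨W, hW0, hWs, hW⟩ := exists_matODE_solution htl hGs
    (smoothOn_const (0 : Matrix (Fin p ⊕ Fin q) (Fin p ⊕ Fin q) ℝ)) htl' W₀
  refine ⟨p, q, e, W, hWs, fun t ht => ?_⟩
  rw [← hW₀, ← hW0]
  refine HasMatDeriv.eq_of_zero (X := fun t => (W t)ᵀ * Y t * W t) (fun s hs => ?_) ht htl'
  have hdet := (Matrix.isUnit_iff_isUnit_det _).1 (hYu s hs)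
  have h1 : Y s * G s = (-(1 / 2) : ℝ) • matD (Icc tl tr) Y s := by
    rw [hG, Matrix.mul_smul, Matrix.mul_nonsing_inv_cancel_left _ _ hdet]
  have h2 : (G s)ᵀ * Y s = (-(1 / 2) : ℝ) • matD (Icc tl tr) Y s := by
    rw [← hdY s hs, ← Matrix.transpose_smul, ← h1, Matrix.transpose_mul, hYt s hs]
  convert ((hW s hs).transpose.mul (hYs.hasMatDeriv le_add_self hs)).mul (hW s hs) using 1
  rw [add_zero, Matrix.transpose_mul, Matrix.mul_assoc (W s)ᵀ, h2, Matrix.mul_assoc (W s)ᵀ (Y s),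
    ← Matrix.mul_assoc (Y s), h1]
  simp only [Matrix.mul_smul, Matrix.smul_mul, Matrix.add_mul, Matrix.mul_assoc]
  module

theorem IsOrthogonalChoice.exists_isAdapted {tl tr : ℝ} (htl : tl < tr) {m : ℕ∞}
    {Z₂ : ℝ → Matrix (Fin (μ + 1) × Fin n) (Fin a) ℝ}
    {U : ℝ → Matrix (Fin n) (Fin d ⊕ Fin a) ℝ}
    (h : IsOrthogonalChoice E A (Icc tl tr) μ (m + 1) Z₂ U)
    (hE : SmoothOn (m + 1) E (Icc tl tr)) (hEt : ∀ t ∈ Icc tl tr, (E t)ᵀ = E t)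
    (hu : ∀ t ∈ Icc tl tr, IsUnit (((U t).toCols₁)ᵀ * E t * (U t).toCols₁)) :
    ∃ p q : ℕ, p + q = d ∧ ∃ Q : ℝ → Matrix (Fin n) ((Fin p ⊕ Fin q) ⊕ Fin a) ℝ,
      IsAdapted E A (Icc tl tr) μ (m + 1) Q ∧
        IsOrthogonalUpToFirstBlock (Icc tl tr) (m + 1) Q := by
  have hT : SmoothOn (m + 1) (fun t => (U t).toCols₁) (Icc tl tr) :=
    fun i j => h.smooth_U i (Sum.inl j)
  obtain ⟨p, q, e, W, hWs, hW⟩ := exists_smooth_congr_sigMatrix htl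
    ((hT.transpose.mul hE).mul hT)
    (fun t ht => by
      simp only [Matrix.transpose_mul, Matrix.transpose_transpose, hEt t ht, Matrix.mul_assoc]) hu
  have hpq : p + q = d := by simpa using Fintype.card_congr e
  -- Only the first block of columns is relabelled by `e`, so `V` is still orthogonal; it is the
  -- orthogonal factor of Q.
  set V : ℝ → Matrix (Fin n) ((Fin p ⊕ Fin q) ⊕ Fin a) ℝ :=
    fun t => (U t).submatrix id (Equiv.sumCongr e (Equiv.refl (Fin a))) with hV
  have hVs : SmoothOn (m + 1) V (Icc tl tr) := fun i j => h.smooth_U i _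
  have hVV : ∀ t ∈ Icc tl tr, V t * (V t)ᵀ = 1 ∧ (V t)ᵀ * V t = 1 := by
    intro t ht
    simp only [hV, Matrix.transpose_submatrix]
    constructor
    · rw [Matrix.submatrix_mul_equiv, h.mul_transpose t ht, Matrix.submatrix_id_id]
    · rw [← Matrix.submatrix_mul _ _ _ id _ Function.bijective_id, h.transpose_mul t ht,
        Matrix.submatrix_one_equiv]
  have hWu : ∀ t ∈ Icc tl tr, (W t)⁻¹ * W t = 1 ∧ W t * (W t)⁻¹ = 1 := by
    intro t ht
    have h1 := sigMatrix_mul_self p q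
    nth_rewrite 2 [← hW t ht] at h1
    rw [← Matrix.mul_assoc] at h1
    have h2 : IsUnit (W t).det := Matrix.isUnit_det_of_left_inverse h1
    exact ⟨Matrix.nonsing_inv_mul _ h2, Matrix.mul_nonsing_inv _ h2⟩
  set B : ℝ → Matrix ((Fin p ⊕ Fin q) ⊕ Fin a) ((Fin p ⊕ Fin q) ⊕ Fin a) ℝ :=
    fun t => Matrix.fromBlocks (W t) 0 0 1 with hB
  have hBs : SmoothOn (m + 1) B (Icc tl tr) := by
    rintro (i | i) (j | j)
    · exact hWs i j
    all_goals exact contDiffOn_const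
  set B' : ℝ → Matrix ((Fin p ⊕ Fin q) ⊕ Fin a) ((Fin p ⊕ Fin q) ⊕ Fin a) ℝ :=
    fun t => Matrix.fromBlocks (W t)⁻¹ 0 0 1 with hB'
  have hBu : ∀ t ∈ Icc tl tr, B t * B' t = 1 ∧ B' t * B t = 1 := by
    intro t ht
    simp [hB, hB', Matrix.fromBlocks_multiply, hWu t ht]
  have hQ₁ : ∀ t, (V t * B t).toCols₁ = (U t).toCols₁.submatrix id e * W t := by
    intro t
    ext i j
    simp [hV, hB, Matrix.mul_apply, Fintype.sum_sum_type]
  have hcongr : ∀ t ∈ Icc tl tr,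
      (V t * B t).toCols₁ᵀ * E t * (V t * B t).toCols₁ = sigMatrix p q := by
    intro t ht
    rw [← hW t ht, hQ₁, Matrix.transpose_mul]
    simp only [← Matrix.mul_assoc]
    congr 1
    simp only [Matrix.mul_assoc]
    congr 1
  refine ⟨p, q, hpq, fun t => V t * B t, ⟨hVs.mul hBs, fun t ht => ?_, ⟨Z₂, h.smooth_Z₂,
    fun i j => (hVs.mul hBs) i (Sum.inl j), fun i j => (hVs.mul hBs) i (Sum.inl j),
    fun t ht => ?_⟩, hcongr⟩, V, W, hVs, hWs, fun t ht => ⟨(hVV t ht).1, (hVV t ht).2, rfl⟩⟩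
  · refine ⟨B' t * (V t)ᵀ, ?_, ?_⟩
    · rw [Matrix.mul_assoc, ← Matrix.mul_assoc (B t), (hBu t ht).1, Matrix.one_mul, (hVV t ht).1]
    · rw [Matrix.mul_assoc, ← Matrix.mul_assoc (V t)ᵀ, (hVV t ht).2, Matrix.one_mul, (hBu t ht).2]
  · refine (h.regularAt t ht).of_isUnit_congr (by simpa using hpq) ?_
      (by rw [hcongr t ht, sigMatrix_mul_self])
    have h1 : (Z₂ t)ᵀ * arrayN A (Icc tl tr) μ t * (U t).toCols₁.submatrix id e = 0 := by
      have := congrArg (fun M => M.submatrix id e) (h.regularAt t ht).A₂_mul_T₂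
      exact this
    rw [hQ₁, ← Matrix.mul_assoc, h1, Matrix.zero_mul]

/-- `J = T₂ᵀ A T₂ - T₂ᵀ E Ṫ₂`. -/
def inherentJ {δ : Type*} (E A : ℝ → Matrix (Fin n) (Fin n) ℝ) (I : Set ℝ)
    (T : ℝ → Matrix (Fin n) δ ℝ) (t : ℝ) : Matrix δ δ ℝ :=
  (T t)ᵀ * A t * T t - (T t)ᵀ * E t * matD I T t

/-- By Aᵀ = -A - Ė, the sum J + Jᵀ is minus the derivative of the constant Tᵀ E T. -/
theorem transpose_inherentJ {δ : Type*} [Fintype δ] (hI : UniqueDiffOn ℝ I) (ht : t ∈ I)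
    (hskew : IsSkewAdjoint E A I) (hE : SmoothOn 1 E I) {T : ℝ → Matrix (Fin n) δ ℝ}
    (hT : SmoothOn 1 T I) {S : Matrix δ δ ℝ} (hS : ∀ t ∈ I, (T t)ᵀ * E t * T t = S) :
    (inherentJ E A I T t)ᵀ = -inherentJ E A I T t := by
  have h1 := ((hT.hasMatDeriv le_rfl ht).transpose.mul (hE.hasMatDeriv le_rfl ht)).mul
    (hT.hasMatDeriv le_rfl ht)
  have h2 := h1.unique ((hasMatDeriv_const S).congr hS ht) hI ht
  simp only [inherentJ, Matrix.transpose_sub, Matrix.transpose_mul, Matrix.transpose_transpose,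
    (hskew t ht).1, (hskew t ht).2]
  simp only [Matrix.mul_sub, Matrix.sub_mul, Matrix.add_mul, Matrix.mul_neg, Matrix.neg_mul,
    Matrix.mul_assoc] at h2 ⊢
  rw [← sub_eq_zero, ← neg_eq_zero, ← h2]
  abel

/-- A frame `T` of the consistent initial values satisfies `E T S J = A T - E Ṫ`. -/
theorem IsOrthogonalChoice.E_mul_frame {δ α δ' α' : Type*} [Fintype δ] [DecidableEq δ] [Fintype α]
    [DecidableEq α] [Fintype δ'] [DecidableEq δ'] [Fintype α'] [DecidableEq α']
    {tl tr : ℝ} (htl : tl < tr)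
    {Z : ℝ → Matrix (Fin (μ + 1) × Fin n) α ℝ} {U : ℝ → Matrix (Fin n) (δ ⊕ α) ℝ}
    (h : IsOrthogonalChoice E A (Icc tl tr) μ ((μ + 1 : ℕ) + μ + 1) Z U)
    (hskew : IsSkewAdjoint E A (Icc tl tr))
    (hE : SmoothOn ((μ + 1 : ℕ) + μ + 1 + μ) E (Icc tl tr))
    (hA : SmoothOn ((μ + 1 : ℕ) + μ + 1 + μ) A (Icc tl tr))
    {Z₂ : ℝ → Matrix (Fin (μ + 1) × Fin n) α' ℝ} {T : ℝ → Matrix (Fin n) δ' ℝ}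
    (hT : SmoothOn 1 T (Icc tl tr))
    (hreg : ∀ t ∈ Icc tl tr, RegularAt E A (Icc tl tr) μ t (Z₂ t) (T t) (T t))
    {S : Matrix δ' δ' ℝ} (hS : ∀ t ∈ Icc tl tr, (T t)ᵀ * E t * T t = S) (hSS : S * S = 1)
    {t : ℝ} (ht : t ∈ Icc tl tr) :
    E t * (T t * (S * inherentJ E A (Icc tl tr) T t))
      = A t * T t - E t * matD (Icc tl tr) T t := by
  have hI := uniqueDiffOn_Icc htl
  have hE1 : SmoothOn 1 E (Icc tl tr) := hE.of_le (le_add_self.trans le_self_add)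
  have hj : (1 : ℕ∞) ≤ ((μ + 1 : ℕ) : ℕ∞) := by push_cast; exact le_add_self
  -- A matrix of homogeneous solutions through the frame at the very point `t`. It remains in the
  -- range of `T`, with coordinates ξ = S Tᵀ E x since S² = 1.
  obtain ⟨x, hxs, hx, hxt⟩ := h.exists_homogeneous_solution htl hj hskew hE hA ht
    (x₀ := T t) ((hreg t ht).A₂_mul_T₂_of (h.regularAt t ht).Z₂_mul_M)
  have hx1 : SmoothOn 1 x (Icc tl tr) := hxs.of_le hj
  set ξ : ℝ → Matrix δ' δ' ℝ := fun s => S * ((T s)ᵀ * E s * x s) with hξ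
  have hξs : SmoothOn 1 ξ (Icc tl tr) := (smoothOn_const S).mul ((hT.transpose.mul hE1).mul hx1)
  have hxξ : ∀ s ∈ Icc tl tr, x s = T s * ξ s := by
    intro s hs
    have h0 := transpose_mul_jet_residual hI hs (hE.of_le le_add_self) (hA.of_le le_add_self)
      (hxs.of_le (by push_cast; exact le_rfl)) (hreg s hs).Z₂_mul_M
    have hz : jet (Icc tl tr) μ (residual E A (Icc tl tr) x) s = 0 := by
      rw [jet_congr (Y := fun _ => 0) hx hs]
      ext r c
      simp [jet]
    rw [hz, Matrix.mul_zero] at h0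
    obtain ⟨K, hK⟩ := (hreg s hs).exists_eq_T₂_mul (neg_eq_zero.1 h0.symm)
    rw [hξ]
    simp only
    rw [hK, ← Matrix.mul_assoc _ (T s), hS s hs, ← Matrix.mul_assoc S, hSS, Matrix.one_mul]
  have hξt : ξ t = 1 := by
    rw [hξ]
    simp only
    rw [hxt, hS t ht, hSS]
  have h1 := ((hT.hasMatDeriv le_rfl ht).mul (hξs.hasMatDeriv le_rfl ht)).congr hxξ ht
  have h2 := hx t ht
  rw [residual, h1.matD_eq hI ht, hξt, hxt, Matrix.mul_one, Matrix.mul_add, sub_eq_zero] at h2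
  have h3 : E t * (T t * matD (Icc tl tr) ξ t) = A t * T t - E t * matD (Icc tl tr) T t := by
    rw [← h2]; abel
  -- Since ξ(t) = 1, the equation for x = T ξ reads E T ξ̇ = A T - E Ṫ at `t`; multiplying by Tᵀ
  -- identifies ξ̇ as S J.
  have h4 : S * matD (Icc tl tr) ξ t = inherentJ E A (Icc tl tr) T t := by
    rw [← hS t ht, inherentJ, Matrix.mul_assoc, Matrix.mul_assoc, h3, Matrix.mul_sub,
      Matrix.mul_assoc, Matrix.mul_assoc]
  rw [← h4, ← Matrix.mul_assoc S, hSS, Matrix.one_mul, h3]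

end Adapted

/-! ### The inherent ODE -/

section InherentODE

variable {n μ : ℕ} {α δ : Type*} [Fintype α] [Fintype δ] [DecidableEq α] [DecidableEq δ]
  {E A : ℝ → Matrix (Fin n) (Fin n) ℝ} {I : Set ℝ} {t : ℝ}
  {Z₂ : ℝ → Matrix (Fin (μ + 1) × Fin n) α ℝ} {Z₁ : ℝ → Matrix (Fin n) δ ℝ}
  {Q : ℝ → Matrix (Fin n) (δ ⊕ α) ℝ}

/-- With a vanishing first block, Â₂ = Â₂₂ P₂ for the lower rows P₂ of Q⁻¹, so Â₂₂ inherits the full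
rank of Â₂. -/
theorem isUnit_redA₂₂ (h : (redA₂ A I μ Z₂ Q t).toCols₁ = 0)
    (hr : ((Z₂ t)ᵀ * arrayN A I μ t).rank = Fintype.card α)
    {P : Matrix (δ ⊕ α) (Fin n) ℝ} (hP : Q t * P = 1) : IsUnit (redA₂₂ A I μ Z₂ Q t) := by
  refine isUnit_of_rank_eq_card (le_antisymm (Matrix.rank_le_card_width _) ?_)
  have h1 : (Z₂ t)ᵀ * arrayN A I μ t = redA₂₂ A I μ Z₂ Q t * P.toRows₂ := by
    calc (Z₂ t)ᵀ * arrayN A I μ t = redA₂ A I μ Z₂ Q t * P := by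
          rw [redA₂, Matrix.mul_assoc _ (Q t), hP, Matrix.mul_one]
      _ = Matrix.fromCols (redA₂ A I μ Z₂ Q t).toCols₁ (redA₂ A I μ Z₂ Q t).toCols₂
          * Matrix.fromRows P.toRows₁ P.toRows₂ := by
          rw [Matrix.fromCols_toCols, Matrix.fromRows_toRows]
      _ = _ := by rw [Matrix.fromCols_mul_fromRows, h, Matrix.zero_mul, zero_add, redA₂₂]
  rw [← hr, h1]
  exact Matrix.rank_mul_le_left _ _

theorem solR_eq_zero (h : (redA₂ A I μ Z₂ Q t).toCols₁ = 0) : solR A I μ Z₂ Q t = 0 := by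
  rw [solR, h, Matrix.mul_zero, neg_zero]

theorem elimE_eq (h : (redA₂ A I μ Z₂ Q t).toCols₁ = 0) :
    elimE E A I μ Z₂ Z₁ Q t = (Z₁ t)ᵀ * E t * (Q t).toCols₁ := by
  rw [elimE, solR_eq_zero h, Matrix.mul_zero, add_zero]
  rfl

/-- Here R = 0 on `I`, so eliminating x₂ leaves the matrix part unchanged. `hG` multiplied by Z₁ᵀ
then determines the inherent matrix, and Z₁ cancels. -/
theorem inherentMatrix_eq (hI : UniqueDiffOn ℝ I) (ht : t ∈ I)
    (h : ∀ s ∈ I, (redA₂ A I μ Z₂ Q s).toCols₁ = 0)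
    (hu : IsUnit ((Z₁ t)ᵀ * E t * (Q t).toCols₁)) {G : Matrix δ δ ℝ}
    (hG : E t * ((Q t).toCols₁ * G)
      = A t * (Q t).toCols₁ - E t * matD I (fun s => (Q s).toCols₁) t) :
    inherentMatrix E A I μ Z₂ Z₁ Q t = G := by
  have hd : matD I (solR A I μ Z₂ Q) t = 0 := by
    rw [matD_congr (Y := fun _ => 0) (fun s hs => solR_eq_zero (h s hs)) ht,
      (hasMatDeriv_const 0).matD_eq hI ht]
  have h1 : (redA₁ E A I Z₁ Q t).toCols₁
      = (Z₁ t)ᵀ * (A t * (Q t).toCols₁ - E t * matD I (fun s => (Q s).toCols₁) t) := by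
    rw [Matrix.mul_sub, ← Matrix.mul_assoc, ← Matrix.mul_assoc]
    rfl
  rw [inherentMatrix, elimE_eq (h t ht), solR_eq_zero (h t ht), hd, Matrix.mul_zero, Matrix.mul_zero,
    add_zero, sub_zero, h1, ← hG, ← Matrix.mul_assoc (Z₁ t)ᵀ (E t),
    ← Matrix.mul_assoc ((Z₁ t)ᵀ * E t),
    Matrix.nonsing_inv_mul_cancel_left _ _ ((Matrix.isUnit_iff_isUnit_det _).1 hu)]

theorem jet_replicateCol (f : ℝ → Fin n → ℝ) :
    jet I μ (fun s => Matrix.replicateCol Unit (f s)) t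
      = Matrix.replicateCol Unit (arrayG f I μ t) := rfl

/-- The second block of the coordinates of a solution is determined by the algebraic equations. -/
theorem solr_eq (hI : UniqueDiffOn ℝ I) (ht : t ∈ I) (hE : SmoothOn μ E I) (hA : SmoothOn μ A I)
    (h : (redA₂ A I μ Z₂ Q t).toCols₁ = 0) (hu : IsUnit (redA₂₂ A I μ Z₂ Q t))
    (hZ : (Z₂ t)ᵀ * arrayM E A I μ t = 0) {f : ℝ → Fin n → ℝ} {u : ℝ → Matrix (Fin n) Unit ℝ}
    (hus : SmoothOn (μ + 1) u I)
    (hres : ∀ s ∈ I, residual E A I u s = Matrix.replicateCol Unit (f s))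
    {v : Matrix (δ ⊕ α) Unit ℝ} (hv : Q t * v = u t) :
    Matrix.replicateCol Unit (solr A f I μ Z₂ Q t) = v.toRows₂ := by
  have h1 := transpose_mul_jet_residual hI ht hE hA hus hZ
  rw [jet_congr hres ht, jet_replicateCol] at h1
  have h2 : (Z₂ t)ᵀ * arrayN A I μ t * u t = redA₂₂ A I μ Z₂ Q t * v.toRows₂ := by
    calc (Z₂ t)ᵀ * arrayN A I μ t * u t = redA₂ A I μ Z₂ Q t * v := by
          rw [redA₂, Matrix.mul_assoc _ (Q t), hv]
      _ = Matrix.fromCols (redA₂ A I μ Z₂ Q t).toCols₁ (redA₂ A I μ Z₂ Q t).toCols₂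
          * Matrix.fromRows v.toRows₁ v.toRows₂ := by
          rw [Matrix.fromCols_toCols, Matrix.fromRows_toRows]
      _ = _ := by rw [Matrix.fromCols_mul_fromRows, h, Matrix.zero_mul, zero_add, redA₂₂]
  have h3 : Matrix.replicateCol Unit (solr A f I μ Z₂ Q t)
      = -((redA₂₂ A I μ Z₂ Q t)⁻¹ * ((Z₂ t)ᵀ * Matrix.replicateCol Unit (arrayG f I μ t))) := by
    rw [← Matrix.replicateCol_mulVec, ← Matrix.replicateCol_mulVec]
    rfl
  rw [h3, h1, h2, Matrix.mul_neg, neg_neg,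
    Matrix.nonsing_inv_mul_cancel_left _ _ ((Matrix.isUnit_iff_isUnit_det _).1 hu)]

/-- The first block of the coordinates of a solution solves the inherent ODE. -/
theorem inherentForcing_eq (hI : UniqueDiffOn ℝ I) (ht : t ∈ I)
    (h : (redA₂ A I μ Z₂ Q t).toCols₁ = 0) (hu : IsUnit ((Z₁ t)ᵀ * E t * (Q t).toCols₁))
    {G : Matrix δ δ ℝ} (hG : E t * ((Q t).toCols₁ * G)
      = A t * (Q t).toCols₁ - E t * matD I (fun s => (Q s).toCols₁) t)
    {f : ℝ → Fin n → ℝ} {v : ℝ → Matrix (δ ⊕ α) Unit ℝ} (hQ : SmoothOn 1 Q I)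
    (hv : SmoothOn 1 v I)
    (hres : residual E A I (fun s => Q s * v s) t = Matrix.replicateCol Unit (f t))
    (hsol : ∀ s ∈ I, Matrix.replicateCol Unit (solr A f I μ Z₂ Q s) = (v s).toRows₂) :
    Matrix.replicateCol Unit (inherentForcing E A f I μ Z₂ Z₁ Q t)
      = (matD I v t).toRows₁ - G * (v t).toRows₁ := by
  have hd : Matrix.replicateCol Unit (vecD I (solr A f I μ Z₂ Q) t) = (matD I v t).toRows₂ := by
    ext i j
    exact derivWithin_congr (fun s hs => congrFun (congrFun (hsol s hs) i) j)
      (congrFun (congrFun (hsol t ht) i) j)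
  have h1 : Matrix.replicateCol Unit (inherentForcing E A f I μ Z₂ Z₁ Q t)
      = ((Z₁ t)ᵀ * E t * (Q t).toCols₁)⁻¹ * ((Z₁ t)ᵀ * Matrix.replicateCol Unit (f t)
          + (redA₁ E A I Z₁ Q t).toCols₂ * (v t).toRows₂
          - (redE₁ E Z₁ Q t).toCols₂ * (matD I v t).toRows₂) := by
    rw [← hsol t ht, ← hd, ← elimE_eq h]
    simp only [← Matrix.replicateCol_mulVec]
    rfl
  have hsplit : ∀ {ι : Type} (M : Matrix ι (δ ⊕ α) ℝ) (w : Matrix (δ ⊕ α) Unit ℝ),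
      M * w = M.toCols₁ * w.toRows₁ + M.toCols₂ * w.toRows₂ := by
    intro ι M w
    rw [← Matrix.fromCols_mul_fromRows, Matrix.fromCols_toCols, Matrix.fromRows_toRows]
  have hQd := ((hQ.hasMatDeriv le_rfl ht).mul (hv.hasMatDeriv le_rfl ht)).matD_eq hI ht
  rw [residual, hQd, hsplit (matD I Q t), hsplit (Q t), hsplit (Q t)] at hres
  rw [h1, ← hres]
  have e1 : (redA₁ E A I Z₁ Q t).toCols₂
      = (Z₁ t)ᵀ * (A t * (Q t).toCols₂) - (Z₁ t)ᵀ * (E t * (matD I Q t).toCols₂) := by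
    rw [← Matrix.mul_assoc, ← Matrix.mul_assoc]; rfl
  have e2 : (redE₁ E Z₁ Q t).toCols₂ = (Z₁ t)ᵀ * (E t * (Q t).toCols₂) := by
    rw [← Matrix.mul_assoc]; rfl
  have e3 : (matD I Q t).toCols₁ = matD I (fun s => (Q s).toCols₁) t := rfl
  -- All terms with x₂ and ẋ₂ cancel, and `hG` turns the terms with x₁ into Ê₁₁ G x₁.
  have key : (Z₁ t)ᵀ * (E t * ((matD I Q t).toCols₁ * (v t).toRows₁
        + (matD I Q t).toCols₂ * (v t).toRows₂
        + ((Q t).toCols₁ * (matD I v t).toRows₁ + (Q t).toCols₂ * (matD I v t).toRows₂))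
        - A t * ((Q t).toCols₁ * (v t).toRows₁ + (Q t).toCols₂ * (v t).toRows₂))
      + (redA₁ E A I Z₁ Q t).toCols₂ * (v t).toRows₂
      - (redE₁ E Z₁ Q t).toCols₂ * (matD I v t).toRows₂
      = (Z₁ t)ᵀ * E t * (Q t).toCols₁ * ((matD I v t).toRows₁ - G * (v t).toRows₁) := by
    have h2 : (Z₁ t)ᵀ * (E t * ((Q t).toCols₁ * (G * (v t).toRows₁)))
        = (Z₁ t)ᵀ * (A t * ((Q t).toCols₁ * (v t).toRows₁))
          - (Z₁ t)ᵀ * (E t * ((matD I Q t).toCols₁ * (v t).toRows₁)) := by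
      have := congrArg (fun M => (Z₁ t)ᵀ * (M * (v t).toRows₁)) hG
      simpa only [Matrix.mul_assoc, Matrix.mul_sub, Matrix.sub_mul, ← e3] using this
    rw [e1, e2]
    simp only [Matrix.mul_add, Matrix.mul_sub, Matrix.sub_mul, Matrix.mul_assoc, h2]
    abel
  rw [key, Matrix.nonsing_inv_mul_cancel_left _ _ ((Matrix.isUnit_iff_isUnit_det _).1 hu)]

end InherentODE

/-! ### Flows -/

section Flows

variable {p q : ℕ} {J : ℝ → Matrix (Fin p ⊕ Fin q) (Fin p ⊕ Fin q) ℝ} {tl tr : ℝ}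

theorem exists_isFlow {δ : Type*} [Fintype δ] [DecidableEq δ] (htl : tl < tr) {m : ℕ∞}
    {G : ℝ → Matrix δ δ ℝ} (hG : SmoothOn m G (Icc tl tr)) {s : ℝ} (hs : s ∈ Icc tl tr) :
    ∃ Φ : ℝ → Matrix δ δ ℝ, IsFlow G (Icc tl tr) s Φ := by
  obtain ⟨Φ, h0, -, h⟩ := exists_matODE_solution htl hG (smoothOn_const (0 : Matrix δ δ ℝ)) hs 1
  refine ⟨Φ, h0, fun t ht i j => ?_⟩
  have := h t ht i j
  rwa [add_zero] at this

/-- The derivative of Φᵀ S Φ is Φᵀ (Jᵀ + J) Φ = 0, so it keeps its initial value S. -/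
theorem IsFlow.mem_genOrthogonal (hJ : ∀ t ∈ Icc tl tr, (J t)ᵀ = -J t) {s : ℝ}
    (hs : s ∈ Icc tl tr) {Φ : ℝ → Matrix (Fin p ⊕ Fin q) (Fin p ⊕ Fin q) ℝ}
    (hΦ : IsFlow (fun t => (sigMatrix p q)⁻¹ * J t) (Icc tl tr) s Φ) {t : ℝ}
    (ht : t ∈ Icc tl tr) : Φ t ∈ genOrthogonal p q := by
  have hD : ∀ t ∈ Icc tl tr, HasMatDeriv (Icc tl tr) Φ (sigMatrix p q * J t * Φ t) t := by
    intro t ht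
    have h := hΦ.2 t ht
    rw [sigMatrix_inv] at h
    exact h
  have key : (Φ t)ᵀ * sigMatrix p q * Φ t = sigMatrix p q := by
    have h0 : (Φ s)ᵀ * sigMatrix p q * Φ s = sigMatrix p q := by
      rw [hΦ.1, Matrix.transpose_one, Matrix.one_mul, Matrix.mul_one]
    refine Eq.trans (HasMatDeriv.eq_of_zero
      (X := fun t => (Φ t)ᵀ * sigMatrix p q * Φ t) (fun r hr => ?_) ht hs) h0
    convert ((hD r hr).transpose.mul (hasMatDeriv_const (sigMatrix p q))).mul (hD r hr) using 1
    have hSS : ∀ M : Matrix (Fin p ⊕ Fin q) (Fin p ⊕ Fin q) ℝ,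
        sigMatrix p q * (sigMatrix p q * M) = M := fun M => by
      rw [← Matrix.mul_assoc, sigMatrix_mul_self, Matrix.one_mul]
    simp only [Matrix.transpose_mul, hJ r hr, sigMatrix_transpose, Matrix.mul_assoc, hSS,
      Matrix.mul_zero, add_zero, Matrix.neg_mul, Matrix.mul_neg, neg_add_cancel]
  refine ⟨?_, key⟩
  rw [Matrix.isUnit_iff_isUnit_det]
  refine Matrix.isUnit_det_of_left_inverse (B := sigMatrix p q * ((Φ t)ᵀ * sigMatrix p q)) ?_
  rw [Matrix.mul_assoc, key, sigMatrix_mul_self]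

end Flows

/-! ### Adapted transformations of regular skew-adjoint pairs -/

section Main

variable {n μ a p q : ℕ} {E A : ℝ → Matrix (Fin n) (Fin n) ℝ} {tl tr : ℝ}

/-- The row and column index types of `Q` differ, so Q⁻¹ is written as (QᵀQ)⁻¹ Qᵀ, which also
displays its smoothness. -/
theorem IsAdapted.exists_coordinates {I : Set ℝ} {m : ℕ∞}
    {Q : ℝ → Matrix (Fin n) ((Fin p ⊕ Fin q) ⊕ Fin a) ℝ} (hQ : IsAdapted E A I μ m Q)
    {κ : Type*} {u : ℝ → Matrix (Fin n) κ ℝ} (hu : SmoothOn m u I) :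
    ∃ v : ℝ → Matrix ((Fin p ⊕ Fin q) ⊕ Fin a) κ ℝ, SmoothOn m v I ∧
      ∀ t ∈ I, Q t * v t = u t := by
  have hunit : ∀ t ∈ I, IsUnit ((Q t)ᵀ * Q t) := by
    intro t ht
    obtain ⟨P, -, hP⟩ := hQ.nonsingular t ht
    exact isUnit_transpose_mul_self (rank_eq_card_of_mul_eq_one hP)
  refine ⟨fun t => ((Q t)ᵀ * Q t)⁻¹ * (Q t)ᵀ * u t,
    (((hQ.smooth.transpose.mul hQ.smooth).inv hunit).mul hQ.smooth.transpose).mul hu,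
    fun t ht => ?_⟩
  obtain ⟨P, hP, -⟩ := hQ.nonsingular t ht
  have h1 : ((Q t)ᵀ * Q t)⁻¹ * (Q t)ᵀ * Q t = 1 := by
    rw [Matrix.mul_assoc, Matrix.nonsing_inv_mul _
      ((Matrix.isUnit_iff_isUnit_det _).1 (hunit t ht))]
  have h2 : ((Q t)ᵀ * Q t)⁻¹ * (Q t)ᵀ = P := by
    rw [← Matrix.mul_one (((Q t)ᵀ * Q t)⁻¹ * (Q t)ᵀ), ← hP, ← Matrix.mul_assoc, h1,
      Matrix.one_mul]
  show Q t * (((Q t)ᵀ * Q t)⁻¹ * (Q t)ᵀ * u t) = u t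
  rw [h2, ← Matrix.mul_assoc, hP, Matrix.one_mul]

theorem IsAdapted.toCols₁_redA₂_eq_zero {I : Set ℝ} {m : ℕ∞}
    {Q : ℝ → Matrix (Fin n) ((Fin p ⊕ Fin q) ⊕ Fin a) ℝ} (hQ : IsAdapted E A I μ m Q)
    {Z₂ : ℝ → Matrix (Fin (μ + 1) × Fin n) (Fin a) ℝ}
    {T₂ Z₁ : ℝ → Matrix (Fin n) (Fin p ⊕ Fin q) ℝ} (hc : IsChoice E A I μ 1 Z₂ T₂ Z₁) {t : ℝ}
    (ht : t ∈ I) : (redA₂ A I μ Z₂ Q t).toCols₁ = 0 := by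
  obtain ⟨Z, hZ⟩ := hQ.isChoice
  exact (hZ.regularAt t ht).A₂_mul_T₂_of (hc.regularAt t ht).Z₂_mul_M

end Main

end LinDAE

end

/-! ### The inherent ODE of a regular skew-adjoint pair -/

theorem theorem4p4 (n μ : ℕ) :
    ∃ r : ℕ, ∀ (a d : ℕ) (tl tr : ℝ), tl < tr →
      ∀ (E A : ℝ → Matrix (Fin n) (Fin n) ℝ) (k : ℕ∞),
        LinDAE.SmoothOn (k + r) E (Set.Icc tl tr) →
        LinDAE.SmoothOn (k + r) A (Set.Icc tl tr) →
        LinDAE.Regular E A (Set.Icc tl tr) μ a d →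
        LinDAE.IsSkewAdjoint E A (Set.Icc tl tr) →
        ∃ p q : ℕ, p + q = d ∧
          -- an adapted transformation exists, orthogonal up to the first block of variables
          (∃ Q : ℝ → Matrix (Fin n) ((Fin p ⊕ Fin q) ⊕ Fin a) ℝ,
            LinDAE.IsAdapted E A (Set.Icc tl tr) μ (k + 1) Q ∧
            LinDAE.IsOrthogonalUpToFirstBlock (Set.Icc tl tr) (k + 1) Q) ∧
          -- every adapted transformation has the asserted properties
          ∀ Q : ℝ → Matrix (Fin n) ((Fin p ⊕ Fin q) ⊕ Fin a) ℝ,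
            LinDAE.IsAdapted E A (Set.Icc tl tr) μ (k + 1) Q →
            ∃ J : ℝ → Matrix (Fin p ⊕ Fin q) (Fin p ⊕ Fin q) ℝ,
              LinDAE.SmoothOn k J (Set.Icc tl tr) ∧
              (∀ t ∈ Set.Icc tl tr, (J t)ᵀ = -J t) ∧
              -- the inherent ODE can be formed, and its matrix is `S⁻¹ J`
              (∀ (Z₂ : ℝ → Matrix (Fin (μ + 1) × Fin n) (Fin a) ℝ)
                (T₂ Z₁ : ℝ → Matrix (Fin n) (Fin p ⊕ Fin q) ℝ),
                LinDAE.IsChoice E A (Set.Icc tl tr) μ 1 Z₂ T₂ Z₁ →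
                ∀ t ∈ Set.Icc tl tr,
                  IsUnit (LinDAE.redA₂₂ A (Set.Icc tl tr) μ Z₂ Q t) ∧
                  IsUnit (LinDAE.elimE E A (Set.Icc tl tr) μ Z₂ Z₁ Q t) ∧
                  LinDAE.inherentMatrix E A (Set.Icc tl tr) μ Z₂ Z₁ Q t
                    = (LinDAE.sigMatrix p q)⁻¹ * J t) ∧
              -- its inhomogeneity
              (∀ f : ℝ → Fin n → ℝ, LinDAE.VecSmoothOn (k + r) f (Set.Icc tl tr) →
                ∃ f₁ : ℝ → Fin p ⊕ Fin q → ℝ, LinDAE.VecSmoothOn k f₁ (Set.Icc tl tr) ∧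
                  ∀ (Z₂ : ℝ → Matrix (Fin (μ + 1) × Fin n) (Fin a) ℝ)
                    (T₂ Z₁ : ℝ → Matrix (Fin n) (Fin p ⊕ Fin q) ℝ),
                    LinDAE.IsChoice E A (Set.Icc tl tr) μ 1 Z₂ T₂ Z₁ →
                    ∀ t ∈ Set.Icc tl tr,
                      LinDAE.inherentForcing E A f (Set.Icc tl tr) μ Z₂ Z₁ Q t = f₁ t) ∧
              -- the flow exists and lies in `O(p, q)`
              (∀ s ∈ Set.Icc tl tr,
                (∃ Φ : ℝ → Matrix (Fin p ⊕ Fin q) (Fin p ⊕ Fin q) ℝ,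
                  LinDAE.IsFlow (fun t => (LinDAE.sigMatrix p q)⁻¹ * J t)
                    (Set.Icc tl tr) s Φ) ∧
                ∀ Φ : ℝ → Matrix (Fin p ⊕ Fin q) (Fin p ⊕ Fin q) ℝ,
                  LinDAE.IsFlow (fun t => (LinDAE.sigMatrix p q)⁻¹ * J t)
                    (Set.Icc tl tr) s Φ →
                  ∀ t ∈ Set.Icc tl tr, Φ t ∈ LinDAE.genOrthogonal p q) := by
  -- Forming M_μ and N_μ costs μ derivatives, which leaves the frame in class k + 4μ + 10. Below,
  -- orders 3μ + 3 and k + 2μ + 2 of the frame are used, so the constant is generous.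
  refine ⟨5 * μ + 10, fun a d tl tr htl E A k hE hA hreg hskew => ?_⟩
  have hI := uniqueDiffOn_Icc htl
  have hEt : ∀ t ∈ Icc tl tr, (E t)ᵀ = E t := fun t ht => (hskew t ht).1
  have hr : k + ((5 * μ + 10 : ℕ) : ℕ∞) = k + ((4 * μ + 9 : ℕ) : ℕ∞) + 1 + (μ : ℕ∞) := by
    push_cast
    ring
  obtain ⟨Z, U, hU⟩ := LinDAE.Regular.exists_isOrthogonalChoice htl (hr ▸ hE) (hr ▸ hA) hreg
  have hnat : ∀ c : ℕ, c ≤ 4 * μ + 9 → (c : ℕ∞) ≤ k + ((4 * μ + 9 : ℕ) : ℕ∞) + 1 := fun c hc =>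
    ((Nat.cast_le.2 hc).trans le_add_self).trans le_self_add
  have hkU : ∀ c : ℕ, c ≤ 4 * μ + 9 → k + (c : ℕ∞) ≤ k + ((4 * μ + 9 : ℕ) : ℕ∞) + 1 := fun c hc =>
    (by gcongr : k + (c : ℕ∞) ≤ k + ((4 * μ + 9 : ℕ) : ℕ∞)).trans le_self_add
  have hk : ∀ c : ℕ, c ≤ 5 * μ + 10 → k + (c : ℕ∞) ≤ k + ((5 * μ + 10 : ℕ) : ℕ∞) := fun c hc => by
    gcongr
  have hc : ∀ c : ℕ, c ≤ 5 * μ + 10 → (c : ℕ∞) ≤ k + ((5 * μ + 10 : ℕ) : ℕ∞) := fun c hc =>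
    (Nat.cast_le.2 hc).trans le_add_self
  have hk1 : k + 1 ≤ k + ((5 * μ + 10 : ℕ) : ℕ∞) := by exact_mod_cast hk 1 (by omega)
  have hE1 : LinDAE.SmoothOn 1 E (Icc tl tr) := hE.of_le (by exact_mod_cast hc 1 (by omega))
  have hμ : (μ : ℕ∞) ≤ k + ((5 * μ + 10 : ℕ) : ℕ∞) := hc μ (by omega)
  have hunit : ∀ t ∈ Icc tl tr, IsUnit (((U t).toCols₁)ᵀ * E t * (U t).toCols₁) := fun t ht =>
    (hU.of_le (by exact_mod_cast hnat (μ + 1 + μ + 1 + μ + 1) (by omega))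
      ).isUnit_transpose_mul_E_mul htl hskew
      (hE.of_le (by exact_mod_cast hc (μ + 1 + μ + 1 + μ + 1 + μ) (by omega)))
      (hA.of_le (by exact_mod_cast hc (μ + 1 + μ + 1 + μ + 1 + μ) (by omega))) ht
  obtain ⟨p, q, hpq, Q₀, hQ₀, hQ₀U⟩ := (hU.of_le (m' := k + 1) (by
    exact_mod_cast hkU 1 (by omega))).exists_isAdapted htl (hE.of_le hk1) hEt hunit
  refine ⟨p, q, hpq, ⟨Q₀, hQ₀, hQ₀U⟩, fun Q hQ => ?_⟩
  have hTs : LinDAE.SmoothOn (k + 1) (fun t => (Q t).toCols₁) (Icc tl tr) :=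
    fun i j => hQ.smooth i (Sum.inl j)
  have hT1 : LinDAE.SmoothOn 1 (fun t => (Q t).toCols₁) (Icc tl tr) := hTs.of_le le_add_self
  set J := LinDAE.inherentJ E A (Icc tl tr) (fun t => (Q t).toCols₁) with hJ
  have hkk : k ≤ k + ((5 * μ + 10 : ℕ) : ℕ∞) := le_self_add
  have hJs : LinDAE.SmoothOn k J (Icc tl tr) := by
    have hT := hTs.of_le (le_self_add : k ≤ k + 1)
    exact ((hT.transpose.mul (hA.of_le hkk)).mul hT).sub
      ((hT.transpose.mul (hE.of_le hkk)).mul (hTs.matD hI))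
  have hJt : ∀ t ∈ Icc tl tr, (J t)ᵀ = -J t := fun t ht =>
    LinDAE.transpose_inherentJ hI ht hskew hE1 hT1 hQ.congr_E
  obtain ⟨ZQ, hZQ⟩ := hQ.isChoice
  -- An identity in `Q` alone: neither Z₂, Z₁ nor f enters, and all the independence claims rest on
  -- it.
  have hframe : ∀ t ∈ Icc tl tr, E t * ((Q t).toCols₁ * ((LinDAE.sigMatrix p q)⁻¹ * J t))
      = A t * (Q t).toCols₁ - E t * LinDAE.matD (Icc tl tr) (fun s => (Q s).toCols₁) t := by
    intro t ht
    rw [LinDAE.sigMatrix_inv]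
    exact (hU.of_le (by exact_mod_cast hnat (μ + 1 + μ + 1) (by omega))).E_mul_frame htl hskew
      (hE.of_le (by exact_mod_cast hc (μ + 1 + μ + 1 + μ) (by omega)))
      (hA.of_le (by exact_mod_cast hc (μ + 1 + μ + 1 + μ) (by omega))) hT1 hZQ.regularAt
      hQ.congr_E (LinDAE.sigMatrix_mul_self p q) ht
  have hGs : LinDAE.SmoothOn k (fun t => (LinDAE.sigMatrix p q)⁻¹ * J t) (Icc tl tr) :=
    (LinDAE.smoothOn_const _).mul hJs
  have hu₂ : ∀ (Z₂ : ℝ → Matrix (Fin (μ + 1) × Fin n) (Fin a) ℝ)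
      (T₂ Z₁ : ℝ → Matrix (Fin n) (Fin p ⊕ Fin q) ℝ),
      LinDAE.IsChoice E A (Icc tl tr) μ 1 Z₂ T₂ Z₁ → ∀ t ∈ Icc tl tr,
        IsUnit (LinDAE.redA₂₂ A (Icc tl tr) μ Z₂ Q t) ∧
        IsUnit ((Z₁ t)ᵀ * E t * (Q t).toCols₁) := by
    intro Z₂ T₂ Z₁ hch t ht
    obtain ⟨P, hP, -⟩ := hQ.nonsingular t ht
    exact ⟨LinDAE.isUnit_redA₂₂ (hQ.toCols₁_redA₂_eq_zero hch ht) (hch.regularAt t ht).rank_A₂ hP,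
      (hZQ.regularAt t ht).isUnit_E₁_mul (hch.regularAt t ht)⟩
  refine ⟨J, hJs, hJt, fun Z₂ T₂ Z₁ hch t ht => ?_, fun f hf => ?_, fun s hs =>
    ⟨LinDAE.exists_isFlow htl hGs hs, fun Φ hΦ t ht => hΦ.mem_genOrthogonal hJt hs ht⟩⟩
  · refine ⟨(hu₂ Z₂ T₂ Z₁ hch t ht).1, ?_, LinDAE.inherentMatrix_eq hI ht
      (fun s hs => hQ.toCols₁_redA₂_eq_zero hch hs) (hu₂ Z₂ T₂ Z₁ hch t ht).2 (hframe t ht)⟩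
    rw [LinDAE.elimE_eq (hQ.toCols₁_redA₂_eq_zero hch ht)]
    exact (hu₂ Z₂ T₂ Z₁ hch t ht).2
  · have hfs : LinDAE.SmoothOn (k + ((5 * μ + 10 : ℕ) : ℕ∞))
        (fun t => Matrix.replicateCol Unit (f t)) (Icc tl tr) := fun i _ => hf i
    have e1 : k + ((μ + 1 : ℕ) : ℕ∞) + μ + 1 = k + ((2 * μ + 2 : ℕ) : ℕ∞) := by push_cast; ring
    have e2 : k + ((μ + 1 : ℕ) : ℕ∞) + μ + 1 + μ = k + ((3 * μ + 2 : ℕ) : ℕ∞) := by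
      push_cast; ring
    -- The solution is taken of class k + μ + 1: its coordinates need order k + 1, and its residual
    -- is differentiated μ times.
    obtain ⟨u, hus, hu, -⟩ := (hU.of_le (e1 ▸ hkU (2 * μ + 2) (by omega))).exists_residual_eq htl
      (j := k + ((μ + 1 : ℕ) : ℕ∞)) (by push_cast; exact le_add_self.trans le_add_self) hskew
      (hE.of_le (e2 ▸ hk (3 * μ + 2) (by omega))) (hA.of_le (e2 ▸ hk (3 * μ + 2) (by omega)))
      (hfs.of_le (e1 ▸ hk (2 * μ + 2) (by omega))) (left_mem_Icc.2 htl.le)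
    obtain ⟨v, hvs, hv⟩ := hQ.exists_coordinates
      (hus.of_le (by push_cast; gcongr; exact le_add_self : k + 1 ≤ k + ((μ + 1 : ℕ) : ℕ∞)))
    have hvs' : LinDAE.SmoothOn k (fun t => (LinDAE.matD (Icc tl tr) v t).toRows₁
        - (LinDAE.sigMatrix p q)⁻¹ * J t * (v t).toRows₁) (Icc tl tr) := by
      refine LinDAE.SmoothOn.sub (fun i j => hvs.matD hI (Sum.inl i) j) (hGs.mul fun i j => ?_)
      exact (hvs.of_le le_self_add) (Sum.inl i) j
    -- The inhomogeneity is v̇₁ - S⁻¹ J v₁ for the coordinates of the single solution `u`, fixed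
    -- before Z₂, T₂, Z₁ are introduced.
    refine ⟨fun t i => ((LinDAE.matD (Icc tl tr) v t).toRows₁
        - (LinDAE.sigMatrix p q)⁻¹ * J t * (v t).toRows₁) i (), fun i => hvs' i (), ?_⟩
    intro Z₂ T₂ Z₁ hch t ht
    have hsol : ∀ s ∈ Icc tl tr,
        Matrix.replicateCol Unit (LinDAE.solr A f (Icc tl tr) μ Z₂ Q s) = (v s).toRows₂ :=
      fun s hs => LinDAE.solr_eq hI hs (hE.of_le hμ) (hA.of_le hμ)
        (hQ.toCols₁_redA₂_eq_zero hch hs) (hu₂ Z₂ T₂ Z₁ hch s hs).1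
        (hch.regularAt s hs).Z₂_mul_M (hus.of_le (by push_cast; exact le_add_self)) hu (hv s hs)
    have hres : LinDAE.residual E A (Icc tl tr) (fun s => Q s * v s) t
        = Matrix.replicateCol Unit (f t) := by
      rw [← hu t ht, LinDAE.residual, LinDAE.residual, LinDAE.matD_congr hv ht, hv t ht]
    have h := LinDAE.inherentForcing_eq hI ht (hQ.toCols₁_redA₂_eq_zero hch ht)
      (hu₂ Z₂ T₂ Z₁ hch t ht).2 (hframe t ht) (hQ.smooth.of_le le_add_self)
      (hvs.of_le le_add_self) hres hsol
    funext i
    exact congrFun (congrFun h i) ()
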